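/- **Setting.** Let $d,T\ge 1$. In period $t=1,\dots,T$ a seller observes $x_t\in\mathcal X\subseteq\mathbb R^d$, sets a price $p_t$ and observes the demand $D_t=g(z_t^\top\theta^*)+\epsilon_t$, where $z_t=(x_t,p_tx_t)\in\mathbb R^{2d}$ and $\theta^*=(\beta^*;\gamma^*)\in\mathbb R^{2d}$ is unknown; the revenue is $p_tD_t$. For $\theta=(\beta;\gamma)$ put $r(p;\theta,x)=p\,g(x^\top\beta+x^\top\gamma\,p)$, $r^*(\theta,x)=\max_{p\ge 0}r(p;\theta,x)$, and $\Theta=\{\theta\in\mathbb R^{2d}:\|\theta\|_2\le\bar\theta\}$, $\bar\theta>0$. Write $\|v\|_M=\sqrt{v^\top Mv}$. **Estimation.** Fix $\lambda>0$ and let $h(u)=g'(g^{-1}(u))$, $$l_t(\theta)=-\int_{D_t}^{g(z_t^\top\theta)}\frac{u-D_t}{h(u)}\,du,\qquad F_t(\theta)=-\lambda\underline g\|\theta\|_2^2+\sum_{\tau\le t}l_\tau(\theta),\qquad M_t=\lambda I_{2d}+\sum_{\tau\le t}z_\tau z_\tau^\top,$$ $$\hat\theta_t\in\arg\max_{\theta\in\Theta}F_t(\theta),\qquad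 \alpha(M)=2\sqrt\lambda\,\bar\theta+\frac{2\bar\sigma}{\underline g}\sqrt{2\log T+\log\frac{\det M}{\lambda^{2d}}},$$ $$\bar\alpha=2\sqrt\lambda\,\bar\theta+\frac{2\bar\sigma}{\underline g}\sqrt{2\log T+2d\log\frac{2d\lambda+T}{2d\lambda}}.$$ The integrals defining $l_1,\dots,l_T$ on $\Theta$ are assumed to exist almost surely. **Algorithm (Thompson sampling with approximate quasi-MLE).** In period $t$ the seller has an approximate solution $\check\theta_{t-1}\in\Theta$ with gap $\Delta_{t-1}=F_{t-1}(\hat\theta_{t-1})-F_{t-1}(\check\theta_{t-1})$, observes $x_t$, samples $\eta_t\sim\mathcal N(0,I_{2d})$, and sets $$\tilde\theta_{t-1}=\check\theta_{t-1}+\Big(\sqrt{\tfrac{2}{\underline g}\Delta_{t-1}}+\alpha(M_{t-1})\Big)M_{t-1}^{-1/2}\eta_t,\qquad p_t\in\arg\max_{p\in[\underline p,\bar p]}r(p;\tilde\theta_{t-1},x_t).$$ There is a filtration $(\mathcal F_t)_{t\ge0}$ such that $x_t$ and $\check\theta_{t-1}$ are $\mathcal F_{t-1}$-measurable (the covariates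 may be any deterministic sequence in $\mathcal X$, or be chosen adversarially from the past), $\eta_t,p_t,\epsilon_t$ are $\mathcal F_t$-measurable, and $\eta_t$ is independent of $\mathcal F_{t-1}$. **Assumptions.** 1. $\theta^*\in\Theta$; $0\le\underline p$; for every $x\in\mathcal X$ some maximizer of $p\mapsto r(p;\theta^*,x)$ over $[0,\infty)$ lies in $(\underline p,\bar p)$; and $\|(x,px)\|_2\le 1$ for all $x\in\mathcal X$, $p\in[\underline p,\bar p]$. 2. Let $\mathcal G_{t-1}=\mathcal F_{t-1}\vee\sigma(\eta_t,p_t)$ be the information available just before the demand of period $t$ is realized. Then $\mathbb E[\epsilon_t\mid\mathcal G_{t-1}]=0$ and $\mathbb E[e^{s\epsilon_t}\mid\mathcal G_{t-1}]\le e^{\bar\sigma^2s^2/2}$ for all $s\in\mathbb R$, with $\bar\sigma>0$. 3. $\bar\Delta\in[0,\infty]$ and $\Delta_{t-1}\le\bar\Delta$ almost surely for $t=1,\dots,T$ (nothing is required if $\bar\Delta=\infty$). Let $$\tilde\Theta=\Big\{\theta\in\mathbb R^{2d}:\ \exists\,\theta'\in\Theta,\ \|\theta-\theta'\|_2\le 2\sqrt{d\log(4dT^2)}\,\Big(\bar\alpha+\sqrt{2\bar\Delta/\underline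 g}\Big)\Big\}$$ ($\tilde\Theta=\mathbb R^{2d}$ if $\bar\Delta=\infty$). The function $g:\mathbb R\to\mathbb R$ is strictly increasing and differentiable, and on the set of all $x^\top\beta+x^\top\gamma\,p$ with $x\in\mathcal X$, $(\beta;\gamma)\in\tilde\Theta$, $p\in[\underline p,\bar p]$ it is convex and satisfies $0<\underline g\le g'\le\bar g<\infty$. **Theorem.** Let $\lambda=1$. Then the expectations below exist, and the regret $\mathrm{Reg}_T=\mathbb E\big[\sum_{t=1}^T r^*(\theta^*,x_t)\big]-\mathbb E\big[\sum_{t=1}^T p_tD_t\big]$ (for a deterministic covariate sequence the first term is the sum itself) satisfies $$\mathrm{Reg}_T\le 8\bar g\bar p\sqrt{d\log(4dT^2)}\,\big(8\sqrt{e\pi}+1\big)\left(\bar\alpha\sqrt{Td\log\Big(\frac{2d+T}{2d}\Big)}+\frac{\sqrt2}{2\sqrt{\underline g}}\,\mathbb E\Big[\sum_{t=1}^T\sqrt{\Delta_{t-1}}\,\|z_t\|_{M_{t-1}^{-1}}\Big]\right)+2\bar p .$$ Moreover, if $\bar\Delta<\infty$, then $$\mathrm{Reg}_T\le 8\bar p\bar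 g d\,\big(8\sqrt{e\pi}+1\big)\left(\bar\alpha+\sqrt{\frac{2\bar\Delta}{\underline g}}\right)\sqrt{T\log(4dT^2)\log\Big(\frac{2d+T}{2d}\Big)}+2\bar p .$$ -/

import Mathlib

open MeasureTheory ProbabilityTheory
open scoped InnerProductSpace MatrixOrder

noncomputable section

/-- Covariate vectors `x ∈ ℝ^d`, with the Euclidean norm. -/
abbrev CovVec (d : ℕ) : Type := EuclideanSpace ℝ (Fin d)

/-- Concatenated vectors of `ℝ^{2d}`, with the Euclidean norm. The parameter `θ = (β; γ)` has
`β` as its `Sum.inl` coordinates and `γ` as its `Sum.inr` coordinates. -/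
abbrev ParVec (d : ℕ) : Type := EuclideanSpace ℝ (Fin d ⊕ Fin d)

/-- The vector `(x, p x) ∈ ℝ^{2d}`. -/
def feature {d : ℕ} (x : CovVec d) (p : ℝ) : ParVec d :=
  WithLp.toLp 2 (Sum.elim (fun i => x i) (fun i => p * x i))

/-- `⟪(x, p x), (β; γ)⟫ = xᵀβ + xᵀγ · p`. -/
theorem inner_feature {d : ℕ} (x : CovVec d) (p : ℝ) (θ : ParVec d) :
    ⟪feature x p, θ⟫_ℝ
      = (∑ i, x i * θ (Sum.inl i)) + (∑ i, x i * θ (Sum.inr i)) * p := by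
  simp only [feature, PiLp.inner_apply, Fintype.sum_sum_type, Sum.elim_inl, Sum.elim_inr,
    RCLike.inner_apply, conj_trivial, Finset.sum_mul]
  congr 1 <;> exact Finset.sum_congr rfl fun i _ => by ring

/-- The weighted norm `‖v‖_M = √(vᵀ M v)`. -/
def matNorm {d : ℕ} (M : Matrix (Fin d ⊕ Fin d) (Fin d ⊕ Fin d) ℝ) (v : ParVec d) : ℝ :=
  √((fun i => v i) ⬝ᵥ M.mulVec (fun i => v i))

/-- The data of the generalized linear demand model `D = g(xᵀβ* + xᵀγ* p) + ε`. -/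
structure PricingModel (d : ℕ) where
  /-- the link function `g` -/
  g : ℝ → ℝ
  /-- the true parameter `θ* = (β*; γ*)` -/
  θstar : ParVec d
  /-- the covariate domain `𝒳` -/
  X : Set (CovVec d)
  /-- the lowest feasible price -/
  pLo : ℝ
  /-- the highest feasible price -/
  pHi : ℝ
  /-- the radius of the parameter set -/
  θbar : ℝ
  /-- the lower bound for `g'` -/
  gLo : ℝ
  /-- the upper bound for `g'` -/
  gHi : ℝ
  /-- the sub-Gaussian constant of the demand shocks -/
  σ : ℝ

namespace PricingModel

variable {d : ℕ} (P : PricingModel d)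

/-- The parameter set `Θ`, the Euclidean ball of radius `θbar`. -/
def paramSet : Set (ParVec d) := {θ | ‖θ‖ ≤ P.θbar}

/-- The expected revenue `r(p; θ, x) = p · g(xᵀβ + xᵀγ p)`. -/
def revenue (p : ℝ) (θ : ParVec d) (x : CovVec d) : ℝ := p * P.g ⟪feature x p, θ⟫_ℝ

/-- The optimal expected revenue `r*(θ, x) = max_{p ≥ 0} r(p; θ, x)`. -/
def optRevenue (θ : ParVec d) (x : CovVec d) : ℝ :=
  sSup ((fun p => P.revenue p θ x) '' Set.Ici 0)

/-- Boundedness: `θ* ∈ Θ`; under the true parameter an optimal price over `[0, ∞)` exists in the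
interior of the feasible interval; the vectors `(x, p x)` lie in the unit ball. -/
structure Bounded : Prop where
  θbar_pos : 0 < P.θbar
  θstar_mem : P.θstar ∈ P.paramSet
  pLo_nonneg : 0 ≤ P.pLo
  optPrice_interior : ∀ x ∈ P.X, ∃ p ∈ Set.Ioo P.pLo P.pHi,
    IsMaxOn (fun q => P.revenue q P.θstar x) (Set.Ici 0) p
  feature_norm_le : ∀ x ∈ P.X, ∀ p ∈ Set.Icc P.pLo P.pHi, ‖feature x p‖ ≤ 1

/-- The confidence width
`α(M) = 2 √lam θbar + (2σ / gLo) √(2 log T + log (det M / lam^{2d}))`. -/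
def alpha (lam : ℝ) (T : ℕ) (M : Matrix (Fin d ⊕ Fin d) (Fin d ⊕ Fin d) ℝ) : ℝ :=
  2 * √lam * P.θbar
    + 2 * P.σ / P.gLo * √(2 * Real.log T + Real.log (M.det / lam ^ (2 * d)))

/-- The uniform bound for the confidence width,
`2 √lam θbar + (2σ / gLo) √(2 log T + 2d log ((2d lam + T) / (2d lam)))`. -/
def alphaBar (lam : ℝ) (T : ℕ) : ℝ :=
  2 * √lam * P.θbar
    + 2 * P.σ / P.gLo
      * √(2 * Real.log T + 2 * d * Real.log ((2 * d * lam + T) / (2 * d * lam)))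

/-- The enlarged parameter set: all `θ` within Euclidean distance
`2 √(d log(4dT²)) (alphaBar + √(2 Δbar / gLo))` of `Θ`. It is written as a union over the finite
`δ ≤ Δbar`, so that for `Δbar = ∞` it is the whole of `ℝ^{2d}`. -/
def enlargedSet (lam : ℝ) (T : ℕ) (Δbar : ENNReal) : Set (ParVec d) :=
  {θ | ∃ θ' ∈ P.paramSet, ∃ δ : ℝ, 0 ≤ δ ∧ ENNReal.ofReal δ ≤ Δbar ∧
    ‖θ - θ'‖ ≤ 2 * √(d * Real.log (4 * d * T ^ 2)) * (P.alphaBar lam T + √(2 * δ / P.gLo))}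

/-- The range of linear predictors `z = xᵀβ + xᵀγ p` with `x ∈ 𝒳`, `p` feasible and `(β; γ)` in
the enlarged parameter set. -/
def predictorRange (lam : ℝ) (T : ℕ) (Δbar : ENNReal) : Set ℝ :=
  {s | ∃ x ∈ P.X, ∃ p ∈ Set.Icc P.pLo P.pHi, ∃ θ ∈ P.enlargedSet lam T Δbar,
    s = ⟪feature x p, θ⟫_ℝ}

/-- The link function is strictly increasing and differentiable; on the range of linear
predictors it is convex and `0 < gLo ≤ g' ≤ gHi`. -/
structure LinkRegular (lam : ℝ) (T : ℕ) (Δbar : ENNReal) : Prop where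
  strictMono : StrictMono P.g
  differentiable : Differentiable ℝ P.g
  convex : ConvexOn ℝ (P.predictorRange lam T Δbar) P.g
  gLo_pos : 0 < P.gLo
  deriv_bounds : ∀ s ∈ P.predictorRange lam T Δbar, P.gLo ≤ deriv P.g s ∧ deriv P.g s ≤ P.gHi

/-- `h(u) = g'(g⁻¹(u))`. -/
def h (u : ℝ) : ℝ := deriv P.g (Function.invFun P.g u)

end PricingModel

/-- The random quantities generated by the approximate Thompson-sampling pricing algorithm.
Time is counted from `0`: `x t`, `η t`, `p t`, `ε t` belong to the `(t+1)`-st period, and `θhat t`,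
`θcheck t` are the exact and the approximate estimators computed from the first `t` periods. -/
structure PricingRun (d : ℕ) (Ω : Type*) where
  /-- covariates -/
  x : ℕ → Ω → CovVec d
  /-- Gaussian sampling vectors -/
  η : ℕ → Ω → ParVec d
  /-- prices -/
  p : ℕ → Ω → ℝ
  /-- demand shocks -/
  ε : ℕ → Ω → ℝ
  /-- exact regularized quasi-likelihood estimators -/
  θhat : ℕ → Ω → ParVec d
  /-- approximate estimators -/
  θcheck : ℕ → Ω → ParVec d

namespace PricingRun

variable {d : ℕ} {Ω : Type*} (P : PricingModel d) (R : PricingRun d Ω)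

/-- The observed regressor `z = (x, p x)` of a period. -/
def z (t : ℕ) (ω : Ω) : ParVec d := feature (R.x t ω) (R.p t ω)

/-- The realized demand `D = g(zᵀθ*) + ε`. -/
def demand (t : ℕ) (ω : Ω) : ℝ := P.g ⟪R.z t ω, P.θstar⟫_ℝ + R.ε t ω

/-- The design matrix `lam I + ∑_{τ < t} z_τ z_τᵀ` of the first `t` periods. -/
def design (lam : ℝ) (t : ℕ) (ω : Ω) : Matrix (Fin d ⊕ Fin d) (Fin d ⊕ Fin d) ℝ :=
  lam • (1 : Matrix (Fin d ⊕ Fin d) (Fin d ⊕ Fin d) ℝ)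
    + ∑ τ ∈ Finset.range t,
        Matrix.vecMulVec (fun i => R.z τ ω i) (fun i => R.z τ ω i)

/-- The quasi-log-likelihood of one observation,
`l(θ) = - ∫_{D}^{g(zᵀθ)} (1 / h(u)) (u - D) du`. -/
def quasiLik (t : ℕ) (ω : Ω) (θ : ParVec d) : ℝ :=
  -∫ u in (R.demand P t ω)..(P.g ⟪R.z t ω, θ⟫_ℝ), 1 / P.h u * (u - R.demand P t ω)

/-- The regularized quasi-likelihood of the first `t` periods,
`- lam gLo ‖θ‖² + ∑_{τ < t} l_τ(θ)`. -/
def objective (lam : ℝ) (t : ℕ) (ω : Ω) (θ : ParVec d) : ℝ :=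
  -(lam * P.gLo * ‖θ‖ ^ 2) + ∑ τ ∈ Finset.range t, R.quasiLik P τ ω θ

/-- The approximation gap `Δ` of the estimator computed from the first `t` periods. -/
def gap (lam : ℝ) (t : ℕ) (ω : Ω) : ℝ :=
  R.objective P lam t ω (R.θhat t ω) - R.objective P lam t ω (R.θcheck t ω)

/-- The sampled parameter `θcheck + (√(2 Δ / gLo) + α(M)) M^{-1/2} η`. -/
def sampled (lam : ℝ) (T t : ℕ) (ω : Ω) : ParVec d :=
  R.θcheck t ω
    + (√(2 / P.gLo * R.gap P lam t ω) + P.alpha lam T (R.design lam t ω))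
      • (WithLp.toLp 2
          ((CFC.sqrt (R.design lam t ω)⁻¹).mulVec (fun i => R.η t ω i)) : ParVec d)

variable {m : MeasurableSpace Ω} (μ : Measure Ω) (𝓕 : Filtration ℕ m)

/-- The information available when the price of a period has been set and its demand is not yet
realized: the past `𝓕 t` (past periods, current covariates, current approximate estimator), the
sampled Gaussian vector and the price. -/
abbrev priceInfo (t : ℕ) : MeasurableSpace Ω :=
  𝓕 t ⊔ MeasurableSpace.comap (R.η t) inferInstance ⊔ MeasurableSpace.comap (R.p t) inferInstance

/-- The demand shocks are martingale differences, conditionally sub-Gaussian with variance proxy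
`σ²`, given everything that precedes them. -/
structure SubGaussianShocks (T : ℕ) : Prop where
  σ_pos : 0 < P.σ
  measurable_shock : ∀ t < T, Measurable[𝓕 (t + 1)] (R.ε t)
  condExp_zero : ∀ t < T, μ[R.ε t | R.priceInfo 𝓕 t] =ᵐ[μ] 0
  integrable_exp : ∀ t < T, ∀ s : ℝ, Integrable (fun ω => Real.exp (s * R.ε t ω)) μ
  condExp_exp_le : ∀ t < T, ∀ s : ℝ,
    ∀ᵐ ω ∂μ, (μ[fun ω' => Real.exp (s * R.ε t ω') | R.priceInfo 𝓕 t]) ω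
      ≤ Real.exp (P.σ ^ 2 * s ^ 2 / 2)

/-- `R` is a run over `T` periods of the approximate Thompson-sampling pricing algorithm with
regularization parameter `lam`. The covariates may depend on the past in an arbitrary
non-anticipating way; `𝓕 t` contains the history of the first `t` periods, the covariates of the
next period and the current approximate estimator. -/
structure IsThompsonRun (lam : ℝ) (T : ℕ) : Prop where
  measurable_x : ∀ t < T, Measurable[𝓕 t] (R.x t)
  measurable_θcheck : ∀ t < T, Measurable[𝓕 t] (R.θcheck t)
  measurable_η : ∀ t < T, Measurable[𝓕 (t + 1)] (R.η t)
  measurable_p : ∀ t < T, Measurable[𝓕 (t + 1)] (R.p t)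
  x_mem : ∀ᵐ ω ∂μ, ∀ t < T, R.x t ω ∈ P.X
  /-- the integrals that define the quasi-likelihoods exist -/
  quasiLik_exists : ∀ᵐ ω ∂μ, ∀ t < T, ∀ θ ∈ P.paramSet,
    IntervalIntegrable (fun u => 1 / P.h u * (u - R.demand P t ω)) volume
      (R.demand P t ω) (P.g ⟪R.z t ω, θ⟫_ℝ)
  /-- `θhat t` maximizes the regularized quasi-likelihood over `Θ` -/
  θhat_argmax : ∀ᵐ ω ∂μ, ∀ t < T, R.θhat t ω ∈ P.paramSet ∧
    IsMaxOn (R.objective P lam t ω) P.paramSet (R.θhat t ω)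
  /-- `θcheck t` is a feasible approximate solution -/
  θcheck_mem : ∀ᵐ ω ∂μ, ∀ t < T, R.θcheck t ω ∈ P.paramSet
  /-- the sampling vector is a fresh standard Gaussian vector of `ℝ^{2d}` -/
  law_η : ∀ t < T, μ.map (R.η t) = stdGaussian (ParVec d)
  indep_η : ∀ t < T, Indep (MeasurableSpace.comap (R.η t) inferInstance) (𝓕 t) μ
  /-- the price maximizes the expected revenue of the sampled parameter -/
  price_argmax : ∀ᵐ ω ∂μ, ∀ t < T, R.p t ω ∈ Set.Icc P.pLo P.pHi ∧
    IsMaxOn (fun q => P.revenue q (R.sampled P lam T t ω) (R.x t ω))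
      (Set.Icc P.pLo P.pHi) (R.p t ω)

/-- The total benchmark revenue `∑_t r*(θ*, x_t)`. -/
def benchmark (T : ℕ) (ω : Ω) : ℝ := ∑ t ∈ Finset.range T, P.optRevenue P.θstar (R.x t ω)

/-- The total collected revenue `∑_t p_t D_t`. -/
def collected (T : ℕ) (ω : Ω) : ℝ := ∑ t ∈ Finset.range T, R.p t ω * R.demand P t ω

/-- The expected regret. For a deterministic covariate sequence the first integral is the sum
`∑_t r*(θ*, x_t)` itself. -/
def regret (T : ℕ) : ℝ := (∫ ω, R.benchmark P T ω ∂μ) - (∫ ω, R.collected P T ω ∂μ)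

/-- `∑_t √Δ_{t-1} ‖z_t‖_{M_{t-1}^{-1}}` in one-based time. -/
def gapSum (lam : ℝ) (T : ℕ) (ω : Ω) : ℝ :=
  ∑ t ∈ Finset.range T, √(R.gap P lam t ω) * matNorm (R.design lam t ω)⁻¹ (R.z t ω)

end PricingRun

end

/-! Fix a period and split its regret at the chosen price `p` and sampled parameter `θ̃`: `r*(θ*) -
r(p; θ*) = [r*(θ*) - r*(θ̃)] + [r(p; θ̃) - r(p; θ*)]`. Everything is compared with the width of the
confidence ellipsoid in the direction of the observed regressor, that is `(√(2Δ/gLo) + α(M))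
‖z‖_{M⁻¹}`.

Coverage. The integral of the link function is strongly convex on the predictor range, so the
objective is strongly concave in the norm of `M`. Hence `θcheck` is within `√(2Δ/gLo)` of `θhat`,
and `θhat` is within `2θbar + s/gLo` of `θ*`, where `s` bounds the dual norm of the score
(`designSq_le_of_isMaxOn`, `sqrt_designSq_le_of_score`). The score is a self-normalized sum of
shocks. Mixing exponential supermartingales over a Gaussian and applying Markov's inequality bounds
it outside probability `T⁻²` (`measure_selfNormalized_gt_le`). On this event and on `‖η‖ ≤ ρ`, with
`ρ = 2√(d log(4dT²))`, the Lipschitz bound for `g` makes the second bracket at most `pHi gHi (ρ +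
1)` times the width.

Optimism. The first bracket is at most the worst shortfall `V` over all sampling vectors of norm at
most `ρ`, and `V` depends on the past only. Because `g` is increasing, a sample is optimistic as
soon as `η` exceeds one standard deviation in one particular direction. Given the past this has
probability at least 0.06, hence at least 0.05 after truncation to radius `ρ` when `T ≥ 10`. For an
optimistic sample, comparing two sampled parameters at the chosen price gives `V ≤ 2ρ pHi gHi ·
width`. Since `V` is independent of `η`, it follows that `0.05 E[V] ≤ 2ρ pHi gHi E[width]`
(`mul_lintegral_le_of_indepFun`, `PricingRun.lintegral_coveredShortfall_le`). The unknown direction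
of the optimal price is thus traded for the regressor actually observed.

Summation. One period costs at most `pHi gHi (41ρ + 1) E[width]` plus a crude bound on events of
probability `2T⁻²`. The elliptical potential bound (`sum_inv_quadForm_le`) and Cauchy-Schwarz
control the sum of `‖z‖_{M⁻¹}`, and the lower-order terms are absorbed since `2θbar ≤ alphaBar`. For
`T < 10` the crude bound is enough. -/

set_option linter.unusedSectionVars false

/-! ### Rank-one updates, determinants and the elliptical potential -/

section RankOneUpdates

open Matrix

variable {ι : Type*} [Fintype ι] [DecidableEq ι]

/-- The regularized Gram matrix `I + ∑_{τ < t} z_τ z_τᵀ`. -/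
noncomputable def gramMatrix (z : ℕ → ι → ℝ) (t : ℕ) : Matrix ι ι ℝ :=
  1 + ∑ τ ∈ Finset.range t, vecMulVec (z τ) (z τ)

theorem gramMatrix_zero (z : ℕ → ι → ℝ) : gramMatrix z 0 = 1 := by simp [gramMatrix]

theorem gramMatrix_succ (z : ℕ → ι → ℝ) (t : ℕ) :
    gramMatrix z (t + 1) = gramMatrix z t + vecMulVec (z t) (z t) := by
  simp [gramMatrix, Finset.sum_range_succ, add_assoc]

theorem posSemidef_vecMulVec_self (a : ι → ℝ) : (vecMulVec a a).PosSemidef := by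
  simpa using posSemidef_vecMulVec_self_star a

theorem gramMatrix_posDef (z : ℕ → ι → ℝ) (t : ℕ) : (gramMatrix z t).PosDef :=
  PosDef.one.add_posSemidef (posSemidef_sum _ fun τ _ => posSemidef_vecMulVec_self (z τ))

theorem dotProduct_vecMulVec_mulVec_self (a v : ι → ℝ) :
    v ⬝ᵥ vecMulVec a a *ᵥ v = (a ⬝ᵥ v) ^ 2 := by
  rw [vecMulVec_mulVec, op_smul_eq_smul, dotProduct_smul, dotProduct_comm v a, smul_eq_mul, sq]

theorem dotProduct_gramMatrix_mulVec (z : ℕ → ι → ℝ) (t : ℕ) (v : ι → ℝ) :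
    v ⬝ᵥ gramMatrix z t *ᵥ v = v ⬝ᵥ v + ∑ τ ∈ Finset.range t, (z τ ⬝ᵥ v) ^ 2 := by
  simp only [gramMatrix, add_mulVec, one_mulVec, dotProduct_add, sum_mulVec, dotProduct_sum,
    dotProduct_vecMulVec_mulVec_self]

theorem dotProduct_self_le_gramMatrix (z : ℕ → ι → ℝ) (t : ℕ) (v : ι → ℝ) :
    v ⬝ᵥ v ≤ v ⬝ᵥ gramMatrix z t *ᵥ v := by
  rw [dotProduct_gramMatrix_mulVec]
  exact le_add_of_nonneg_right (Finset.sum_nonneg fun _ _ => sq_nonneg _)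

theorem dotProduct_mulVec_symm {A : Matrix ι ι ℝ} (hA : A.IsHermitian) (u v : ι → ℝ) :
    u ⬝ᵥ A *ᵥ v = v ⬝ᵥ A *ᵥ u := by
  have h : Aᵀ = A := by rw [← conjTranspose_eq_transpose_of_trivial]; exact hA
  rw [dotProduct_mulVec, ← mulVec_transpose, h, dotProduct_comm]

theorem Matrix.PosDef.mulVec_inv_mulVec {A : Matrix ι ι ℝ} (hA : A.PosDef) (v : ι → ℝ) :
    A *ᵥ (A⁻¹ *ᵥ v) = v := by
  rw [mulVec_mulVec, mul_nonsing_inv _ ((isUnit_iff_isUnit_det _).1 hA.isUnit), one_mulVec]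

theorem Matrix.PosDef.inv_mulVec_mulVec {A : Matrix ι ι ℝ} (hA : A.PosDef) (v : ι → ℝ) :
    A⁻¹ *ᵥ (A *ᵥ v) = v := by
  rw [mulVec_mulVec, nonsing_inv_mul _ ((isUnit_iff_isUnit_det _).1 hA.isUnit), one_mulVec]

theorem Matrix.PosDef.inv_quadForm_nonneg {A : Matrix ι ι ℝ} (hA : A.PosDef) (v : ι → ℝ) :
    0 ≤ v ⬝ᵥ A⁻¹ *ᵥ v := by
  simpa using hA.inv.posSemidef.dotProduct_mulVec_nonneg v

/-- The matrix determinant lemma. It makes `log det` telescope in the elliptical potential and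
supplies the normalizing factor of the supermartingale. -/
theorem det_add_vecMulVec_self {A : Matrix ι ι ℝ} (hA : A.PosDef) (u : ι → ℝ) :
    (A + vecMulVec u u).det = A.det * (1 + u ⬝ᵥ A⁻¹ *ᵥ u) := by
  rw [vecMulVec_eq Unit,
    det_add_replicateCol_mul_replicateRow ((isUnit_iff_isUnit_det _).1 hA.isUnit)]
  congr 1
  rw [det_unique, Matrix.mul_assoc]
  simp [Matrix.mul_apply, dotProduct, mulVec, replicateRow, replicateCol]

/-- The Sherman-Morrison formula in quadratic form. Solving `A y + (u ⬝ᵥ y) u = v` for `y` leaves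
only the scalar `u ⬝ᵥ y` unknown, and pairing with `u` determines it. -/
theorem inv_quadForm_add_vecMulVec {A : Matrix ι ι ℝ} (hA : A.PosDef) (u v : ι → ℝ) :
    v ⬝ᵥ (A + vecMulVec u u)⁻¹ *ᵥ v
      = v ⬝ᵥ A⁻¹ *ᵥ v - (u ⬝ᵥ A⁻¹ *ᵥ v) ^ 2 / (1 + u ⬝ᵥ A⁻¹ *ᵥ u) := by
  have hB : (A + vecMulVec u u).PosDef := hA.add_posSemidef (posSemidef_vecMulVec_self u)
  have hq := hA.inv_quadForm_nonneg u
  have hsym := dotProduct_mulVec_symm hA.inv.isHermitian v u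
  obtain ⟨y, hy⟩ : ∃ y, y = (A + vecMulVec u u)⁻¹ *ᵥ v := ⟨_, rfl⟩
  have h1 : A *ᵥ y + (u ⬝ᵥ y) • u = v := by
    have := hB.mulVec_inv_mulVec v
    rw [← hy, add_mulVec, vecMulVec_mulVec, op_smul_eq_smul] at this
    exact this
  have h2 : y = A⁻¹ *ᵥ v - (u ⬝ᵥ y) • A⁻¹ *ᵥ u := by
    have h3 : A *ᵥ y = v - (u ⬝ᵥ y) • u := eq_sub_of_add_eq h1
    rw [← mulVec_smul, ← mulVec_sub, ← h3, hA.inv_mulVec_mulVec]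
  have h4 : (u ⬝ᵥ y) * (1 + u ⬝ᵥ A⁻¹ *ᵥ u) = u ⬝ᵥ A⁻¹ *ᵥ v := by
    have := congrArg (fun w => u ⬝ᵥ w) h2
    simp only [dotProduct_sub, dotProduct_smul, smul_eq_mul] at this
    linarith
  have h5 : v ⬝ᵥ y = v ⬝ᵥ A⁻¹ *ᵥ v - (u ⬝ᵥ y) * (v ⬝ᵥ A⁻¹ *ᵥ u) := by
    have := congrArg (fun w => v ⬝ᵥ w) h2
    simpa only [dotProduct_sub, dotProduct_smul, smul_eq_mul] using this
  rw [← hy, h5, hsym, ← h4]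
  field_simp

/-- How the inverse quadratic form changes when the same vector updates matrix and argument. -/
theorem inv_quadForm_update {A : Matrix ι ι ℝ} (hA : A.PosDef) (u v : ι → ℝ) (e : ℝ) :
    (v + e • u) ⬝ᵥ (A + vecMulVec u u)⁻¹ *ᵥ (v + e • u)
      = v ⬝ᵥ A⁻¹ *ᵥ v
        + (2 * e * (u ⬝ᵥ A⁻¹ *ᵥ v) + e ^ 2 * (u ⬝ᵥ A⁻¹ *ᵥ u) - (u ⬝ᵥ A⁻¹ *ᵥ v) ^ 2)
          / (1 + u ⬝ᵥ A⁻¹ *ᵥ u) := by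
  have hq := hA.inv_quadForm_nonneg u
  have hsym := dotProduct_mulVec_symm hA.inv.isHermitian v u
  rw [inv_quadForm_add_vecMulVec hA]
  simp only [mulVec_add, mulVec_smul, dotProduct_add, add_dotProduct, smul_dotProduct,
    dotProduct_smul, smul_eq_mul, hsym]
  field_simp
  ring

/-- With `w = A⁻¹ u`, the hypothesis reads `|w|² ≤ u ⬝ᵥ w`; combine it with `|u - w|² ≥ 0`. -/
theorem inv_quadForm_le {A : Matrix ι ι ℝ} (hA : A.PosDef) (h1 : ∀ v, v ⬝ᵥ v ≤ v ⬝ᵥ A *ᵥ v)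
    (u : ι → ℝ) : u ⬝ᵥ A⁻¹ *ᵥ u ≤ u ⬝ᵥ u := by
  have h := h1 (A⁻¹ *ᵥ u)
  rw [hA.mulVec_inv_mulVec, dotProduct_comm _ u] at h
  have h2 : 0 ≤ (u - A⁻¹ *ᵥ u) ⬝ᵥ (u - A⁻¹ *ᵥ u) := by
    simpa using dotProduct_star_self_nonneg (u - A⁻¹ *ᵥ u)
  simp only [dotProduct_sub, sub_dotProduct] at h2
  rw [dotProduct_comm (A⁻¹ *ᵥ u) u] at h2
  linarith

theorem det_gramMatrix_succ (z : ℕ → ι → ℝ) (t : ℕ) :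
    (gramMatrix z (t + 1)).det
      = (gramMatrix z t).det * (1 + z t ⬝ᵥ (gramMatrix z t)⁻¹ *ᵥ z t) := by
  rw [gramMatrix_succ, det_add_vecMulVec_self (gramMatrix_posDef z t)]

theorem one_le_det_gramMatrix (z : ℕ → ι → ℝ) (t : ℕ) : 1 ≤ (gramMatrix z t).det := by
  induction t with
  | zero => simp [gramMatrix_zero]
  | succ t ih =>
    rw [det_gramMatrix_succ]
    have := (gramMatrix_posDef z t).inv_quadForm_nonneg (z t)
    nlinarith

theorem trace_gramMatrix (z : ℕ → ι → ℝ) (t : ℕ) :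
    (gramMatrix z t).trace = Fintype.card ι + ∑ τ ∈ Finset.range t, z τ ⬝ᵥ z τ := by
  simp [gramMatrix, trace_add, trace_sum, trace_vecMulVec]

/-- The determinant-trace inequality for the Gram matrix of vectors in the unit ball. -/
theorem log_det_gramMatrix_le [Nonempty ι] (z : ℕ → ι → ℝ) (t T : ℕ) (htT : t ≤ T)
    (hz : ∀ τ < t, z τ ⬝ᵥ z τ ≤ 1) :
    Real.log (gramMatrix z t).det
      ≤ Fintype.card ι * Real.log ((Fintype.card ι + T) / Fintype.card ι) := by
  have hA := gramMatrix_posDef z t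
  have hn : (0 : ℝ) < Fintype.card ι := by exact_mod_cast Fintype.card_pos
  obtain ⟨a, ha⟩ : ∃ a : ℝ, a = (Fintype.card ι + T) / Fintype.card ι := ⟨_, rfl⟩
  have ha0 : 0 < a := by rw [ha]; positivity
  have htr : ∑ i, hA.1.eigenvalues i ≤ Fintype.card ι * a := by
    have h1 := hA.1.trace_eq_sum_eigenvalues
    have h2 : ∑ τ ∈ Finset.range t, z τ ⬝ᵥ z τ ≤ T := by
      calc ∑ τ ∈ Finset.range t, z τ ⬝ᵥ z τ ≤ ∑ τ ∈ Finset.range t, (1 : ℝ) :=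
            Finset.sum_le_sum fun τ hτ => hz τ (Finset.mem_range.1 hτ)
        _ ≤ T := by simpa using htT
    rw [trace_gramMatrix] at h1
    simp only [RCLike.ofReal_real_eq_id, id_eq] at h1
    rw [← h1, ha, mul_div_cancel₀ _ hn.ne']
    linarith
  rw [hA.1.det_eq_prod_eigenvalues, ← ha]
  simp only [RCLike.ofReal_real_eq_id, id_eq]
  rw [Real.log_prod fun i _ => (hA.eigenvalues_pos i).ne']
  -- In place of the arithmetic-geometric mean inequality: the tangent to `log` at `a`, an upper
  -- bound for the mean eigenvalue.
  calc ∑ i, Real.log (hA.1.eigenvalues i)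
      ≤ ∑ i, (hA.1.eigenvalues i / a - 1 + Real.log a) := by
        refine Finset.sum_le_sum fun i _ => ?_
        have h := Real.log_le_sub_one_of_pos (div_pos (hA.eigenvalues_pos i) ha0)
        rw [Real.log_div (hA.eigenvalues_pos i).ne' ha0.ne'] at h
        linarith
    _ = (∑ i, hA.1.eigenvalues i) / a - Fintype.card ι + Fintype.card ι * Real.log a := by
        simp [Finset.sum_add_distrib, Finset.sum_sub_distrib, Finset.sum_div]
    _ ≤ Fintype.card ι * Real.log a := by
        have : (∑ i, hA.1.eigenvalues i) / a ≤ Fintype.card ι := by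
          rw [div_le_iff₀ ha0]; exact htr
        linarith

/-- The elliptical potential bound. -/
theorem sum_inv_quadForm_le (z : ℕ → ι → ℝ) (T : ℕ) (hz : ∀ τ < T, z τ ⬝ᵥ z τ ≤ 1) :
    ∑ t ∈ Finset.range T, z t ⬝ᵥ (gramMatrix z t)⁻¹ *ᵥ z t
      ≤ 2 * Real.log (gramMatrix z T).det := by
  induction T with
  | zero => simp [gramMatrix_zero]
  | succ T ih =>
    rw [Finset.sum_range_succ, det_gramMatrix_succ]
    have h0 := (gramMatrix_posDef z T).inv_quadForm_nonneg (z T)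
    have h1 := (inv_quadForm_le (gramMatrix_posDef z T) (dotProduct_self_le_gramMatrix z T)
      (z T)).trans (hz T (Nat.lt_succ_self T))
    have h2 := one_le_det_gramMatrix z T
    rw [Real.log_mul (by positivity) (by positivity)]
    have h3 := ih fun τ hτ => hz τ (hτ.trans (Nat.lt_succ_self T))
    obtain ⟨q, hq⟩ : ∃ q, q = z T ⬝ᵥ (gramMatrix z T)⁻¹ *ᵥ z T := ⟨_, rfl⟩
    rw [← hq] at h0 h1 ⊢
    -- For `0 ≤ q ≤ 1`, `log (1 + q) ≥ q / (1 + q) ≥ q / 2`. The bound `q ≤ 1` comes from `M ≥ I`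
    -- and `|z| ≤ 1`.
    have h4 : q ≤ 2 * Real.log (1 + q) := by
      have := Real.one_sub_inv_le_log_of_pos (show 0 < 1 + q by linarith)
      have h5 : q / 2 ≤ 1 - (1 + q)⁻¹ := by
        rw [show 1 - (1 + q)⁻¹ = q / (1 + q) by field_simp; ring]
        gcongr
        linarith
      linarith
    linarith

theorem sum_sqrt_inv_quadForm_le [Nonempty ι] (z : ℕ → ι → ℝ) (T : ℕ)
    (hz : ∀ τ < T, z τ ⬝ᵥ z τ ≤ 1) :
    ∑ t ∈ Finset.range T, √(z t ⬝ᵥ (gramMatrix z t)⁻¹ *ᵥ z t)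
      ≤ √(2 * T * (Fintype.card ι * Real.log ((Fintype.card ι + T) / Fintype.card ι))) := by
  refine Real.le_sqrt_of_sq_le ?_
  calc (∑ t ∈ Finset.range T, √(z t ⬝ᵥ (gramMatrix z t)⁻¹ *ᵥ z t)) ^ 2
      ≤ (Finset.range T).card * ∑ t ∈ Finset.range T,
          √(z t ⬝ᵥ (gramMatrix z t)⁻¹ *ᵥ z t) ^ 2 := sq_sum_le_card_mul_sum_sq
    _ = T * ∑ t ∈ Finset.range T, z t ⬝ᵥ (gramMatrix z t)⁻¹ *ᵥ z t := by
        rw [Finset.card_range]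
        congr 1
        exact Finset.sum_congr rfl fun t _ =>
          Real.sq_sqrt ((gramMatrix_posDef z t).inv_quadForm_nonneg _)
    _ ≤ T * (2 * (Fintype.card ι * Real.log ((Fintype.card ι + T) / Fintype.card ι))) := by
        gcongr
        exact (sum_inv_quadForm_le z T hz).trans
          (by gcongr; exact log_det_gramMatrix_le z T T le_rfl hz)
    _ = _ := by ring

end RankOneUpdates

/-! ### Inverse square roots, dual norms, and measurability of matrix functions -/

section InverseSqrt

open Matrix

variable {ι : Type*} [Fintype ι] [DecidableEq ι] {A : Matrix ι ι ℝ}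

theorem Matrix.PosDef.sqrt_inv_mul_self (hA : A.PosDef) :
    CFC.sqrt A⁻¹ * CFC.sqrt A⁻¹ = A⁻¹ :=
  CFC.sqrt_mul_sqrt_self _ hA.inv.posSemidef.nonneg

theorem Matrix.PosDef.sqrt_inv_isHermitian (_hA : A.PosDef) : (CFC.sqrt A⁻¹).IsHermitian :=
  (Matrix.nonneg_iff_posSemidef.1 (CFC.sqrt_nonneg A⁻¹)).isHermitian

theorem Matrix.PosDef.sqrt_inv_dotProduct (hA : A.PosDef) (u v : ι → ℝ) :
    (CFC.sqrt A⁻¹ *ᵥ u) ⬝ᵥ (CFC.sqrt A⁻¹ *ᵥ v) = u ⬝ᵥ A⁻¹ *ᵥ v := by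
  rw [dotProduct_comm, dotProduct_mulVec_symm hA.sqrt_inv_isHermitian, mulVec_mulVec,
    hA.sqrt_inv_mul_self]

/-- The Cauchy-Schwarz inequality for the dual pair of weighted norms. -/
theorem Matrix.PosDef.dotProduct_le_sqrt_mul_sqrt (hA : A.PosDef) (u v : ι → ℝ) :
    |u ⬝ᵥ v| ≤ √(u ⬝ᵥ A⁻¹ *ᵥ u) * √(v ⬝ᵥ A *ᵥ v) := by
  have h1 : u ⬝ᵥ v = (CFC.sqrt A⁻¹ *ᵥ u) ⬝ᵥ (CFC.sqrt A⁻¹ *ᵥ (A *ᵥ v)) := by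
    rw [hA.sqrt_inv_dotProduct, hA.inv_mulVec_mulVec]
  have h2 : v ⬝ᵥ A *ᵥ v
      = (CFC.sqrt A⁻¹ *ᵥ (A *ᵥ v)) ⬝ᵥ (CFC.sqrt A⁻¹ *ᵥ (A *ᵥ v)) := by
    rw [hA.sqrt_inv_dotProduct, hA.inv_mulVec_mulVec, dotProduct_comm]
  rw [h1, h2, ← hA.sqrt_inv_dotProduct u u]
  have h := abs_real_inner_le_norm (WithLp.toLp 2 (CFC.sqrt A⁻¹ *ᵥ u))
    (WithLp.toLp 2 (CFC.sqrt A⁻¹ *ᵥ (A *ᵥ v)))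
  simp only [EuclideanSpace.norm_eq, Real.norm_eq_abs, sq_abs] at h
  convert h using 2
  · simp [PiLp.inner_apply, dotProduct, mul_comm]
  · simp [dotProduct, sq]
  · simp [dotProduct, sq]

/-- The square root is continuous on the cone of positive semidefinite matrices, so the map is
factored through that cone as a subtype. -/
theorem measurable_sqrt_apply {Ω : Type*} [MeasurableSpace Ω] {B : Ω → Matrix ι ι ℝ}
    (hB : ∀ i j, Measurable fun ω => B ω i j) (h0 : ∀ ω, (B ω).PosSemidef) (i j : ι) :
    Measurable fun ω => CFC.sqrt (B ω) i j := by
  let _ : MeasurableSpace (Matrix ι ι ℝ) := MeasurableSpace.pi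
  have _ : BorelSpace (Matrix ι ι ℝ) := inferInstanceAs (BorelSpace (ι → ι → ℝ))
  have hB' : Measurable B := measurable_pi_iff.2 fun i => measurable_pi_iff.2 fun j => hB i j
  have hc : ContinuousOn (CFC.sqrt : Matrix ι ι ℝ → Matrix ι ι ℝ) {a | 0 ≤ a} := by
    open scoped Matrix.Norms.L2Operator in
    exact CFC.continuousOn_sqrt
  have h1 : Continuous fun a : {a : Matrix ι ι ℝ | 0 ≤ a} => CFC.sqrt (a : Matrix ι ι ℝ) :=
    continuousOn_iff_continuous_domRestrict.1 hc
  have h2 := h1.measurable.comp (hB'.subtype_mk (h := fun ω => (h0 ω).nonneg))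
  exact measurable_pi_iff.1 (measurable_pi_iff.1 h2 i) j

/-- The inverse is the adjugate divided by the determinant, both polynomial in the entries; with
total division no invertibility is needed. -/
theorem measurable_inv_apply {Ω : Type*} [MeasurableSpace Ω] {B : Ω → Matrix ι ι ℝ}
    (hB : ∀ i j, Measurable fun ω => B ω i j) (i j : ι) :
    Measurable fun ω => (B ω)⁻¹ i j := by
  let _ : MeasurableSpace (Matrix ι ι ℝ) := MeasurableSpace.pi
  have _ : BorelSpace (Matrix ι ι ℝ) := inferInstanceAs (BorelSpace (ι → ι → ℝ))
  have hB' : Measurable B := measurable_pi_iff.2 fun i => measurable_pi_iff.2 fun j => hB i j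
  have h1 : Measurable fun ω => (B ω).det := (continuous_id.matrix_det).measurable.comp hB'
  have h2 : Measurable fun ω => (B ω).adjugate i j :=
    ((continuous_id.matrix_adjugate).matrix_elem i j).measurable.comp hB'
  simp only [Matrix.inv_def, Matrix.smul_apply, smul_eq_mul, Ring.inverse_eq_inv']
  exact h1.inv.mul h2

theorem measurable_det {Ω : Type*} [MeasurableSpace Ω] {B : Ω → Matrix ι ι ℝ}
    (hB : ∀ i j, Measurable fun ω => B ω i j) : Measurable fun ω => (B ω).det := by
  let _ : MeasurableSpace (Matrix ι ι ℝ) := MeasurableSpace.pi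
  have _ : BorelSpace (Matrix ι ι ℝ) := inferInstanceAs (BorelSpace (ι → ι → ℝ))
  have hB' : Measurable B := measurable_pi_iff.2 fun i => measurable_pi_iff.2 fun j => hB i j
  exact (continuous_id.matrix_det).measurable.comp hB'

theorem measurable_dotProduct_mulVec {Ω : Type*} [MeasurableSpace Ω] {B : Ω → Matrix ι ι ℝ}
    (hB : ∀ i j, Measurable fun ω => B ω i j) {u v : Ω → ι → ℝ}
    (hu : ∀ i, Measurable fun ω => u ω i) (hv : ∀ i, Measurable fun ω => v ω i) :
    Measurable fun ω => u ω ⬝ᵥ B ω *ᵥ v ω := by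
  simp only [dotProduct, mulVec]
  fun_prop

theorem measurable_gramMatrix_apply {Ω : Type*} [MeasurableSpace Ω] {z : ℕ → Ω → ι → ℝ} {t : ℕ}
    (hz : ∀ τ < t, ∀ i, Measurable fun ω => z τ ω i) (i j : ι) :
    Measurable fun ω => gramMatrix (fun τ => z τ ω) t i j := by
  simp only [gramMatrix, Matrix.add_apply, Matrix.sum_apply, Matrix.vecMulVec_apply]
  refine measurable_const.add (Finset.measurable_sum _ fun τ hτ => ?_)
  have := hz τ (Finset.mem_range.1 hτ)
  exact (this i).mul (this j)

end InverseSqrt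

/-! ### Exponential supermartingale steps for conditionally sub-Gaussian shocks -/

section ConditionallySubGaussian

variable {Ω : Type*} {G m : MeasurableSpace Ω} {μ : Measure Ω}

/-- Restricted to `G`, the measure with density `exp (s ε)` is dominated by `C μ`, by the defining
property of conditional expectation. Comparing measures allows every nonnegative `G`-measurable `h`,
without integrability. -/
theorem lintegral_mul_exp_const_le [IsFiniteMeasure μ] (hG : G ≤ m) {ε : Ω → ℝ}
    (hε : Measurable ε) {s C : ℝ} (hint : Integrable (fun ω => Real.exp (s * ε ω)) μ)
    (hle : ∀ᵐ ω ∂μ, (μ[fun ω' => Real.exp (s * ε ω') | G]) ω ≤ C)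
    {h : Ω → ENNReal} (hh : Measurable[G] h) :
    ∫⁻ ω, h ω * ENNReal.ofReal (Real.exp (s * ε ω)) ∂μ ≤ ENNReal.ofReal C * ∫⁻ ω, h ω ∂μ := by
  have hm : Measurable fun ω => ENNReal.ofReal (Real.exp (s * ε ω)) := by fun_prop
  obtain ⟨ν, hν⟩ : ∃ ν, ν = μ.withDensity fun ω => ENNReal.ofReal (Real.exp (s * ε ω)) := ⟨_, rfl⟩
  have h1 : ∫⁻ ω, h ω * ENNReal.ofReal (Real.exp (s * ε ω)) ∂μ = ∫⁻ ω, h ω ∂ν := by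
    rw [hν, lintegral_withDensity_eq_lintegral_mul _ hm (hh.mono hG le_rfl)]
    exact lintegral_congr fun ω => mul_comm _ _
  have h2 : ν.trim hG ≤ ENNReal.ofReal C • μ.trim hG := by
    refine Measure.le_iff.2 fun A hA => ?_
    have hA' := hG A hA
    rw [Measure.smul_apply, trim_measurableSet_eq hG hA, trim_measurableSet_eq hG hA, hν,
      withDensity_apply _ hA', ← ofReal_integral_eq_lintegral_ofReal hint.integrableOn
        (Filter.Eventually.of_forall fun ω => (Real.exp_pos _).le),
      ← setIntegral_condExp hG hint hA, smul_eq_mul, ← ENNReal.ofReal_toReal (measure_ne_top μ A),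
      ← ENNReal.ofReal_mul' ENNReal.toReal_nonneg]
    refine ENNReal.ofReal_le_ofReal ?_
    calc ∫ ω in A, (μ[fun ω' => Real.exp (s * ε ω') | G]) ω ∂μ ≤ ∫ _ in A, C ∂μ :=
          setIntegral_mono_ae integrable_condExp.integrableOn (integrableOn_const (by simp)) hle
      _ = C * (μ A).toReal := by simp [Measure.real, mul_comm]
  rw [h1, ← lintegral_trim hG hh, ← lintegral_trim hG hh, ← smul_eq_mul, ← lintegral_smul_measure]
  exact lintegral_mono' h2 le_rfl

/-- A shock that is conditionally sub-Gaussian given `G`. -/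
structure CondSubGaussian (G : MeasurableSpace Ω) {m : MeasurableSpace Ω} (μ : Measure Ω)
    (σ : ℝ) (ε : Ω → ℝ) : Prop where
  le : G ≤ m
  measurable : Measurable ε
  integrable_exp : ∀ s : ℝ, Integrable (fun ω => Real.exp (s * ε ω)) μ
  condExp_exp_le : ∀ s : ℝ, ∀ᵐ ω ∂μ,
    (μ[fun ω' => Real.exp (s * ε ω') | G]) ω ≤ Real.exp (σ ^ 2 * s ^ 2 / 2)

variable [IsFiniteMeasure μ] {σ : ℝ} {ε : Ω → ℝ}

theorem CondSubGaussian.lintegral_const_le (hsub : CondSubGaussian G μ σ ε) (s : ℝ)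
    {h : Ω → ENNReal} (hh : Measurable[G] h) :
    ∫⁻ ω, h ω * ENNReal.ofReal (Real.exp (s * ε ω - σ ^ 2 * s ^ 2 / 2)) ∂μ ≤ ∫⁻ ω, h ω ∂μ := by
  have h1 := lintegral_mul_exp_const_le hsub.le hsub.measurable (hsub.integrable_exp s)
    (hsub.condExp_exp_le s) hh
  have hm : Measurable fun ω => h ω * ENNReal.ofReal (Real.exp (s * ε ω)) := by
    have := hsub.measurable
    have := hh.mono hsub.le le_rfl
    fun_prop
  calc ∫⁻ ω, h ω * ENNReal.ofReal (Real.exp (s * ε ω - σ ^ 2 * s ^ 2 / 2)) ∂μ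
      = ∫⁻ ω, ENNReal.ofReal (Real.exp (-(σ ^ 2 * s ^ 2 / 2)))
          * (h ω * ENNReal.ofReal (Real.exp (s * ε ω))) ∂μ := by
        refine lintegral_congr fun ω => ?_
        rw [sub_eq_add_neg, Real.exp_add, ENNReal.ofReal_mul (Real.exp_pos _).le]
        ring
    _ = ENNReal.ofReal (Real.exp (-(σ ^ 2 * s ^ 2 / 2)))
          * ∫⁻ ω, h ω * ENNReal.ofReal (Real.exp (s * ε ω)) ∂μ := lintegral_const_mul _ hm
    _ ≤ ENNReal.ofReal (Real.exp (-(σ ^ 2 * s ^ 2 / 2)))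
          * (ENNReal.ofReal (Real.exp (σ ^ 2 * s ^ 2 / 2)) * ∫⁻ ω, h ω ∂μ) := by gcongr
    _ = ∫⁻ ω, h ω ∂μ := by
        rw [← mul_assoc, ← ENNReal.ofReal_mul (Real.exp_pos _).le, ← Real.exp_add]
        simp

/-- On each level set of `s` the exponent is constant, and the indicator of the level set is
`G`-measurable and can be absorbed into `h`. -/
theorem CondSubGaussian.lintegral_finite_range_le (hsub : CondSubGaussian G μ σ ε)
    {s : Ω → ℝ} (hs : Measurable[G] s) (hfin : (Set.range s).Finite) {h : Ω → ENNReal}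
    (hh : Measurable[G] h) :
    ∫⁻ ω, h ω * ENNReal.ofReal (Real.exp (s ω * ε ω - σ ^ 2 * s ω ^ 2 / 2)) ∂μ
      ≤ ∫⁻ ω, h ω ∂μ := by
  classical
  have hA : ∀ a, MeasurableSet[G] (s ⁻¹' {a}) := fun a => hs (measurableSet_singleton a)
  have hi : ∀ a, Measurable[G] ((s ⁻¹' {a}).indicator h) := fun a => hh.indicator (hA a)
  have key : ∀ (F : ℝ → Ω → ENNReal) (ω : Ω),
      h ω * F (s ω) ω = ∑ a ∈ hfin.toFinset, (s ⁻¹' {a}).indicator h ω * F a ω := by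
    intro F ω
    rw [Finset.sum_eq_single (s ω)]
    · rw [Set.indicator_of_mem (by simp)]
    · intro a _ ha
      rw [Set.indicator_of_notMem (by simpa using ha.symm), zero_mul]
    · intro hω
      exact absurd (hfin.mem_toFinset.2 (Set.mem_range_self ω)) hω
  have hε := hsub.measurable
  calc ∫⁻ ω, h ω * ENNReal.ofReal (Real.exp (s ω * ε ω - σ ^ 2 * s ω ^ 2 / 2)) ∂μ
      = ∫⁻ ω, ∑ a ∈ hfin.toFinset, (s ⁻¹' {a}).indicator h ω
          * ENNReal.ofReal (Real.exp (a * ε ω - σ ^ 2 * a ^ 2 / 2)) ∂μ :=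
        lintegral_congr fun ω =>
          key (fun a ω => ENNReal.ofReal (Real.exp (a * ε ω - σ ^ 2 * a ^ 2 / 2))) ω
    _ = ∑ a ∈ hfin.toFinset, ∫⁻ ω, (s ⁻¹' {a}).indicator h ω
          * ENNReal.ofReal (Real.exp (a * ε ω - σ ^ 2 * a ^ 2 / 2)) ∂μ := by
        refine lintegral_finsetSum _ fun a _ => ?_
        have := (hi a).mono hsub.le le_rfl
        fun_prop
    _ ≤ ∑ a ∈ hfin.toFinset, ∫⁻ ω, (s ⁻¹' {a}).indicator h ω ∂μ :=
        Finset.sum_le_sum fun a _ => hsub.lintegral_const_le a (hi a)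
    _ = ∫⁻ ω, ∑ a ∈ hfin.toFinset, (s ⁻¹' {a}).indicator h ω ∂μ :=
        (lintegral_finsetSum _ fun a _ => (hi a).mono hsub.le le_rfl).symm
    _ = ∫⁻ ω, h ω ∂μ := by
        refine lintegral_congr fun ω => ?_
        simpa using (key (fun _ _ => 1) ω).symm

theorem Measurable.exists_finite_range_approx {Ω : Type*} [MeasurableSpace Ω] {s : Ω → ℝ}
    (hs : Measurable s) : ∃ f : ℕ → Ω → ℝ, (∀ n, Measurable (f n) ∧ (Set.range (f n)).Finite) ∧
      ∀ ω, Filter.Tendsto (fun n => f n ω) Filter.atTop (nhds (s ω)) :=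
  ⟨fun n => hs.stronglyMeasurable.approx n, fun _ => ⟨SimpleFunc.measurable _,
    SimpleFunc.finite_range _⟩, fun ω => hs.stronglyMeasurable.tendsto_approx ω⟩

/-- The exponential supermartingale step with a random, `G`-measurable, exponent. -/
theorem CondSubGaussian.lintegral_le (hsub : CondSubGaussian G μ σ ε)
    {s : Ω → ℝ} (hs : Measurable[G] s) {h : Ω → ENNReal} (hh : Measurable[G] h) :
    ∫⁻ ω, h ω * ENNReal.ofReal (Real.exp (s ω * ε ω - σ ^ 2 * s ω ^ 2 / 2)) ∂μ
      ≤ ∫⁻ ω, h ω ∂μ := by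
  obtain ⟨f, hf, hfs⟩ := @Measurable.exists_finite_range_approx Ω G s hs
  have hε := hsub.measurable
  have hh' := hh.mono hsub.le le_rfl
  have hlim : ∀ ω, Filter.Tendsto (fun n => h ω * ENNReal.ofReal
      (Real.exp (f n ω * ε ω - σ ^ 2 * f n ω ^ 2 / 2))) Filter.atTop
      (nhds (h ω * ENNReal.ofReal (Real.exp (s ω * ε ω - σ ^ 2 * s ω ^ 2 / 2)))) := by
    intro ω
    have h1 := hfs ω
    have h2 : Continuous fun x : ℝ =>
        ENNReal.ofReal (Real.exp (x * ε ω - σ ^ 2 * x ^ 2 / 2)) :=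
      ENNReal.continuous_ofReal.comp (by fun_prop)
    -- The limit is nonzero, so the products converge even where `h` is infinite.
    refine ENNReal.Tendsto.const_mul ((h2.tendsto _).comp h1) (Or.inl ?_)
    exact (ENNReal.ofReal_pos.2 (Real.exp_pos _)).ne'
  -- Fatou's lemma along the simple approximations of `s`; no dominating function is required.
  calc ∫⁻ ω, h ω * ENNReal.ofReal (Real.exp (s ω * ε ω - σ ^ 2 * s ω ^ 2 / 2)) ∂μ
      = ∫⁻ ω, Filter.liminf (fun n => h ω * ENNReal.ofReal
          (Real.exp (f n ω * ε ω - σ ^ 2 * f n ω ^ 2 / 2))) Filter.atTop ∂μ :=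
        lintegral_congr fun ω => (hlim ω).liminf_eq.symm
    _ ≤ Filter.liminf (fun n => ∫⁻ ω, h ω * ENNReal.ofReal
          (Real.exp (f n ω * ε ω - σ ^ 2 * f n ω ^ 2 / 2)) ∂μ)
          Filter.atTop := by
        refine lintegral_liminf_le fun n => ?_
        have := (hf n).1.mono hsub.le le_rfl
        fun_prop
    _ ≤ Filter.liminf (fun _ : ℕ => ∫⁻ ω, h ω ∂μ) Filter.atTop :=
        Filter.liminf_le_liminf (Filter.Eventually.of_forall fun n =>
          hsub.lintegral_finite_range_le (hf n).1 (hf n).2 hh)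
    _ = ∫⁻ ω, h ω ∂μ := Filter.liminf_const _

theorem lintegral_gaussian_density (b : ℝ) {v : ℝ} (hv : 0 < v) :
    ∫⁻ y : ℝ, ENNReal.ofReal ((√(2 * Real.pi * v))⁻¹ * Real.exp (-(y - b) ^ 2 / (2 * v))) = 1 := by
  have h := lintegral_gaussianPDFReal_eq_one b (v := v.toNNReal) (by simpa using hv)
  simpa only [gaussianPDFReal, Real.coe_toNNReal _ hv.le] using h

/-- Mixing the exponential supermartingales over a Gaussian prior, in one dimension. -/
theorem CondSubGaussian.lintegral_quadratic_le (hσ : 0 < σ) (hsub : CondSubGaussian G μ σ ε)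
    {a q : Ω → ℝ} (ha : Measurable[G] a) (hq : Measurable[G] q) (hq0 : ∀ ω, 0 ≤ q ω)
    {h : Ω → ENNReal} (hh : Measurable[G] h) :
    ∫⁻ ω, h ω * ENNReal.ofReal (Real.exp
        ((2 * ε ω * a ω + ε ω ^ 2 * q ω - a ω ^ 2) / (2 * σ ^ 2 * (1 + q ω)))
          * (√(1 + q ω))⁻¹) ∂μ ≤ ∫⁻ ω, h ω ∂μ := by
  have hε := hsub.measurable
  have hh' := hh.mono hsub.le le_rfl
  have ha' := ha.mono hsub.le le_rfl
  have hq' := hq.mono hsub.le le_rfl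
  -- The exponent `s y` is affine in the mixing variable `y`, and `K` is the density of a normal law
  -- in `y` with mean `a k` and variance `1 + q`. The slope `k` is tuned so that, after completing
  -- the square, the integrand is the target times the density of the normal law with mean `k ε` and
  -- variance 1. Both densities have mass one, and Tonelli's theorem exchanges the two integrals.
  obtain ⟨k, hk⟩ : ∃ k : Ω → ℝ, k = fun ω => √(q ω / (σ ^ 2 * (1 + q ω))) := ⟨_, rfl⟩
  have hkm : Measurable[G] k := by rw [hk]; fun_prop
  have hkm' := hkm.mono hsub.le le_rfl
  have hk2 : ∀ ω, k ω ^ 2 = q ω / (σ ^ 2 * (1 + q ω)) := fun ω => by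
    have := hq0 ω
    simp only [hk]
    exact Real.sq_sqrt (by positivity)
  obtain ⟨s, hs⟩ : ∃ s : ℝ → Ω → ℝ, s = fun y ω => a ω / (σ ^ 2 * (1 + q ω)) + k ω * y :=
    ⟨_, rfl⟩
  have hsm : ∀ y, Measurable[G] (s y) := fun y => by rw [hs]; fun_prop
  obtain ⟨K, hK⟩ : ∃ K : Ω → ℝ → ℝ, K = fun ω y => (√(2 * Real.pi * (1 + q ω)))⁻¹
      * Real.exp (-(y - a ω * k ω) ^ 2 / (2 * (1 + q ω))) := ⟨_, rfl⟩
  have hKm : ∀ y, Measurable[G] fun ω => K ω y := fun y => by rw [hK]; fun_prop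
  have hK0 : ∀ ω y, 0 ≤ K ω y := fun ω y => by rw [hK]; positivity
  have hid : ∀ ω y, K ω y * Real.exp (s y ω * ε ω - σ ^ 2 * s y ω ^ 2 / 2)
      = Real.exp ((2 * ε ω * a ω + ε ω ^ 2 * q ω - a ω ^ 2) / (2 * σ ^ 2 * (1 + q ω)))
          * (√(1 + q ω))⁻¹
        * ((√(2 * Real.pi * 1))⁻¹ * Real.exp (-(y - k ω * ε ω) ^ 2 / (2 * 1))) := by
    intro ω y
    have h1 : 0 < 1 + q ω := by linarith [hq0 ω]
    have h2 : -(y - a ω * k ω) ^ 2 / (2 * (1 + q ω))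
          + (s y ω * ε ω - σ ^ 2 * s y ω ^ 2 / 2)
        = (2 * ε ω * a ω + ε ω ^ 2 * q ω - a ω ^ 2) / (2 * σ ^ 2 * (1 + q ω))
          + -(y - k ω * ε ω) ^ 2 / (2 * 1) := by
      have h3 := hk2 ω
      have h4 : q ω = k ω ^ 2 * σ ^ 2 * (1 + q ω) := by
        rw [h3]; field_simp
      have h5 : 1 = (1 + q ω) * (1 - k ω ^ 2 * σ ^ 2) := by linarith
      have h6 : (1 + q ω)⁻¹ = 1 - k ω ^ 2 * σ ^ 2 := by
        field_simp
        linarith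
      have h7 : q ω * (1 + q ω)⁻¹ = k ω ^ 2 * σ ^ 2 := by
        field_simp
        linarith
      have e1 : -(y - a ω * k ω) ^ 2 / (2 * (1 + q ω))
          = -(y - a ω * k ω) ^ 2 / 2 * (1 + q ω)⁻¹ := by field_simp
      have e2 : (2 * ε ω * a ω + ε ω ^ 2 * q ω - a ω ^ 2) / (2 * σ ^ 2 * (1 + q ω))
          = (2 * ε ω * a ω - a ω ^ 2) / (2 * σ ^ 2) * (1 + q ω)⁻¹
            + ε ω ^ 2 / (2 * σ ^ 2) * (q ω * (1 + q ω)⁻¹) := by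
        simp only [div_eq_mul_inv, mul_inv]; ring
      have e3 : s y ω = a ω / σ ^ 2 * (1 + q ω)⁻¹ + k ω * y := by
        rw [hs]; field_simp
      rw [e1, e2, e3, h7, h6]
      field_simp
      ring
    rw [hK]
    simp only
    rw [mul_assoc, ← Real.exp_add, h2, Real.exp_add, Real.sqrt_mul (by positivity) (1 + q ω),
      mul_inv, mul_one]
    ring_nf
  have hF0 : ∀ ω, 0 ≤ Real.exp
      ((2 * ε ω * a ω + ε ω ^ 2 * q ω - a ω ^ 2) / (2 * σ ^ 2 * (1 + q ω)))
          * (√(1 + q ω))⁻¹ := fun ω => by positivity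
  calc ∫⁻ ω, h ω * ENNReal.ofReal (Real.exp
        ((2 * ε ω * a ω + ε ω ^ 2 * q ω - a ω ^ 2) / (2 * σ ^ 2 * (1 + q ω)))
          * (√(1 + q ω))⁻¹) ∂μ
      = ∫⁻ ω, (∫⁻ y : ℝ, h ω * (ENNReal.ofReal (K ω y)
          * ENNReal.ofReal (Real.exp (s y ω * ε ω - σ ^ 2 * s y ω ^ 2 / 2)))) ∂μ := by
        refine lintegral_congr fun ω => ?_
        simp_rw [← ENNReal.ofReal_mul (hK0 ω _), hid ω, ENNReal.ofReal_mul (hF0 ω)]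
        rw [lintegral_const_mul _ (by fun_prop), lintegral_const_mul _ (by fun_prop),
          lintegral_gaussian_density _ one_pos, mul_one]
    _ = ∫⁻ y : ℝ, ∫⁻ ω, h ω * (ENNReal.ofReal (K ω y)
          * ENNReal.ofReal (Real.exp (s y ω * ε ω - σ ^ 2 * s y ω ^ 2 / 2))) ∂μ := by
        refine lintegral_lintegral_swap ?_
        rw [hK, hs]
        simp only [Function.uncurry_def]
        fun_prop
    _ ≤ ∫⁻ y : ℝ, ∫⁻ ω, h ω * ENNReal.ofReal (K ω y) ∂μ := by
        refine lintegral_mono fun y => ?_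
        simp_rw [← mul_assoc]
        exact hsub.lintegral_le (hsm y) (hh.mul (hKm y).ennreal_ofReal)
    _ = ∫⁻ ω, (∫⁻ y : ℝ, h ω * ENNReal.ofReal (K ω y)) ∂μ := by
        refine lintegral_lintegral_swap ?_
        rw [hK]
        simp only [Function.uncurry_def]
        fun_prop
    _ = ∫⁻ ω, h ω ∂μ := by
        refine lintegral_congr fun ω => ?_
        rw [hK, lintegral_const_mul _ (by fun_prop),
          lintegral_gaussian_density _ (by linarith [hq0 ω]), mul_one]

end ConditionallySubGaussian

/-! ### The self-normalized deviation inequality -/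

section SelfNormalized

open Matrix

variable {Ω : Type*} {m : MeasurableSpace Ω} {μ : Measure Ω} [IsProbabilityMeasure μ]
  {ι : Type*} [Fintype ι] [DecidableEq ι]

/-- The weighted sum of shocks `∑_{τ < t} ε_τ z_τ`. -/
def shockSum (z : ℕ → ι → ℝ) (ε : ℕ → ℝ) (t : ℕ) : ι → ℝ := ∑ τ ∈ Finset.range t, ε τ • z τ

theorem measurable_shockSum_apply {Ω : Type*} [MeasurableSpace Ω] {z : ℕ → Ω → ι → ℝ}
    {ε : ℕ → Ω → ℝ} {t : ℕ} (hz : ∀ τ < t, ∀ i, Measurable fun ω => z τ ω i)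
    (hε : ∀ τ < t, Measurable (ε τ)) (i : ι) :
    Measurable fun ω => shockSum (fun τ => z τ ω) (fun τ => ε τ ω) t i := by
  simp only [shockSum, Finset.sum_apply, Pi.smul_apply, smul_eq_mul]
  exact Finset.measurable_sum _ fun τ hτ =>
    (hε τ (Finset.mem_range.1 hτ)).mul (hz τ (Finset.mem_range.1 hτ) i)

theorem measurable_exp_selfNormalized {Ω : Type*} [MeasurableSpace Ω] (σ : ℝ)
    {z : ℕ → Ω → ι → ℝ} {ε : ℕ → Ω → ℝ} {t : ℕ}
    (hz : ∀ τ < t, ∀ i, Measurable fun ω => z τ ω i) (hε : ∀ τ < t, Measurable (ε τ)) :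
    Measurable fun ω => ENNReal.ofReal
        (Real.exp (shockSum (fun τ => z τ ω) (fun τ => ε τ ω) t
            ⬝ᵥ (gramMatrix (fun τ => z τ ω) t)⁻¹ *ᵥ
              shockSum (fun τ => z τ ω) (fun τ => ε τ ω) t / (2 * σ ^ 2))
          * (√(gramMatrix (fun τ => z τ ω) t).det)⁻¹) := by
  have hM : ∀ i j, Measurable fun ω => gramMatrix (fun τ => z τ ω) t i j :=
    measurable_gramMatrix_apply hz
  exact ((Real.measurable_exp.comp ((measurable_dotProduct_mulVec
    (measurable_inv_apply hM) (measurable_shockSum_apply hz hε)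
    (measurable_shockSum_apply hz hε)).div_const _)).mul
      (measurable_det hM).sqrt.inv).ennreal_ofReal

/-- The update formulas for the inverse quadratic form and the determinant turn one more observation
into exactly the factor treated in `CondSubGaussian.lintegral_quadratic_le`. -/
theorem exp_selfNormalized_succ (σ : ℝ) (z : ℕ → ι → ℝ) (ε : ℕ → ℝ) (t : ℕ) :
    Real.exp (shockSum z ε (t + 1) ⬝ᵥ (gramMatrix z (t + 1))⁻¹ *ᵥ shockSum z ε (t + 1)
        / (2 * σ ^ 2)) * (√(gramMatrix z (t + 1)).det)⁻¹
      = (Real.exp (shockSum z ε t ⬝ᵥ (gramMatrix z t)⁻¹ *ᵥ shockSum z ε t / (2 * σ ^ 2))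
          * (√(gramMatrix z t).det)⁻¹)
        * (Real.exp ((2 * ε t * (z t ⬝ᵥ (gramMatrix z t)⁻¹ *ᵥ shockSum z ε t)
              + ε t ^ 2 * (z t ⬝ᵥ (gramMatrix z t)⁻¹ *ᵥ z t)
              - (z t ⬝ᵥ (gramMatrix z t)⁻¹ *ᵥ shockSum z ε t) ^ 2)
            / (2 * σ ^ 2 * (1 + z t ⬝ᵥ (gramMatrix z t)⁻¹ *ᵥ z t)))
          * (√(1 + z t ⬝ᵥ (gramMatrix z t)⁻¹ *ᵥ z t))⁻¹) := by
  have hA := gramMatrix_posDef z t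
  have hq := hA.inv_quadForm_nonneg (z t)
  have h1 : shockSum z ε (t + 1) = shockSum z ε t + ε t • z t := by
    simp [shockSum, Finset.sum_range_succ]
  rw [h1, det_gramMatrix_succ, gramMatrix_succ, inv_quadForm_update hA,
    Real.sqrt_mul hA.det_pos.le, mul_inv, add_div, Real.exp_add, div_div,
    mul_comm (1 + _) (2 * σ ^ 2)]
  ring

/-- Induction on time with one scalar mixture per step, so no Gaussian integral over the parameter
space appears. The measurability of all past quantities is assumed for each `G τ` separately, so `G`
need not be monotone. -/
theorem lintegral_exp_selfNormalized_le {σ : ℝ} (hσ : 0 < σ) {z : ℕ → Ω → ι → ℝ}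
    {ε : ℕ → Ω → ℝ} {G : ℕ → MeasurableSpace Ω} (t : ℕ)
    (hsub : ∀ τ < t, CondSubGaussian (G τ) μ σ (ε τ))
    (hz : ∀ τ < t, ∀ τ' ≤ τ, ∀ i, Measurable[G τ] fun ω => z τ' ω i)
    (hε : ∀ τ < t, ∀ τ' < τ, Measurable[G τ] (ε τ')) :
    ∫⁻ ω, ENNReal.ofReal
        (Real.exp (shockSum (fun τ => z τ ω) (fun τ => ε τ ω) t
            ⬝ᵥ (gramMatrix (fun τ => z τ ω) t)⁻¹ *ᵥ
              shockSum (fun τ => z τ ω) (fun τ => ε τ ω) t / (2 * σ ^ 2))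
          * (√(gramMatrix (fun τ => z τ ω) t).det)⁻¹) ∂μ ≤ 1 := by
  induction t with
  | zero => simp [shockSum, gramMatrix_zero]
  | succ t ih =>
    have hs := hsub t (Nat.lt_succ_self t)
    have hzt := hz t (Nat.lt_succ_self t)
    have hεt := hε t (Nat.lt_succ_self t)
    have hM : ∀ i j, Measurable[G t] fun ω => gramMatrix (fun τ => z τ ω) t i j :=
      @measurable_gramMatrix_apply ι _ _ Ω (G t) z t fun τ hτ => hzt τ hτ.le
    have hMi : ∀ i j, Measurable[G t] fun ω => (gramMatrix (fun τ => z τ ω) t)⁻¹ i j :=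
      @measurable_inv_apply ι _ _ Ω (G t) _ hM
    have hS : ∀ i, Measurable[G t] fun ω =>
        shockSum (fun τ => z τ ω) (fun τ => ε τ ω) t i :=
      @measurable_shockSum_apply ι _ _ Ω (G t) z ε t (fun τ hτ => hzt τ hτ.le) hεt
    have hq : Measurable[G t] fun ω => z t ω ⬝ᵥ (gramMatrix (fun τ => z τ ω) t)⁻¹ *ᵥ z t ω :=
      @measurable_dotProduct_mulVec ι _ _ Ω (G t) _ hMi _ _ (hzt t le_rfl) (hzt t le_rfl)
    have ha : Measurable[G t] fun ω => z t ω ⬝ᵥ (gramMatrix (fun τ => z τ ω) t)⁻¹ *ᵥ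
        shockSum (fun τ => z τ ω) (fun τ => ε τ ω) t :=
      @measurable_dotProduct_mulVec ι _ _ Ω (G t) _ hMi _ _ (hzt t le_rfl) hS
    simp_rw [exp_selfNormalized_succ σ]
    refine le_trans ?_ (ih (fun τ hτ => hsub τ (hτ.trans (Nat.lt_succ_self t)))
      (fun τ hτ => hz τ (hτ.trans (Nat.lt_succ_self t)))
      (fun τ hτ => hε τ (hτ.trans (Nat.lt_succ_self t))))
    have hW := @measurable_exp_selfNormalized ι _ _ Ω (G t) σ z ε t
      (fun τ hτ => hzt τ hτ.le) hεt
    refine le_trans (le_of_eq ?_) (hs.lintegral_quadratic_le hσ ha hq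
      (fun ω => (gramMatrix_posDef _ t).inv_quadForm_nonneg _) hW)
    refine lintegral_congr fun ω => ?_
    rw [ENNReal.ofReal_mul (by positivity)]

/-- The self-normalized tail bound at a fixed time, by Markov's inequality. -/
theorem measure_selfNormalized_gt_le {σ : ℝ} (hσ : 0 < σ) {z : ℕ → Ω → ι → ℝ}
    {ε : ℕ → Ω → ℝ} {G : ℕ → MeasurableSpace Ω} (t : ℕ)
    (hsub : ∀ τ < t, CondSubGaussian (G τ) μ σ (ε τ))
    (hz : ∀ τ < t, ∀ τ' ≤ τ, ∀ i, Measurable[G τ] fun ω => z τ' ω i)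
    (hε : ∀ τ < t, ∀ τ' < τ, Measurable[G τ] (ε τ')) (L : ℝ) :
    μ {ω | σ ^ 2 * (Real.log (gramMatrix (fun τ => z τ ω) t).det + 2 * L)
        < shockSum (fun τ => z τ ω) (fun τ => ε τ ω) t
            ⬝ᵥ (gramMatrix (fun τ => z τ ω) t)⁻¹ *ᵥ
              shockSum (fun τ => z τ ω) (fun τ => ε τ ω) t}
      ≤ ENNReal.ofReal (Real.exp (-L)) := by
  have h1 := lintegral_exp_selfNormalized_le hσ t hsub hz hε
  obtain ⟨W, hW⟩ : ∃ W : Ω → ℝ, W = fun ω =>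
      Real.exp (shockSum (fun τ => z τ ω) (fun τ => ε τ ω) t
            ⬝ᵥ (gramMatrix (fun τ => z τ ω) t)⁻¹ *ᵥ
              shockSum (fun τ => z τ ω) (fun τ => ε τ ω) t / (2 * σ ^ 2))
          * (√(gramMatrix (fun τ => z τ ω) t).det)⁻¹ := ⟨_, rfl⟩
  have h2 : ENNReal.ofReal (Real.exp L) * μ {ω | ENNReal.ofReal (Real.exp L)
      ≤ ENNReal.ofReal (W ω)} ≤ 1 := by
    refine (mul_meas_ge_le_lintegral₀ ?_ _).trans (by rw [hW]; exact h1)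
    rw [hW]
    exact (measurable_exp_selfNormalized σ
      (fun τ hτ i => (hz τ hτ τ le_rfl i).mono (hsub τ hτ).le le_rfl)
      (fun τ hτ => (hsub τ hτ).measurable)).aemeasurable
  have h3 : μ {ω | ENNReal.ofReal (Real.exp L) ≤ ENNReal.ofReal (W ω)}
      ≤ ENNReal.ofReal (Real.exp (-L)) := by
    rw [Real.exp_neg, ENNReal.ofReal_inv_of_pos (Real.exp_pos L), ENNReal.le_inv_iff_mul_le,
      mul_comm]
    exact h2
  refine (measure_mono fun ω hω => ?_).trans h3
  simp only [Set.mem_ofPred_eq] at hω ⊢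
  refine ENNReal.ofReal_le_ofReal ?_
  have hdet := (gramMatrix_posDef (fun τ => z τ ω) t).det_pos
  rw [hW]
  simp only
  -- Writing `√det` as `exp (½ log det)` makes the claim a linear inequality between exponents.
  rw [← div_eq_mul_inv, le_div_iff₀ (Real.sqrt_pos.2 hdet), Real.sqrt_eq_rpow,
    Real.rpow_def_of_pos hdet, ← Real.exp_add]
  refine Real.exp_le_exp.2 ?_
  rw [le_div_iff₀ (by positivity)]
  nlinarith

end SelfNormalized

/-! ### The antiderivative of the link function -/

section LinkPotential

variable {g : ℝ → ℝ} {S : Set ℝ} {c : ℝ}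

theorem image_Ioc_of_strictMono_continuous (hg : StrictMono g) (hc : Continuous g) {a b : ℝ} :
    g '' Set.Ioc a b = Set.Ioc (g a) (g b) := by
  refine Set.Subset.antisymm ?_ fun y hy => ?_
  · rintro _ ⟨x, hx, rfl⟩
    exact ⟨hg hx.1, hg.monotone hx.2⟩
  · have hab : a ≤ b := (hg.lt_iff_lt.1 (hy.1.trans_le hy.2)).le
    obtain ⟨x, hx, rfl⟩ := intermediate_value_Icc hab hc.continuousOn ⟨hy.1.le, hy.2⟩
    exact ⟨x, ⟨hg.lt_iff_lt.1 hy.1, hx.2⟩, rfl⟩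

/-- The substitution `u = g s` in the integral that defines the quasi-likelihood. -/
theorem integral_link_substitution (hg : StrictMono g) (hd : Differentiable ℝ g)
    (hS : Convex ℝ S) (hpos : ∀ s ∈ S, 0 < deriv g s) {a b : ℝ} (ha : a ∈ S) (hb : b ∈ S)
    (D : ℝ) :
    ∫ u in (g a)..(g b), 1 / deriv g (Function.invFun g u) * (u - D) = ∫ s in a..b, (g s - D) := by
  wlog hab : a ≤ b generalizing a b
  · rw [intervalIntegral.integral_symm, this hb ha (not_le.1 hab).le,
      ← intervalIntegral.integral_symm]
  rw [intervalIntegral.integral_of_le (hg.monotone hab), intervalIntegral.integral_of_le hab,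
    ← image_Ioc_of_strictMono_continuous hg hd.continuous,
    integral_image_eq_integral_abs_deriv_smul measurableSet_Ioc
      (fun x _ => (hd x).hasDerivAt.hasDerivWithinAt) hg.injective.injOn]
  refine setIntegral_congr_fun measurableSet_Ioc fun s hs => ?_
  -- Between `a` and `b` the derivative is positive, so the Jacobian cancels the weight `1 /
  -- g'(g⁻¹(u))`.
  have hsS : s ∈ S := hS.ordConnected.out ha hb ⟨hs.1.le, hs.2⟩
  have := hpos s hsS
  simp only [smul_eq_mul, Function.leftInverse_invFun hg.injective s, abs_of_pos this]
  field_simp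

/-- The antiderivative of the link function. -/
noncomputable def linkPotential (g : ℝ → ℝ) (s : ℝ) : ℝ := ∫ u in (0 : ℝ)..s, g u

theorem continuous_linkPotential (hc : Continuous g) : Continuous (linkPotential g) :=
  intervalIntegral.continuous_primitive (fun _ _ => hc.intervalIntegrable _ _) 0

theorem integral_sub_const_eq_linkPotential (hc : Continuous g) (a b D : ℝ) :
    ∫ s in a..b, (g s - D)
      = (linkPotential g b - D * b) - (linkPotential g a - D * a) := by
  rw [intervalIntegral.integral_sub (hc.intervalIntegrable _ _) (by simp), linkPotential,
    linkPotential, intervalIntegral.integral_const, smul_eq_mul,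
    ← intervalIntegral.integral_interval_sub_left (hc.intervalIntegrable 0 b)
      (hc.intervalIntegrable 0 a)]
  ring

theorem mul_sub_le_link_sub (hd : Differentiable ℝ g) (hS : Convex ℝ S)
    (hlow : ∀ s ∈ S, c ≤ deriv g s) {a b : ℝ} (ha : a ∈ S) (hb : b ∈ S) (hab : a ≤ b) :
    c * (b - a) ≤ g b - g a :=
  hS.mul_sub_le_image_sub_of_le_deriv hd.continuous.continuousOn hd.differentiableOn
    (fun s hs => hlow s (interior_subset hs)) a ha b hb hab

/-- Strong convexity of the antiderivative of the link function. -/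
theorem linkPotential_lower (hd : Differentiable ℝ g) (hS : Convex ℝ S)
    (hlow : ∀ s ∈ S, c ≤ deriv g s) {a b : ℝ} (ha : a ∈ S) (hb : b ∈ S) :
    linkPotential g a + g a * (b - a) + c / 2 * (b - a) ^ 2 ≤ linkPotential g b := by
  have hc := hd.continuous
  have h1 : ∫ s in a..b, (g s - g a - c * (s - a))
      = linkPotential g b - linkPotential g a - g a * (b - a) - c / 2 * (b - a) ^ 2 := by
    have h2 := integral_sub_const_eq_linkPotential hc a b (g a)
    have i1 : IntervalIntegrable (fun s => g s - g a) volume a b :=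
      Continuous.intervalIntegrable (by fun_prop) _ _
    have i2 : IntervalIntegrable (fun s => c * (s - a)) volume a b :=
      Continuous.intervalIntegrable (by fun_prop) _ _
    rw [intervalIntegral.integral_sub i1 i2, h2,
      intervalIntegral.integral_const_mul, intervalIntegral.integral_sub (by simp) (by simp)]
    simp
    ring
  -- The integrand has the sign of `s - a`; for `b ≤ a` the reversed orientation compensates.
  have h3 : 0 ≤ ∫ s in a..b, (g s - g a - c * (s - a)) := by
    rcases le_total a b with hab | hab
    · refine intervalIntegral.integral_nonneg hab fun s hs => ?_
      have := mul_sub_le_link_sub hd hS hlow ha (hS.ordConnected.out ha hb hs) hs.1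
      linarith
    · rw [intervalIntegral.integral_symm, ← intervalIntegral.integral_neg]
      refine intervalIntegral.integral_nonneg hab fun s hs => ?_
      have := mul_sub_le_link_sub hd hS hlow (hS.ordConnected.out hb ha hs) ha hs.2
      linarith
  linarith

end LinkPotential

/-! ### Strong concavity of the quasi-likelihood and estimation error -/

section QuasiLikelihood

variable {E : Type*} [NormedAddCommGroup E] [InnerProductSpace ℝ E]
  {g : ℝ → ℝ} {S : Set ℝ} {c : ℝ} {z : ℕ → E} {D : ℕ → ℝ} {t : ℕ}

/-- The regularized quasi-log-likelihood, up to an additive constant. -/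
noncomputable def quasiObjective (g : ℝ → ℝ) (c : ℝ) (z : ℕ → E) (D : ℕ → ℝ) (t : ℕ) (θ : E) : ℝ :=
  -(c * ‖θ‖ ^ 2)
    - ∑ τ ∈ Finset.range t, (linkPotential g ⟪z τ, θ⟫_ℝ - D τ * ⟪z τ, θ⟫_ℝ)

/-- The squared design norm `‖v‖² + ∑_{τ < t} ⟪z_τ, v⟫²`. -/
noncomputable def designSq (z : ℕ → E) (t : ℕ) (v : E) : ℝ :=
  ‖v‖ ^ 2 + ∑ τ ∈ Finset.range t, ⟪z τ, v⟫_ℝ ^ 2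

theorem designSq_smul (r : ℝ) (v : E) : designSq z t (r • v) = r ^ 2 * designSq z t v := by
  simp only [designSq, norm_smul, inner_smul_right, mul_pow, Finset.mul_sum, mul_add,
    Real.norm_eq_abs, sq_abs]

theorem sq_norm_le_designSq (v : E) : ‖v‖ ^ 2 ≤ designSq z t v :=
  le_add_of_nonneg_right (Finset.sum_nonneg fun _ _ => sq_nonneg _)

/-- The differential of the quasi-log-likelihood at `θ` in direction `v`. -/
noncomputable def quasiSlope (g : ℝ → ℝ) (c : ℝ) (z : ℕ → E) (D : ℕ → ℝ) (t : ℕ) (θ v : E) : ℝ :=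
  -(2 * c * ⟪θ, v⟫_ℝ) - ∑ τ ∈ Finset.range t, (g ⟪z τ, θ⟫_ℝ - D τ) * ⟪z τ, v⟫_ℝ

theorem quasiSlope_smul (θ : E) (r : ℝ) (v : E) :
    quasiSlope g c z D t θ (r • v) = r * quasiSlope g c z D t θ v := by
  simp only [quasiSlope, inner_smul_right, mul_sub, Finset.mul_sum]
  congr 1
  · ring
  · exact Finset.sum_congr rfl fun _ _ => by ring

theorem continuous_quasiObjective (hc : Continuous g) : Continuous (quasiObjective g c z D t) := by
  have := continuous_linkPotential hc
  unfold quasiObjective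
  fun_prop

/-- Each observation contributes curvature `c / 2`, while the penalty `c ‖θ‖²` contributes `c`. Half
of the latter completes `designSq`; the other half remains as the last term. -/
theorem quasiObjective_le (hd : Differentiable ℝ g) (hS : Convex ℝ S)
    (hlow : ∀ s ∈ S, c ≤ deriv g s) {θ₀ θ : E} (h₀ : ∀ τ < t, ⟪z τ, θ₀⟫_ℝ ∈ S)
    (h : ∀ τ < t, ⟪z τ, θ⟫_ℝ ∈ S) :
    quasiObjective g c z D t θ ≤ quasiObjective g c z D t θ₀
      + quasiSlope g c z D t θ₀ (θ - θ₀)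
      - c / 2 * designSq z t (θ - θ₀) - c / 2 * ‖θ - θ₀‖ ^ 2 := by
  have h1 : ‖θ‖ ^ 2 = ‖θ₀‖ ^ 2 + 2 * ⟪θ₀, θ - θ₀⟫_ℝ + ‖θ - θ₀‖ ^ 2 := by
    rw [← norm_add_sq_real, add_sub_cancel]
  have h2 : ∑ τ ∈ Finset.range t, ((linkPotential g ⟪z τ, θ₀⟫_ℝ - D τ * ⟪z τ, θ₀⟫_ℝ)
        + (g ⟪z τ, θ₀⟫_ℝ - D τ) * ⟪z τ, θ - θ₀⟫_ℝ + c / 2 * ⟪z τ, θ - θ₀⟫_ℝ ^ 2)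
      ≤ ∑ τ ∈ Finset.range t, (linkPotential g ⟪z τ, θ⟫_ℝ - D τ * ⟪z τ, θ⟫_ℝ) := by
    refine Finset.sum_le_sum fun τ hτ => ?_
    have hτ' := Finset.mem_range.1 hτ
    have := linkPotential_lower hd hS hlow (h₀ τ hτ') (h τ hτ')
    rw [inner_sub_right]
    linarith
  rw [Finset.sum_add_distrib, Finset.sum_add_distrib, ← Finset.mul_sum] at h2
  unfold quasiObjective quasiSlope designSq
  rw [h1]
  linarith

/-- Around a maximizer over a convex set the quasi-log-likelihood decreases quadratically. -/
theorem designSq_le_of_isMaxOn (hd : Differentiable ℝ g) (hS : Convex ℝ S) (hc : 0 < c)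
    (hlow : ∀ s ∈ S, c ≤ deriv g s) {K : Set E} (hK : Convex ℝ K)
    (hKS : ∀ θ ∈ K, ∀ τ < t, ⟪z τ, θ⟫_ℝ ∈ S) {θ₀ θ : E} (h₀ : θ₀ ∈ K) (hθ : θ ∈ K)
    (hmax : IsMaxOn (quasiObjective g c z D t) K θ₀) :
    designSq z t (θ - θ₀)
      ≤ 2 / c * (quasiObjective g c z D t θ₀ - quasiObjective g c z D t θ) := by
  obtain ⟨Φ, hΦ⟩ : ∃ Φ, Φ = quasiObjective g c z D t := ⟨_, rfl⟩
  -- Expand at `θ₀ + r (θ - θ₀)` towards both endpoints, with weights `r` and `1 - r`: the slopes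
  -- cancel, and maximality of `θ₀` bounds the value at the intermediate point. Dividing by `r` and
  -- letting `r → 0` avoids a first-order condition on the boundary of `K`.
  have key : ∀ r : ℝ, 0 < r → r < 1 →
      (1 - r) * (c / 2 * designSq z t (θ - θ₀)) ≤ Φ θ₀ - Φ θ := by
    intro r hr0 hr1
    have hmem : θ₀ + r • (θ - θ₀) ∈ K := hK.add_smul_sub_mem h₀ hθ ⟨hr0.le, hr1.le⟩
    have e1 := quasiObjective_le hd hS hlow (D := D) (hKS _ hmem) (hKS _ hθ)
    have e2 := quasiObjective_le hd hS hlow (D := D) (hKS _ hmem) (hKS _ h₀)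
    have hm : quasiObjective g c z D t (θ₀ + r • (θ - θ₀)) ≤ quasiObjective g c z D t θ₀ :=
      hmax hmem
    have v1 : θ - (θ₀ + r • (θ - θ₀)) = (1 - r) • (θ - θ₀) := by module
    have v2 : θ₀ - (θ₀ + r • (θ - θ₀)) = (-r) • (θ - θ₀) := by module
    rw [v1, quasiSlope_smul, designSq_smul] at e1
    rw [v2, quasiSlope_smul, designSq_smul] at e2
    rw [← hΦ] at e1 e2 hm
    obtain ⟨w, hw⟩ : ∃ w, w = θ₀ + r • (θ - θ₀) := ⟨_, rfl⟩
    obtain ⟨q, hq⟩ : ∃ q, q = designSq z t (θ - θ₀) := ⟨_, rfl⟩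
    rw [← hw] at e1 e2 hm
    rw [← hq] at e1 e2 ⊢
    have n1 := mul_nonneg (half_pos hc).le (sq_nonneg ‖(1 - r) • (θ - θ₀)‖)
    have n2 := mul_nonneg (half_pos hc).le (sq_nonneg ‖(-r) • (θ - θ₀)‖)
    have f1 := mul_le_mul_of_nonneg_left e1 hr0.le
    have f2 := mul_le_mul_of_nonneg_left e2 (sub_pos.2 hr1).le
    have n3 := mul_nonneg hr0.le n1
    have n4 := mul_nonneg (sub_pos.2 hr1).le n2
    have h5 : r * ((1 - r) * (c / 2 * q)) ≤ r * (Φ θ₀ - Φ θ) := by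
      nlinarith
    exact le_of_mul_le_mul_left h5 hr0
  have hlim : Filter.Tendsto (fun r : ℝ => (1 - r) * (c / 2 * designSq z t (θ - θ₀)))
      (nhdsWithin 0 (Set.Ioo 0 1)) (nhds ((1 - 0) * (c / 2 * designSq z t (θ - θ₀)))) :=
    Continuous.tendsto (by fun_prop) (0 : ℝ) |>.mono_left nhdsWithin_le_nhds
  have : (nhdsWithin (0 : ℝ) (Set.Ioo 0 1)).NeBot := by
    rw [nhdsWithin_Ioo_eq_nhdsGT one_pos]; infer_instance
  have h6 := le_of_tendsto hlim (eventually_nhdsWithin_of_forall fun r hr => key r hr.1 hr.2)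
  rw [← hΦ, div_mul_eq_mul_div, le_div_iff₀ hc]
  linarith

/-- The error of a quasi-likelihood estimator, in terms of a bound
`s` for the dual norm of the score. -/
theorem sqrt_designSq_le_of_score (hd : Differentiable ℝ g) (hS : Convex ℝ S) (hc : 0 < c)
    (hlow : ∀ s ∈ S, c ≤ deriv g s) {θ₀ θ : E} {b s : ℝ} (hs : 0 ≤ s)
    (h₀ : ∀ τ < t, ⟪z τ, θ₀⟫_ℝ ∈ S) (h : ∀ τ < t, ⟪z τ, θ⟫_ℝ ∈ S) (hb : ‖θ₀‖ ≤ b)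
    (hle : designSq z t (θ₀ - θ)
      ≤ 2 / c * (quasiObjective g c z D t θ - quasiObjective g c z D t θ₀))
    (hscore : ∑ τ ∈ Finset.range t, (D τ - g ⟪z τ, θ₀⟫_ℝ) * ⟪z τ, θ - θ₀⟫_ℝ
      ≤ s * √(designSq z t (θ - θ₀))) :
    √(designSq z t (θ - θ₀)) ≤ 2 * b + s / c := by
  have hneg : designSq z t (θ₀ - θ) = designSq z t (θ - θ₀) := by
    rw [← neg_sub θ θ₀, ← neg_one_smul ℝ (θ - θ₀), designSq_smul]
    ring
  rw [hneg, div_mul_eq_mul_div, le_div_iff₀ hc] at hle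
  have e := quasiObjective_le hd hS hlow (D := D) h₀ h
  have hq0 : 0 ≤ designSq z t (θ - θ₀) := (sq_nonneg _).trans (sq_norm_le_designSq _)
  have hn : ‖θ - θ₀‖ ≤ √(designSq z t (θ - θ₀)) := Real.le_sqrt_of_sq_le (sq_norm_le_designSq _)
  have hq := Real.sq_sqrt hq0
  obtain ⟨r, hr⟩ : ∃ r, r = √(designSq z t (θ - θ₀)) := ⟨_, rfl⟩
  rw [← hr] at hq hn hscore ⊢
  rw [← hq] at e hle
  have hin : -⟪θ₀, θ - θ₀⟫_ℝ ≤ b * ‖θ - θ₀‖ := by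
    have h1 := (abs_le.1 (abs_real_inner_le_norm θ₀ (θ - θ₀))).1
    have h2 := mul_le_mul_of_nonneg_right hb (norm_nonneg (θ - θ₀))
    linarith
  have hsl : quasiSlope g c z D t θ₀ (θ - θ₀) ≤ 2 * c * (b * ‖θ - θ₀‖) + s * r := by
    have : ∑ τ ∈ Finset.range t, (D τ - g ⟪z τ, θ₀⟫_ℝ) * ⟪z τ, θ - θ₀⟫_ℝ
        = -∑ τ ∈ Finset.range t, (g ⟪z τ, θ₀⟫_ℝ - D τ) * ⟪z τ, θ - θ₀⟫_ℝ := by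
      rw [← Finset.sum_neg_distrib]
      exact Finset.sum_congr rfl fun _ _ => by ring
    unfold quasiSlope
    nlinarith
  obtain ⟨x, hx⟩ : ∃ x, x = ‖θ - θ₀‖ := ⟨_, rfl⟩
  have hx0 : 0 ≤ x := hx ▸ norm_nonneg _
  rw [← hx] at e hn hsl
  have hb0 : 0 ≤ b := (norm_nonneg _).trans hb
  -- Two quadratic gains of `c r² / 2` add up: one from the expansion at `θ₀`, one from `hle`.
  have hmain : c * r ^ 2 ≤ 2 * c * (b * x) + s * r := by
    nlinarith [mul_nonneg hc.le (sq_nonneg x)]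
  rcases (hx0.trans hn).eq_or_lt with hr0 | hr0
  · rw [← hr0]
    positivity
  · have h8 : c * r ≤ c * (2 * b) + s := by
      refine le_of_mul_le_mul_right ?_ hr0
      nlinarith [mul_nonneg (mul_nonneg hc.le hb0) (sub_nonneg.2 hn)]
    rw [show 2 * b + s / c = (c * (2 * b) + s) / c by field_simp, le_div_iff₀ hc]
    linarith

/-- An exact maximizer need not depend measurably on the data, but the maximal value is a countable
supremum and therefore does. -/
theorem eq_iSup_denseSeq_of_forall_le {X : Type*} [TopologicalSpace X]
    [TopologicalSpace.SeparableSpace X] [Nonempty X] {f : X → ℝ} (hf : Continuous f) {x : X}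
    (hx : ∀ y, f y ≤ f x) : f x = ⨆ n, f (TopologicalSpace.denseSeq X n) := by
  have hb : BddAbove (Set.range fun n => f (TopologicalSpace.denseSeq X n)) :=
    ⟨f x, by rintro _ ⟨n, rfl⟩; exact hx _⟩
  refine le_antisymm ?_ (ciSup_le fun n => hx _)
  have hcl : IsClosed {y | f y ≤ ⨆ n, f (TopologicalSpace.denseSeq X n)} :=
    isClosed_le hf continuous_const
  exact (TopologicalSpace.denseRange_denseSeq X).induction_on
    (p := fun y => f y ≤ ⨆ n, f (TopologicalSpace.denseSeq X n)) x hcl fun n => le_ciSup hb n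

end QuasiLikelihood

/-! ### Gaussian tails and the freezing argument -/

section GaussianEstimates

/-- On `[1, 3/2]`, an interval of length one half, the density is at least 0.12. The value 0.06
leaves 0.05 after a truncation of probability at most 0.01. -/
theorem gaussianReal_Ici_one_ge : (6 / 100 : ℝ) ≤ (gaussianReal 0 1).real (Set.Ici 1) := by
  have h1 : ENNReal.ofReal (6 / 100) ≤ gaussianReal 0 1 (Set.Ici 1) := by
    rw [gaussianReal_apply _ one_ne_zero]
    calc ENNReal.ofReal (6 / 100)
        = ENNReal.ofReal (12 / 100) * volume (Set.Icc (1 : ℝ) (3 / 2)) := by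
          rw [Real.volume_Icc, ← ENNReal.ofReal_mul (by norm_num)]
          norm_num
      _ = ∫⁻ _ in Set.Icc (1 : ℝ) (3 / 2), ENNReal.ofReal (12 / 100) :=
          (setLIntegral_const _ _).symm
      _ ≤ ∫⁻ x in Set.Icc (1 : ℝ) (3 / 2), gaussianPDF 0 1 x := by
          refine setLIntegral_mono (measurable_gaussianPDF 0 1) fun x hx => ?_
          rw [gaussianPDF]
          refine ENNReal.ofReal_le_ofReal ?_
          rw [gaussianPDFReal]
          have hpi : √(2 * Real.pi * ((1 : NNReal) : ℝ)) ≤ 251 / 100 := by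
            refine Real.sqrt_le_iff.2 ⟨by norm_num, ?_⟩
            have := Real.pi_lt_d2
            norm_num
            linarith
          have hpos : 0 < √(2 * Real.pi * ((1 : NNReal) : ℝ)) := by
            simp only [NNReal.coe_one]; positivity
          have hexp : (31 / 100 : ℝ)
              ≤ Real.exp (-(x - 0) ^ 2 / (2 * ((1 : NNReal) : ℝ))) := by
            have h9 : (-(9 / 8) : ℝ) ≤ -(x - 0) ^ 2 / (2 * ((1 : NNReal) : ℝ)) := by
              simp only [NNReal.coe_one]
              nlinarith [hx.1, hx.2]
            refine le_trans ?_ (Real.exp_le_exp.2 h9)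
            rw [Real.exp_neg, le_inv_comm₀ (by norm_num) (Real.exp_pos _)]
            have e1 := Real.exp_one_lt_d9
            -- The reciprocal of `1 - 1/8 ≤ exp (-1/8)`.
            have e2 : Real.exp (1 / 8) ≤ 8 / 7 := by
              have := Real.one_sub_le_exp_neg (1 / 8)
              rw [Real.exp_neg, le_inv_comm₀ (by norm_num) (Real.exp_pos _)] at this
              norm_num at this ⊢
              linarith
            rw [show (9 / 8 : ℝ) = 1 + 1 / 8 by norm_num, Real.exp_add]
            nlinarith [Real.exp_pos 1, Real.exp_pos (1 / 8)]
          calc (12 / 100 : ℝ) ≤ (251 / 100)⁻¹ * (31 / 100) := by norm_num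
            _ ≤ _ := by gcongr
      _ ≤ ∫⁻ x in Set.Ici 1, gaussianPDF 0 1 x :=
          lintegral_mono_set fun x hx => hx.1
  rw [Measure.real, ← ENNReal.ofReal_le_iff_le_toReal (measure_ne_top _ _)]
  exact h1

theorem gaussianReal_Ici_le {r : ℝ} (hr : 0 ≤ r) :
    (gaussianReal 0 1).real (Set.Ici r) ≤ Real.exp (-(r ^ 2 / 2)) := by
  have h := measure_ge_le_exp_mul_mgf (μ := gaussianReal 0 1) (X := id) r hr
    (integrable_exp_mul_gaussianReal r)
  rw [mgf_id_gaussianReal, ← Real.exp_add] at h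
  refine h.trans (Real.exp_le_exp.2 (le_of_eq ?_))
  simp
  ring

variable {E : Type*} [NormedAddCommGroup E] [InnerProductSpace ℝ E] [FiniteDimensional ℝ E]
  [MeasurableSpace E] [BorelSpace E]

theorem map_inner_stdGaussian {u : E} (hu : ‖u‖ = 1) :
    (stdGaussian E).map (fun x => ⟪u, x⟫_ℝ) = gaussianReal 0 1 := by
  have h := IsGaussian.map_eq_gaussianReal (μ := stdGaussian E) (innerSL ℝ u)
  rw [variance_dual_stdGaussian, integral_strongDual_stdGaussian, innerSL_apply_norm, hu] at h
  simpa using h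

/-- The projection onto the direction of `u` is standard normal. For `u = 0` the event is certain,
so a degenerate direction needs no exclusion later. -/
theorem stdGaussian_norm_le_inner_ge (u : E) :
    (6 / 100 : ℝ) ≤ (stdGaussian E).real {x | ‖u‖ ≤ ⟪u, x⟫_ℝ} := by
  rcases eq_or_ne u 0 with rfl | hu
  · simp
    norm_num
  · have hu' : 0 < ‖u‖ := norm_pos_iff.2 hu
    have h1 : ‖(‖u‖⁻¹ • u)‖ = 1 := by
      rw [norm_smul, norm_inv, norm_norm, inv_mul_cancel₀ hu'.ne']
    have h2 : {x : E | ‖u‖ ≤ ⟪u, x⟫_ℝ} = (fun x => ⟪‖u‖⁻¹ • u, x⟫_ℝ) ⁻¹' Set.Ici 1 := by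
      ext x
      simp only [Set.mem_ofPred_eq, Set.mem_preimage, Set.mem_Ici, real_inner_smul_left]
      rw [← div_eq_inv_mul, one_le_div hu']
    rw [h2, ← map_measureReal_apply (by fun_prop) measurableSet_Ici, map_inner_stdGaussian h1]
    exact gaussianReal_Ici_one_ge

theorem stdGaussian_inner_ge_le {u : E} (hu : ‖u‖ = 1) {r : ℝ} (hr : 0 ≤ r) :
    (stdGaussian E).real {x | r ≤ ⟪u, x⟫_ℝ} ≤ Real.exp (-(r ^ 2 / 2)) := by
  have h2 : {x : E | r ≤ ⟪u, x⟫_ℝ} = (fun x => ⟪u, x⟫_ℝ) ⁻¹' Set.Ici r := rfl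
  rw [h2, ← map_measureReal_apply (by fun_prop) measurableSet_Ici, map_inner_stdGaussian hu]
  exact gaussianReal_Ici_le hr

/-- The tail of the norm of a standard Gaussian vector, by a union bound over coordinates. -/
theorem stdGaussian_norm_gt_le {ι : Type*} [Fintype ι] {r : ℝ} (hr : 0 ≤ r) :
    (stdGaussian (EuclideanSpace ℝ ι)).real {x | r * √(Fintype.card ι) < ‖x‖}
      ≤ Fintype.card ι * (2 * Real.exp (-(r ^ 2 / 2))) := by
  classical
  have hsub : {x : EuclideanSpace ℝ ι | r * √(Fintype.card ι) < ‖x‖}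
      ⊆ ⋃ i : ι, ({x : EuclideanSpace ℝ ι | r ≤ ⟪EuclideanSpace.single i (1 : ℝ), x⟫_ℝ}
        ∪ {x : EuclideanSpace ℝ ι | r ≤ ⟪-EuclideanSpace.single i (1 : ℝ), x⟫_ℝ}) := by
    intro x hx
    by_contra hcon
    simp only [Set.mem_iUnion, Set.mem_union, Set.mem_ofPred_eq, inner_neg_left,
      EuclideanSpace.inner_single_left, map_one, one_mul, not_exists, not_or, not_le] at hcon
    refine absurd (show r * √(Fintype.card ι) < ‖x‖ from hx) (not_lt.2 ?_)
    rw [EuclideanSpace.norm_eq]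
    refine Real.sqrt_le_iff.2 ⟨by positivity, ?_⟩
    rw [mul_pow, Real.sq_sqrt (by positivity)]
    calc ∑ i, ‖x i‖ ^ 2 ≤ ∑ _i : ι, r ^ 2 := by
          refine Finset.sum_le_sum fun i _ => ?_
          rw [Real.norm_eq_abs, sq_abs]
          have := hcon i
          exact sq_le_sq' (by linarith) this.1.le
      _ = r ^ 2 * Fintype.card ι := by simp [mul_comm]
  refine (measureReal_mono hsub).trans ((measureReal_iUnion_fintype_le _).trans ?_)
  calc ∑ i : ι, (stdGaussian (EuclideanSpace ℝ ι)).real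
        ({x : EuclideanSpace ℝ ι | r ≤ ⟪EuclideanSpace.single i (1 : ℝ), x⟫_ℝ}
        ∪ {x : EuclideanSpace ℝ ι | r ≤ ⟪-EuclideanSpace.single i (1 : ℝ), x⟫_ℝ})
      ≤ ∑ _i : ι, 2 * Real.exp (-(r ^ 2 / 2)) := by
        refine Finset.sum_le_sum fun i _ => (measureReal_union_le _ _).trans ?_
        rw [two_mul]
        exact add_le_add (stdGaussian_inner_ge_le (by simp) hr)
          (stdGaussian_inner_ge_le (by simp) hr)
    _ = _ := by simp

/-- Freezing: if for every relevant value of `X` the independent variable `η` falls into the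
slice of `O` with probability at least `p`, then `p E[V(X)] ≤ E[V(X) 1_O(X, η)]`. -/
theorem mul_lintegral_le_of_indepFun {Ω B E : Type*} {m : MeasurableSpace Ω} {μ : Measure Ω}
    [IsProbabilityMeasure μ] [MeasurableSpace B] [MeasurableSpace E] {X : Ω → B} {η : Ω → E}
    (hX : Measurable X) (hη : Measurable η) (hind : IndepFun X η μ) {V : B → ENNReal}
    (hV : Measurable V) {O : Set (B × E)} (hO : MeasurableSet O) {p : ENNReal}
    (hp : ∀ b, V b ≠ 0 → p ≤ (μ.map η) (Prod.mk b ⁻¹' O)) :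
    p * ∫⁻ ω, V (X ω) ∂μ ≤ ∫⁻ ω, O.indicator (fun y => V y.1) (X ω, η ω) ∂μ := by
  have := Measure.isProbabilityMeasure_map (μ := μ) hη.aemeasurable
  have hF : Measurable (O.indicator fun y : B × E => V y.1) :=
    (hV.comp measurable_fst).indicator hO
  have h1 := (indepFun_iff_map_prod_eq_prod_map_map hX.aemeasurable hη.aemeasurable).1 hind
  rw [← lintegral_map hF (hX.prodMk hη), h1, lintegral_prod _ hF.aemeasurable,
    lintegral_map (hF.lintegral_prod_right') hX,
    ← lintegral_const_mul p (f := fun ω => V (X ω)) (hV.comp hX)]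
  refine lintegral_mono fun ω => ?_
  have h2 : ∀ e, O.indicator (fun y : B × E => V y.1) (X ω, e)
      = (Prod.mk (X ω) ⁻¹' O).indicator (fun _ => V (X ω)) e := fun e => by
    by_cases he : (X ω, e) ∈ O
    · rw [Set.indicator_of_mem he, Set.indicator_of_mem (show e ∈ Prod.mk (X ω) ⁻¹' O from he)]
    · rw [Set.indicator_of_notMem he,
        Set.indicator_of_notMem (show e ∉ Prod.mk (X ω) ⁻¹' O from he)]
  simp only [h2]
  rw [lintegral_indicator_const (measurable_prodMk_left hO), mul_comm]
  -- Where `V` vanishes, `hp` gives no information, but then both sides are zero.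
  by_cases h0 : V (X ω) = 0
  · simp [h0]
  · gcongr
    exact hp _ h0

end GaussianEstimates

/-! ### Deterministic bounds in the demand model -/

section ModelBounds

theorem EuclideanSpace.inner_eq_dotProduct {ι : Type*} [Fintype ι] (u v : EuclideanSpace ℝ ι) :
    ⟪u, v⟫_ℝ = (fun i => u i) ⬝ᵥ (fun i => v i) := by
  simp [PiLp.inner_apply, dotProduct, mul_comm]

theorem EuclideanSpace.norm_sq_eq_dotProduct {ι : Type*} [Fintype ι] (u : EuclideanSpace ℝ ι) :
    ‖u‖ ^ 2 = (fun i => u i) ⬝ᵥ (fun i => u i) := by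
  rw [← real_inner_self_eq_norm_sq, EuclideanSpace.inner_eq_dotProduct]

theorem continuous_feature {d : ℕ} :
    Continuous fun y : CovVec d × ℝ => feature y.1 y.2 := by
  unfold feature
  refine (PiLp.continuous_toLp 2 _).comp (continuous_pi fun i => ?_)
  cases i <;> simp only [Sum.elim_inl, Sum.elim_inr] <;> fun_prop

namespace PricingModel

variable {d : ℕ} {P : PricingModel d} {T : ℕ} {Δbar : ENNReal}

/-- The radius `2 √(d log(4dT²))` of the Gaussian sampling vectors. -/
noncomputable def samplingRadius (d T : ℕ) : ℝ := 2 * √(d * Real.log (4 * d * T ^ 2))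

theorem samplingRadius_nonneg (d T : ℕ) : 0 ≤ samplingRadius d T := by
  unfold samplingRadius; positivity

/-- Used to absorb lower-order regret terms, which are proportional to `θbar`, into the confidence
width. -/
theorem two_mul_radius_le_alphaBar (hB : P.Bounded) (hg : 0 < P.gLo) (hσ : 0 < P.σ) :
    2 * P.θbar ≤ P.alphaBar 1 T := by
  have := hB.θbar_pos
  unfold alphaBar
  rw [Real.sqrt_one, mul_one]
  exact le_add_of_nonneg_right (by positivity)

theorem paramSet_subset_enlargedSet (hB : P.Bounded) (hg : 0 < P.gLo) (hσ : 0 < P.σ) :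
    P.paramSet ⊆ P.enlargedSet 1 T Δbar := by
  intro θ hθ
  refine ⟨θ, hθ, 0, le_rfl, by simp, ?_⟩
  have h0 := hB.θbar_pos
  have h1 : 0 ≤ P.alphaBar 1 T := by linarith [two_mul_radius_le_alphaBar (T := T) hB hg hσ]
  simp only [sub_self, norm_zero]
  positivity

theorem convex_paramSet : Convex ℝ P.paramSet := by
  have : P.paramSet = Metric.closedBall 0 P.θbar := by ext; simp [paramSet]
  rw [this]
  exact convex_closedBall _ _

theorem inner_mem_predictorRange {x : CovVec d} (hx : x ∈ P.X) {p : ℝ}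
    (hp : p ∈ Set.Icc P.pLo P.pHi) {θ : ParVec d} (hθ : θ ∈ P.enlargedSet 1 T Δbar) :
    ⟪feature x p, θ⟫_ℝ ∈ P.predictorRange 1 T Δbar :=
  ⟨x, hx, p, hp, θ, hθ, rfl⟩

theorem LinkRegular.abs_sub_le (hL : P.LinkRegular 1 T Δbar) {a b : ℝ}
    (ha : a ∈ P.predictorRange 1 T Δbar) (hb : b ∈ P.predictorRange 1 T Δbar) :
    |P.g a - P.g b| ≤ P.gHi * |a - b| := by
  have h := hL.convex.1.norm_image_sub_le_of_norm_deriv_le (f := P.g) (C := P.gHi)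
    (fun s _ => hL.differentiable s) (fun s hs => ?_) hb ha
  · simpa only [Real.norm_eq_abs] using h
  · rw [Real.norm_eq_abs, abs_of_nonneg (hL.gLo_pos.le.trans (hL.deriv_bounds s hs).1)]
    exact (hL.deriv_bounds s hs).2

theorem Bounded.pHi_pos (hB : P.Bounded) {x : CovVec d} (hx : x ∈ P.X) : 0 < P.pHi := by
  obtain ⟨p, hp, -⟩ := hB.optPrice_interior x hx
  linarith [hB.pLo_nonneg, hp.1, hp.2]

theorem LinkRegular.gHi_pos (hL : P.LinkRegular 1 T Δbar) {s : ℝ}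
    (hs : s ∈ P.predictorRange 1 T Δbar) : 0 < P.gHi :=
  hL.gLo_pos.trans_le ((hL.deriv_bounds s hs).1.trans (hL.deriv_bounds s hs).2)

/-- The optimal revenue over the feasible prices. -/
noncomputable def feasibleRevenue (P : PricingModel d) (θ : ParVec d) (x : CovVec d) : ℝ :=
  sSup ((fun p => P.revenue p θ x) '' Set.Icc P.pLo P.pHi)

theorem continuous_revenue (hg : Continuous P.g) :
    Continuous fun y : (ParVec d × CovVec d) × ℝ => P.revenue y.2 y.1.1 y.1.2 := by
  unfold revenue
  refine continuous_snd.mul (hg.comp (Continuous.inner ?_ ?_))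
  · exact continuous_feature.comp (by fun_prop : Continuous fun y : (ParVec d × CovVec d) × ℝ =>
      (y.1.2, y.2))
  · fun_prop

theorem continuous_feasibleRevenue (hg : Continuous P.g) :
    Continuous fun y : ParVec d × CovVec d => P.feasibleRevenue y.1 y.2 :=
  isCompact_Icc.continuous_sSup (f := fun (y : ParVec d × CovVec d) p => P.revenue p y.1 y.2)
    (continuous_revenue hg)

theorem continuous_revenue_price (hg : Continuous P.g) (θ : ParVec d) (x : CovVec d) :
    Continuous fun p => P.revenue p θ x :=
  (continuous_revenue hg).comp (by fun_prop : Continuous fun p : ℝ => ((θ, x), p))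

theorem feasibleRevenue_isGreatest (hg : Continuous P.g) (hne : P.pLo ≤ P.pHi) (θ : ParVec d)
    (x : CovVec d) : IsGreatest ((fun p => P.revenue p θ x) '' Set.Icc P.pLo P.pHi)
      (P.feasibleRevenue θ x) :=
  (isCompact_Icc.image (continuous_revenue_price hg θ x)).isGreatest_sSup
    ((Set.nonempty_Icc.2 hne).image _)

theorem revenue_le_feasibleRevenue (hg : Continuous P.g) (θ : ParVec d) (x : CovVec d) {p : ℝ}
    (hp : p ∈ Set.Icc P.pLo P.pHi) : P.revenue p θ x ≤ P.feasibleRevenue θ x :=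
  (feasibleRevenue_isGreatest hg (hp.1.trans hp.2) θ x).2 ⟨p, hp, rfl⟩

theorem feasibleRevenue_eq_of_isMaxOn {θ : ParVec d} {x : CovVec d} {p : ℝ}
    (hp : p ∈ Set.Icc P.pLo P.pHi)
    (hmax : IsMaxOn (fun q => P.revenue q θ x) (Set.Icc P.pLo P.pHi) p) :
    P.feasibleRevenue θ x = P.revenue p θ x :=
  IsGreatest.csSup_eq ⟨⟨p, hp, rfl⟩, by rintro _ ⟨q, hq, rfl⟩; exact hmax hq⟩

/-- The benchmark ranges over all nonnegative prices, the algorithm over a compact interval; they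
agree because some global maximizer lies inside the interval. -/
theorem Bounded.optRevenue_eq (hB : P.Bounded) {x : CovVec d} (hx : x ∈ P.X) :
    P.optRevenue P.θstar x = P.feasibleRevenue P.θstar x := by
  obtain ⟨p, hp, hmax⟩ := hB.optPrice_interior x hx
  have hp0 : 0 ≤ p := hB.pLo_nonneg.trans hp.1.le
  rw [feasibleRevenue_eq_of_isMaxOn (Set.Ioo_subset_Icc_self hp)
    (hmax.on_subset fun q hq => hB.pLo_nonneg.trans hq.1)]
  exact IsGreatest.csSup_eq ⟨⟨p, hp0, rfl⟩, by rintro _ ⟨q, hq, rfl⟩; exact hmax hq⟩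

theorem Bounded.abs_inner_le (hB : P.Bounded) {x : CovVec d} (hx : x ∈ P.X) {p : ℝ}
    (hp : p ∈ Set.Icc P.pLo P.pHi) {θ : ParVec d} (hθ : θ ∈ P.paramSet) :
    |⟪feature x p, θ⟫_ℝ| ≤ P.θbar :=
  calc |⟪feature x p, θ⟫_ℝ| ≤ ‖feature x p‖ * ‖θ‖ := abs_real_inner_le_norm _ _
    _ ≤ 1 * ‖θ‖ := by gcongr; exact hB.feature_norm_le x hx p hp
    _ ≤ P.θbar := by rw [one_mul]; exact hθ

/-- The first-order condition at the optimal price bounds the optimal demand. -/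
theorem abs_demand_at_optPrice_le (hB : P.Bounded) (hL : P.LinkRegular 1 T Δbar) (hσ : 0 < P.σ)
    {x : CovVec d} (hx : x ∈ P.X) {p : ℝ} (hp : p ∈ Set.Ioo P.pLo P.pHi)
    (hmax : IsMaxOn (fun q => P.revenue q P.θstar x) (Set.Ici 0) p) :
    |P.g ⟪feature x p, P.θstar⟫_ℝ| ≤ P.gHi * P.θbar := by
  have hp0 : 0 < p := hB.pLo_nonneg.trans_lt hp.1
  have hpI := Set.Ioo_subset_Icc_self hp
  obtain ⟨b, hb⟩ : ∃ b, b = ∑ i, x i * P.θstar (Sum.inr i) := ⟨_, rfl⟩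
  have hin : ∀ q, ⟪feature x q, P.θstar⟫_ℝ = (∑ i, x i * P.θstar (Sum.inl i)) + b * q :=
    fun q => by rw [inner_feature, hb]
  have hs := inner_mem_predictorRange (T := T) (Δbar := Δbar) hx hpI
    (paramSet_subset_enlargedSet hB hL.gLo_pos hσ hB.θstar_mem)
  have hder : HasDerivAt (fun q => P.revenue q P.θstar x)
      (1 * P.g ⟪feature x p, P.θstar⟫_ℝ
        + p * (deriv P.g ⟪feature x p, P.θstar⟫_ℝ * b)) p := by
    have h1 : HasDerivAt (fun q => ⟪feature x q, P.θstar⟫_ℝ) b p := by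
      simp only [hin]
      simpa using ((hasDerivAt_id p).const_mul b).const_add (∑ i, x i * P.θstar (Sum.inl i))
    exact (hasDerivAt_id p).mul ((hL.differentiable _).hasDerivAt.comp p h1)
  -- At an interior maximizer the derivative vanishes, so the demand there equals `-g' · (p b)`.
  have hloc : IsLocalMax (fun q => P.revenue q P.θstar x) p :=
    hmax.isLocalMax (Ici_mem_nhds hp0)
  have hzero := hloc.hasDerivAt_eq_zero hder
  -- `p b` is the predictor of the parameter obtained from `θ*` by erasing the `β` block, which does
  -- not increase the norm.
  have hpb : |p * b| ≤ P.θbar := by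
    have h2 : p * b = ⟪feature x p, (WithLp.toLp 2
        (Sum.elim (fun _ => 0) fun i => P.θstar (Sum.inr i)) : ParVec d)⟫_ℝ := by
      rw [inner_feature, hb]
      simp [mul_comm]
    rw [h2]
    refine hB.abs_inner_le hx hpI ?_
    refine le_trans ?_ (show ‖P.θstar‖ ≤ P.θbar from hB.θstar_mem)
    rw [EuclideanSpace.norm_eq, EuclideanSpace.norm_eq]
    refine Real.sqrt_le_sqrt ?_
    simp only [Fintype.sum_sum_type, Sum.elim_inl, Sum.elim_inr, norm_zero]
    have : 0 ≤ ∑ i, ‖P.θstar (Sum.inl i)‖ ^ 2 := Finset.sum_nonneg fun _ _ => sq_nonneg _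
    simpa using this
  have hd := hL.deriv_bounds _ hs
  have h3 : P.g ⟪feature x p, P.θstar⟫_ℝ = -(deriv P.g ⟪feature x p, P.θstar⟫_ℝ * (p * b)) := by
    linarith
  rw [h3, abs_neg, abs_mul, abs_of_nonneg (hL.gLo_pos.le.trans hd.1)]
  exact mul_le_mul hd.2 hpb (abs_nonneg _) (hL.gHi_pos hs).le

/-- The regret of a feasible price is bounded. -/
theorem regret_le_of_feasible (hB : P.Bounded) (hL : P.LinkRegular 1 T Δbar) (hσ : 0 < P.σ)
    {x : CovVec d} (hx : x ∈ P.X) {p : ℝ} (hp : p ∈ Set.Icc P.pLo P.pHi) :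
    P.feasibleRevenue P.θstar x - P.revenue p P.θstar x ≤ 3 * (P.pHi * P.gHi * P.θbar) := by
  obtain ⟨q, hq, hmax⟩ := hB.optPrice_interior x hx
  have hqI := Set.Ioo_subset_Icc_self hq
  have hθ := paramSet_subset_enlargedSet (T := T) (Δbar := Δbar) hB hL.gLo_pos hσ hB.θstar_mem
  rw [feasibleRevenue_eq_of_isMaxOn hqI (hmax.on_subset fun q hq => hB.pLo_nonneg.trans hq.1)]
  unfold revenue
  have h1 := abs_demand_at_optPrice_le hB hL hσ hx hq hmax
  have h2 := hL.abs_sub_le (inner_mem_predictorRange hx hqI hθ) (inner_mem_predictorRange hx hp hθ)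
  have h3 := hB.abs_inner_le hx hqI hB.θstar_mem
  have h4 := hB.abs_inner_le hx hp hB.θstar_mem
  have hg := (hL.gHi_pos (inner_mem_predictorRange hx hp hθ)).le
  have h5 : |⟪feature x q, P.θstar⟫_ℝ - ⟪feature x p, P.θstar⟫_ℝ| ≤ 2 * P.θbar := by
    rw [abs_le] at h3 h4 ⊢
    constructor <;> linarith [h3.1, h3.2, h4.1, h4.2]
  have h6 := h2.trans (mul_le_mul_of_nonneg_left h5 hg)
  obtain ⟨a, ha⟩ : ∃ a, a = P.g ⟪feature x q, P.θstar⟫_ℝ := ⟨_, rfl⟩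
  obtain ⟨b, hb⟩ : ∃ b, b = P.g ⟪feature x p, P.θstar⟫_ℝ := ⟨_, rfl⟩
  rw [← ha, ← hb] at h6 ⊢
  rw [← ha] at h1
  have hp0 : 0 ≤ p := hB.pLo_nonneg.trans hp.1
  -- The regret is `q a - p b = (q - p) a + p (a - b)`. The first part costs one unit `pHi gHi
  -- θbar`, the second two, hence the constant 3.
  have h7 : (q - p) * a ≤ P.pHi * (P.gHi * P.θbar) := by
    refine (le_abs_self _).trans ?_
    rw [abs_mul]
    refine mul_le_mul ?_ h1 (abs_nonneg _) (hB.pHi_pos hx).le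
    rw [abs_le]
    constructor <;> linarith [hq.1, hq.2, hp.1, hp.2, hB.pLo_nonneg]
  have h8 : p * (a - b) ≤ P.pHi * (P.gHi * (2 * P.θbar)) :=
    (mul_le_mul_of_nonneg_left ((le_abs_self _).trans h6) hp0).trans
      (mul_le_mul_of_nonneg_right hp.2 (by have := hB.θbar_pos; positivity))
  nlinarith

theorem revenue_sub_le (hB : P.Bounded) (hL : P.LinkRegular 1 T Δbar)
    {x : CovVec d} (hx : x ∈ P.X) {p : ℝ} (hp : p ∈ Set.Icc P.pLo P.pHi) {θ θ' : ParVec d}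
    (hθ : θ ∈ P.enlargedSet 1 T Δbar) (hθ' : θ' ∈ P.enlargedSet 1 T Δbar) :
    P.revenue p θ x - P.revenue p θ' x ≤ P.pHi * P.gHi * |⟪feature x p, θ - θ'⟫_ℝ| := by
  have h := hL.abs_sub_le (inner_mem_predictorRange hx hp hθ) (inner_mem_predictorRange hx hp hθ')
  have hp0 : 0 ≤ p := hB.pLo_nonneg.trans hp.1
  have hg := (hL.gHi_pos (inner_mem_predictorRange hx hp hθ)).le
  unfold revenue
  rw [← mul_sub, inner_sub_right, mul_assoc]
  exact (mul_le_mul_of_nonneg_left ((le_abs_self _).trans h) hp0).trans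
    (mul_le_mul_of_nonneg_right hp.2 (by positivity))

end PricingModel

end ModelBounds

/-! ### Optimism and concentration of the sampled parameter -/

section SamplingGeometry

namespace PricingModel

variable {d : ℕ} {P : PricingModel d} {T : ℕ} {Δbar : ENNReal}

/-- A square matrix acting on parameter vectors. -/
noncomputable def matAct (N : Fin d ⊕ Fin d → Fin d ⊕ Fin d → ℝ) (e : ParVec d) : ParVec d :=
  WithLp.toLp 2 (Matrix.mulVec N fun i => e i)

theorem matAct_sub (N : Fin d ⊕ Fin d → Fin d ⊕ Fin d → ℝ) (e e' : ParVec d) :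
    matAct N (e - e') = matAct N e - matAct N e' := by
  ext i
  simp [matAct, Matrix.mulVec, dotProduct, mul_sub]

theorem inner_matAct {N : Fin d ⊕ Fin d → Fin d ⊕ Fin d → ℝ} (hN : ∀ i j, N i j = N j i)
    (v e : ParVec d) : ⟪v, matAct N e⟫_ℝ = ⟪matAct N v, e⟫_ℝ := by
  rw [EuclideanSpace.inner_eq_dotProduct, EuclideanSpace.inner_eq_dotProduct]
  have h := dotProduct_mulVec_symm (A := N) (Matrix.IsHermitian.ext fun i j => by simp [hN i j])
    (fun i => v i)
    (fun i => e i)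
  simp only [matAct]
  rw [h, dotProduct_comm]

theorem continuous_matAct :
    Continuous fun y : (Fin d ⊕ Fin d → Fin d ⊕ Fin d → ℝ) × ParVec d => matAct y.1 y.2 := by
  unfold matAct
  refine (PiLp.continuous_toLp 2 _).comp (continuous_pi fun i => ?_)
  simp only [Matrix.mulVec, dotProduct]
  fun_prop

/-- What determines the law of the sampled parameter and the price: estimator, confidence width,
inverse square root of the design matrix, covariates. -/
abbrev SamplingState (d : ℕ) : Type :=
  ParVec d × ℝ × (Fin d ⊕ Fin d → Fin d ⊕ Fin d → ℝ) × CovVec d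

/-- The sampled parameter as a function of the sampling vector. -/
noncomputable def perturbed (b : SamplingState d) (e : ParVec d) : ParVec d :=
  b.1 + b.2.1 • matAct b.2.2.1 e

theorem continuous_perturbed :
    Continuous fun y : SamplingState d × ParVec d => perturbed y.1 y.2 := by
  have h : Continuous fun y : SamplingState d × ParVec d => matAct y.1.2.2.1 y.2 :=
    continuous_matAct.comp
      (by fun_prop : Continuous fun y : SamplingState d × ParVec d => (y.1.2.2.1, y.2))
  unfold perturbed
  fun_prop

/-- The states whose confidence ellipsoid contains the true parameter. -/
def coveringStates (P : PricingModel d) : Set (SamplingState d) :=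
  {b | 0 ≤ b.2.1 ∧ (∀ i j, b.2.2.1 i j = b.2.2.1 j i)
    ∧ ∀ v, ⟪v, P.θstar - b.1⟫_ℝ ≤ b.2.1 * ‖matAct b.2.2.1 v‖}

/-- The ellipsoid is described through its support function, so covering is an intersection of
closed conditions over all directions `v`. Closedness serves as the measurability certificate. -/
theorem isClosed_coveringStates : IsClosed P.coveringStates := by
  have h3 : ∀ v : ParVec d, Continuous fun b : SamplingState d => matAct b.2.2.1 v := fun v =>
    continuous_matAct.comp (by fun_prop : Continuous fun b : SamplingState d => (b.2.2.1, v))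
  have e1 : IsClosed {b : SamplingState d | 0 ≤ b.2.1} :=
    isClosed_le continuous_const (by fun_prop)
  have e2 : IsClosed (⋂ i, ⋂ j, {b : SamplingState d | b.2.2.1 i j = b.2.2.1 j i}) :=
    isClosed_iInter fun i => isClosed_iInter fun j => isClosed_eq (by fun_prop) (by fun_prop)
  have e3 : IsClosed (⋂ v : ParVec d,
      {b : SamplingState d | ⟪v, P.θstar - b.1⟫_ℝ ≤ b.2.1 * ‖matAct b.2.2.1 v‖}) :=
    isClosed_iInter fun v => isClosed_le (by fun_prop)
      ((by fun_prop : Continuous fun b : SamplingState d => b.2.1).mul (h3 v).norm)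
  have e4 : P.coveringStates = {b : SamplingState d | 0 ≤ b.2.1}
      ∩ ((⋂ i, ⋂ j, {b : SamplingState d | b.2.2.1 i j = b.2.2.1 j i})
        ∩ ⋂ v : ParVec d,
          {b : SamplingState d | ⟪v, P.θstar - b.1⟫_ℝ ≤ b.2.1 * ‖matAct b.2.2.1 v‖}) := by
    ext b
    simp [coveringStates]
  rw [e4]
  exact e1.inter (e2.inter e3)

theorem continuous_feasibleRevenue_comp (hg : Continuous P.g) {Y : Type*} [TopologicalSpace Y]
    {f : Y → ParVec d} {x : Y → CovVec d} (hf : Continuous f) (hx : Continuous x) :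
    Continuous fun y => P.feasibleRevenue (f y) (x y) := by
  have h := (continuous_feasibleRevenue hg).comp (hf.prodMk hx)
  simpa only [Function.comp_def] using h

/-- The shortfall of the optimal revenue of the sampled parameter. -/
noncomputable def shortfall (P : PricingModel d) (b : SamplingState d) (e : ParVec d) : ℝ :=
  P.feasibleRevenue P.θstar b.2.2.2 - P.feasibleRevenue (perturbed b e) b.2.2.2

/-- The worst shortfall over the sampling vectors of norm at most `ρ`. -/
noncomputable def worstShortfall (P : PricingModel d) (ρ : ℝ) (b : SamplingState d) : ℝ :=
  sSup (P.shortfall b '' Metric.closedBall 0 ρ)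

theorem continuous_shortfall (hg : Continuous P.g) :
    Continuous fun y : SamplingState d × ParVec d => P.shortfall y.1 y.2 := by
  have h0 : Continuous fun y : SamplingState d × ParVec d => y.1.2.2.2 := by fun_prop
  have h3 : Continuous fun y : SamplingState d × ParVec d =>
      P.feasibleRevenue P.θstar y.1.2.2.2 :=
    continuous_feasibleRevenue_comp hg (f := fun _ => P.θstar) continuous_const h0
  have h4 : Continuous fun y : SamplingState d × ParVec d =>
      P.feasibleRevenue (perturbed y.1 y.2) y.1.2.2.2 :=
    continuous_feasibleRevenue_comp hg continuous_perturbed h0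
  unfold shortfall
  exact h3.sub h4

/-- A supremum over a compact ball is continuous in the state, hence measurable with respect to the
past. -/
theorem continuous_worstShortfall (hg : Continuous P.g) (ρ : ℝ) :
    Continuous (P.worstShortfall ρ) :=
  (isCompact_closedBall (0 : ParVec d) ρ).continuous_sSup (f := P.shortfall)
    (continuous_shortfall hg)

theorem shortfall_le_worstShortfall (hg : Continuous P.g) {ρ : ℝ} (b : SamplingState d)
    {e : ParVec d} (he : ‖e‖ ≤ ρ) : P.shortfall b e ≤ P.worstShortfall ρ b := by
  have h1 : Continuous fun e : ParVec d => (b, e) := by fun_prop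
  have hc : Continuous fun e => P.shortfall b e := by
    simpa only [Function.comp_def] using (continuous_shortfall hg).comp h1
  exact le_csSup ((isCompact_closedBall (0 : ParVec d) ρ).bddAbove_image hc.continuousOn)
    ⟨e, by simpa using he, rfl⟩

/-- The sampling vectors of radius `ρ` for which the sampled parameter is optimistic. -/
def optimisticSet (P : PricingModel d) (ρ : ℝ) : Set (SamplingState d × ParVec d) :=
  {y | ‖y.2‖ ≤ ρ ∧ P.shortfall y.1 y.2 ≤ 0}

theorem isClosed_optimisticSet (hg : Continuous P.g) (ρ : ℝ) : IsClosed (P.optimisticSet ρ) := by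
  have h1 : IsClosed {y : SamplingState d × ParVec d | ‖y.2‖ ≤ ρ} :=
    isClosed_le (by fun_prop) continuous_const
  have h2 : IsClosed {y : SamplingState d × ParVec d | P.shortfall y.1 y.2 ≤ 0} :=
    isClosed_le (continuous_shortfall hg) continuous_const
  exact h1.inter h2

/-- The union bound over `2d` coordinates and two signs at level `√(2 log(4dT²))` gives `4d /
(4dT²)`, exactly `T⁻²`. -/
theorem stdGaussian_samplingRadius_lt_le (hd : 0 < d) (hT : 0 < T) :
    (stdGaussian (ParVec d)).real {e | samplingRadius d T < ‖e‖} ≤ 1 / (T : ℝ) ^ 2 := by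
  have hd1 : (1 : ℝ) ≤ d := by exact_mod_cast hd
  have hT1 : (1 : ℝ) ≤ T := by exact_mod_cast hT
  have hT2 : (1 : ℝ) ≤ (T : ℝ) ^ 2 := one_le_pow₀ hT1
  have harg : (1 : ℝ) ≤ 4 * d * T ^ 2 := by nlinarith
  have hlog := Real.log_nonneg harg
  have h := stdGaussian_norm_gt_le (ι := Fin d ⊕ Fin d)
    (r := √(2 * Real.log (4 * d * T ^ 2))) (Real.sqrt_nonneg _)
  have hr : √(2 * Real.log (4 * d * T ^ 2)) * √(Fintype.card (Fin d ⊕ Fin d) : ℝ)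
      = samplingRadius d T := by
    rw [← Real.sqrt_mul (by positivity), samplingRadius]
    rw [show (2 : ℝ) * √(d * Real.log (4 * d * T ^ 2))
      = √(2 ^ 2 * (d * Real.log (4 * d * T ^ 2))) by
        rw [Real.sqrt_mul (by positivity) (d * _), Real.sqrt_sq (by norm_num)]]
    congr 1
    simp
    ring
  rw [hr] at h
  refine h.trans (le_of_eq ?_)
  rw [Real.sq_sqrt (by positivity), mul_div_cancel_left₀ _ two_ne_zero, Real.exp_neg,
    Real.exp_log (by linarith)]
  simp
  field_simp
  ring

/-- Optimism has constant probability, because the link function is increasing. -/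
theorem optimistic_of_inner_ge (hL : P.LinkRegular 1 T Δbar) (hlo : 0 ≤ P.pLo)
    (hne : P.pLo ≤ P.pHi) {b : SamplingState d} (hb : b ∈ P.coveringStates) :
    ∃ u : ParVec d, ∀ e, ‖u‖ ≤ ⟪u, e⟫_ℝ → P.shortfall b e ≤ 0 := by
  obtain ⟨hc, hN, hcov⟩ := hb
  have hg := hL.differentiable.continuous
  obtain ⟨p, hp, hpmax⟩ := (feasibleRevenue_isGreatest hg hne P.θstar b.2.2.2).1
  -- The direction is the rescaled feature at the optimal price of `θ*`. If `e` exceeds `‖u‖` along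
  -- `u`, covering makes the sampled predictor at that price at least the true one; monotonicity of
  -- `g` and `p ≥ 0` carry this over to revenues.
  refine ⟨matAct b.2.2.1 (feature b.2.2.2 p), fun e he => sub_nonpos.2 ?_⟩
  refine le_trans ?_ (revenue_le_feasibleRevenue hg (perturbed b e) b.2.2.2 hp)
  rw [← hpmax]
  refine mul_le_mul_of_nonneg_left (hL.strictMono.monotone ?_) (hlo.trans hp.1)
  have h1 := hcov (feature b.2.2.2 p)
  have h2 := mul_le_mul_of_nonneg_left he hc
  rw [perturbed, inner_add_right, inner_smul_right, inner_matAct hN]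
  rw [inner_sub_right] at h1
  linarith

theorem stdGaussian_optimistic_ge (hL : P.LinkRegular 1 T Δbar) (hlo : 0 ≤ P.pLo)
    (hne : P.pLo ≤ P.pHi) (hd : 0 < d) (hT : 10 ≤ T) {b : SamplingState d}
    (hb : b ∈ P.coveringStates) :
    ENNReal.ofReal (5 / 100)
      ≤ stdGaussian (ParVec d) (Prod.mk b ⁻¹' P.optimisticSet (samplingRadius d T)) := by
  obtain ⟨u, hu⟩ := optimistic_of_inner_ge hL hlo hne hb
  have hd1 : (1 : ℝ) ≤ d := by exact_mod_cast hd
  have hT1 : (10 : ℝ) ≤ T := by exact_mod_cast hT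
  have hsub : {e : ParVec d | ‖u‖ ≤ ⟪u, e⟫_ℝ} \ {e : ParVec d | samplingRadius d T < ‖e‖}
      ⊆ Prod.mk b ⁻¹' P.optimisticSet (samplingRadius d T) := fun e he =>
    ⟨not_lt.1 he.2, hu e he.1⟩
  have h1 := stdGaussian_norm_le_inner_ge u
  have h2 := stdGaussian_samplingRadius_lt_le hd (show 0 < T by omega)
  have h3 : (5 / 100 : ℝ) ≤ (stdGaussian (ParVec d)).real
      ({e : ParVec d | ‖u‖ ≤ ⟪u, e⟫_ℝ} \ {e : ParVec d | samplingRadius d T < ‖e‖}) := by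
    have h4 := measureReal_mono (μ := stdGaussian (ParVec d)) (show
      {e : ParVec d | ‖u‖ ≤ ⟪u, e⟫_ℝ} ⊆ ({e : ParVec d | ‖u‖ ≤ ⟪u, e⟫_ℝ}
        \ {e : ParVec d | samplingRadius d T < ‖e‖}) ∪ {e : ParVec d | samplingRadius d T < ‖e‖}
      from by rw [Set.sdiff_union_self]; exact Set.subset_union_left)
    have h5 := measureReal_union_le (μ := stdGaussian (ParVec d)) ({e : ParVec d | ‖u‖ ≤ ⟪u, e⟫_ℝ}
        \ {e : ParVec d | samplingRadius d T < ‖e‖}) {e : ParVec d | samplingRadius d T < ‖e‖}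
    have h6 : 1 / (T : ℝ) ^ 2 ≤ 1 / 100 := by
      apply one_div_le_one_div_of_le (by norm_num)
      nlinarith
    linarith
  calc ENNReal.ofReal (5 / 100) ≤ ENNReal.ofReal ((stdGaussian (ParVec d)).real
      ({e : ParVec d | ‖u‖ ≤ ⟪u, e⟫_ℝ} \ {e : ParVec d | samplingRadius d T < ‖e‖})) :=
        ENNReal.ofReal_le_ofReal h3
    _ = stdGaussian (ParVec d) ({e : ParVec d | ‖u‖ ≤ ⟪u, e⟫_ℝ}
        \ {e : ParVec d | samplingRadius d T < ‖e‖}) := by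
        rw [ofReal_measureReal]
    _ ≤ _ := measure_mono hsub

/-- A state of the algorithm that satisfies the a priori bounds. -/
structure Admissible (P : PricingModel d) (T : ℕ) (Δbar : ENNReal) (b : SamplingState d) :
    Prop where
  mem_paramSet : b.1 ∈ P.paramSet
  width_nonneg : 0 ≤ b.2.1
  width_le : ∃ δ : ℝ, 0 ≤ δ ∧ ENNReal.ofReal δ ≤ Δbar ∧ b.2.1 ≤ P.alphaBar 1 T + √(2 * δ / P.gLo)
  symm : ∀ i j, b.2.2.1 i j = b.2.2.1 j i
  contraction : ∀ e : ParVec d, ‖matAct b.2.2.1 e‖ ≤ ‖e‖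
  covariate_mem : b.2.2.2 ∈ P.X

/-- The shape of the enlarged set is designed for this: `M ≥ I` makes `M^{-1/2}` a contraction, so a
truncated sample moves at most `ρ` times the width bound. -/
theorem Admissible.perturbed_mem {b : SamplingState d} (hb : P.Admissible T Δbar b)
    {e : ParVec d} (he : ‖e‖ ≤ samplingRadius d T) :
    perturbed b e ∈ P.enlargedSet 1 T Δbar := by
  obtain ⟨δ, h0, h1, h2⟩ := hb.width_le
  refine ⟨b.1, hb.mem_paramSet, δ, h0, h1, ?_⟩
  rw [perturbed, add_sub_cancel_left, norm_smul, Real.norm_eq_abs, abs_of_nonneg hb.width_nonneg,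
    mul_comm]
  exact mul_le_mul ((hb.contraction e).trans he) h2 hb.width_nonneg (samplingRadius_nonneg d T)

/-- Two samples of radius `ρ` give similar revenues. -/
theorem Admissible.revenue_perturbed_sub_le (hB : P.Bounded) (hL : P.LinkRegular 1 T Δbar)
    {b : SamplingState d} (hb : P.Admissible T Δbar b) {p : ℝ} (hp : p ∈ Set.Icc P.pLo P.pHi)
    {e e' : ParVec d} (he : ‖e‖ ≤ samplingRadius d T) (he' : ‖e'‖ ≤ samplingRadius d T) :
    P.revenue p (perturbed b e) b.2.2.2 - P.revenue p (perturbed b e') b.2.2.2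
      ≤ P.pHi * P.gHi * (2 * samplingRadius d T * b.2.1
          * ‖matAct b.2.2.1 (feature b.2.2.2 p)‖) := by
  refine (revenue_sub_le hB hL hb.covariate_mem hp (hb.perturbed_mem he)
    (hb.perturbed_mem he')).trans ?_
  have hg := (hL.gHi_pos
    (inner_mem_predictorRange hb.covariate_mem hp (hb.perturbed_mem he))).le
  have hpos := (hB.pHi_pos hb.covariate_mem).le
  refine mul_le_mul_of_nonneg_left ?_ (mul_nonneg hpos hg)
  have h1 : perturbed b e - perturbed b e' = b.2.1 • matAct b.2.2.1 (e - e') := by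
    rw [matAct_sub, perturbed, perturbed]; module
  rw [h1, inner_smul_right, inner_matAct hb.symm, abs_mul, abs_of_nonneg hb.width_nonneg]
  have h2 := abs_real_inner_le_norm (matAct b.2.2.1 (feature b.2.2.2 p)) (e - e')
  have h3 : ‖e - e'‖ ≤ 2 * samplingRadius d T := (norm_sub_le e e').trans (by linarith)
  calc b.2.1 * |⟪matAct b.2.2.1 (feature b.2.2.2 p), e - e'⟫_ℝ|
      ≤ b.2.1 * (‖matAct b.2.2.1 (feature b.2.2.2 p)‖ * (2 * samplingRadius d T)) :=
        mul_le_mul_of_nonneg_left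
          (h2.trans (mul_le_mul_of_nonneg_left h3 (norm_nonneg _))) hb.width_nonneg
    _ = _ := by ring

/-- On the good event a sample and the true parameter give similar revenues. -/
theorem Admissible.revenue_perturbed_sub_true_le (hB : P.Bounded) (hL : P.LinkRegular 1 T Δbar)
    (hσ : 0 < P.σ) {b : SamplingState d} (hb : P.Admissible T Δbar b)
    (hcov : b ∈ P.coveringStates) {p : ℝ} (hp : p ∈ Set.Icc P.pLo P.pHi)
    {e : ParVec d} (he : ‖e‖ ≤ samplingRadius d T) :
    P.revenue p (perturbed b e) b.2.2.2 - P.revenue p P.θstar b.2.2.2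
      ≤ P.pHi * P.gHi * ((samplingRadius d T + 1) * b.2.1
          * ‖matAct b.2.2.1 (feature b.2.2.2 p)‖) := by
  have hθ := paramSet_subset_enlargedSet (T := T) (Δbar := Δbar) hB hL.gLo_pos hσ hB.θstar_mem
  refine (revenue_sub_le hB hL hb.covariate_mem hp (hb.perturbed_mem he) hθ).trans ?_
  have hg := (hL.gHi_pos (inner_mem_predictorRange hb.covariate_mem hp hθ)).le
  have hpos := (hB.pHi_pos hb.covariate_mem).le
  refine mul_le_mul_of_nonneg_left ?_ (mul_nonneg hpos hg)
  obtain ⟨w, hw⟩ : ∃ w, w = ‖matAct b.2.2.1 (feature b.2.2.2 p)‖ := ⟨_, rfl⟩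
  -- Covering is one-sided in `v`; using both signs of the feature gives the absolute value.
  have h1 := hcov.2.2 (feature b.2.2.2 p)
  have h2 := hcov.2.2 (-feature b.2.2.2 p)
  have h3 : matAct b.2.2.1 (-feature b.2.2.2 p) = -matAct b.2.2.1 (feature b.2.2.2 p) := by
    have h0 : matAct b.2.2.1 (0 : ParVec d) = 0 := by
      have := matAct_sub b.2.2.1 (0 : ParVec d) 0
      simpa using this
    have := matAct_sub b.2.2.1 0 (feature b.2.2.2 p)
    rwa [zero_sub, h0, zero_sub] at this
  rw [h3, norm_neg, inner_neg_left] at h2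
  have h4 : perturbed b e - P.θstar = b.2.1 • matAct b.2.2.1 e - (P.θstar - b.1) := by
    rw [perturbed]; module
  rw [h4, inner_sub_right, inner_smul_right, inner_matAct hb.symm]
  have h5 := abs_real_inner_le_norm (matAct b.2.2.1 (feature b.2.2.2 p)) e
  rw [← hw] at h1 h2 h5 ⊢
  have hw0 : 0 ≤ w := hw ▸ norm_nonneg _
  have h6 : |⟪matAct b.2.2.1 (feature b.2.2.2 p), e⟫_ℝ| ≤ samplingRadius d T * w :=
    h5.trans (by rw [mul_comm]; exact mul_le_mul_of_nonneg_right he hw0)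
  have h7 : |b.2.1 * ⟪matAct b.2.2.1 (feature b.2.2.2 p), e⟫_ℝ|
      ≤ b.2.1 * (samplingRadius d T * w) := by
    rw [abs_mul, abs_of_nonneg hb.width_nonneg]
    exact mul_le_mul_of_nonneg_left h6 hb.width_nonneg
  rw [abs_le] at h7 ⊢
  constructor <;> nlinarith [h7.1, h7.2]

/-- The regret of the price that is optimal for the sampled parameter, on the good event. -/
theorem Admissible.regret_le (hB : P.Bounded) (hL : P.LinkRegular 1 T Δbar)
    (hσ : 0 < P.σ) {b : SamplingState d} (hb : P.Admissible T Δbar b)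
    (hcov : b ∈ P.coveringStates) {p : ℝ} (hp : p ∈ Set.Icc P.pLo P.pHi)
    {e : ParVec d} (he : ‖e‖ ≤ samplingRadius d T)
    (hmax : IsMaxOn (fun q => P.revenue q (perturbed b e) b.2.2.2) (Set.Icc P.pLo P.pHi) p) :
    P.feasibleRevenue P.θstar b.2.2.2 - P.revenue p P.θstar b.2.2.2
      ≤ P.worstShortfall (samplingRadius d T) b
        + P.pHi * P.gHi * ((samplingRadius d T + 1) * b.2.1
          * ‖matAct b.2.2.1 (feature b.2.2.2 p)‖) := by
  have h1 := hb.revenue_perturbed_sub_true_le hB hL hσ hcov hp he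
  have h2 := shortfall_le_worstShortfall hL.differentiable.continuous b he
  rw [shortfall, feasibleRevenue_eq_of_isMaxOn hp hmax] at h2
  linarith

/-- For an optimistic sample the worst shortfall is bounded through the chosen price. -/
theorem Admissible.worstShortfall_le (hB : P.Bounded) (hL : P.LinkRegular 1 T Δbar)
    {b : SamplingState d} (hb : P.Admissible T Δbar b) {p : ℝ} (hp : p ∈ Set.Icc P.pLo P.pHi)
    {e : ParVec d} (he : (b, e) ∈ P.optimisticSet (samplingRadius d T))
    (hmax : IsMaxOn (fun q => P.revenue q (perturbed b e) b.2.2.2) (Set.Icc P.pLo P.pHi) p) :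
    P.worstShortfall (samplingRadius d T) b
      ≤ P.pHi * P.gHi * (2 * samplingRadius d T * b.2.1
          * ‖matAct b.2.2.1 (feature b.2.2.2 p)‖) := by
  refine csSup_le ((Metric.nonempty_closedBall.2 (samplingRadius_nonneg d T)).image _) ?_
  rintro _ ⟨e', he', rfl⟩
  -- Optimism bounds `r*(θ*)` by the revenue of the sample `e` at its own price `p`, and the sample
  -- `e'` earns at least its revenue at the same `p`. Only a difference of two samples at `p` is
  -- left.
  have h1 := he.2
  simp only at h1
  rw [shortfall, feasibleRevenue_eq_of_isMaxOn hp hmax] at h1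
  have h2 := hb.revenue_perturbed_sub_le hB hL hp he.1 (e' := e') (by simpa using he')
  have h3 := revenue_le_feasibleRevenue hL.differentiable.continuous (perturbed b e') b.2.2.2 hp
  rw [shortfall]
  linarith

end PricingModel

end SamplingGeometry

/-! ### Measurability along a run and the probability of a large score -/

section RunMeasurability

namespace PricingRun

variable {d : ℕ} {Ω : Type*} {P : PricingModel d} {R : PricingRun d Ω} {T : ℕ} {Δbar : ENNReal}

theorem measurable_z [MeasurableSpace Ω] {t : ℕ} (hx : Measurable (R.x t))
    (hp : Measurable (R.p t)) : Measurable (R.z t) :=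
  continuous_feature.measurable.comp (hx.prodMk hp)

theorem measurable_z_apply [MeasurableSpace Ω] {t : ℕ} (hx : Measurable (R.x t))
    (hp : Measurable (R.p t)) (i : Fin d ⊕ Fin d) : Measurable fun ω => R.z t ω i :=
  (EuclideanSpace.proj (𝕜 := ℝ) i).continuous.measurable.comp (measurable_z hx hp)

theorem measurable_demand [MeasurableSpace Ω] (hg : Continuous P.g) {t : ℕ}
    (hx : Measurable (R.x t)) (hp : Measurable (R.p t)) (hε : Measurable (R.ε t)) :
    Measurable (R.demand P t) := by
  have h1 : Continuous fun v : ParVec d => P.g ⟪v, P.θstar⟫_ℝ := hg.comp (by fun_prop)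
  exact (h1.measurable.comp (measurable_z hx hp)).add hε

theorem design_one (t : ℕ) (ω : Ω) :
    R.design 1 t ω = gramMatrix (fun τ i => R.z τ ω i) t := by
  simp [design, gramMatrix]

/-- The quasi-log-likelihood of the first `t` periods, up to a constant that does not depend on
the parameter. -/
noncomputable def logLik (R : PricingRun d Ω) (P : PricingModel d) (t : ℕ) (ω : Ω)
    (θ : ParVec d) : ℝ :=
  quasiObjective P.g P.gLo (fun τ => R.z τ ω) (fun τ => R.demand P τ ω) t θ

theorem measurable_logLik [MeasurableSpace Ω] (hg : Continuous P.g) {t : ℕ}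
    (hx : ∀ τ < t, Measurable (R.x τ)) (hp : ∀ τ < t, Measurable (R.p τ))
    (hε : ∀ τ < t, Measurable (R.ε τ)) {θ : Ω → ParVec d} (hθ : Measurable θ) :
    Measurable fun ω => R.logLik P t ω (θ ω) := by
  unfold logLik quasiObjective
  refine Measurable.sub (by fun_prop) (Finset.measurable_sum _ fun τ hτ => ?_)
  have hτ' := Finset.mem_range.1 hτ
  have h1 : Measurable fun ω => ⟪R.z τ ω, θ ω⟫_ℝ :=
    (measurable_z (hx τ hτ') (hp τ hτ')).inner hθ
  exact ((continuous_linkPotential hg).measurable.comp h1).sub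
    ((measurable_demand hg (hx τ hτ') (hp τ hτ') (hε τ hτ')).mul h1)

/-- The approximation gap, written with a countable supremum. -/
noncomputable def gapSup (R : PricingRun d Ω) (P : PricingModel d) [Nonempty P.paramSet] (t : ℕ)
    (ω : Ω) : ℝ :=
  (⨆ n, R.logLik P t ω (TopologicalSpace.denseSeq P.paramSet n))
    - R.logLik P t ω (R.θcheck t ω)

theorem measurable_gapSup [MeasurableSpace Ω] [Nonempty P.paramSet] (hg : Continuous P.g) {t : ℕ}
    (hx : ∀ τ < t, Measurable (R.x τ)) (hp : ∀ τ < t, Measurable (R.p τ))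
    (hε : ∀ τ < t, Measurable (R.ε τ)) (hθ : Measurable (R.θcheck t)) :
    Measurable (R.gapSup P t) :=
  (Measurable.iSup fun _ => measurable_logLik hg hx hp hε measurable_const).sub
    (measurable_logLik hg hx hp hε hθ)

/-- The inverse square root of the design matrix. -/
noncomputable def invSqrtDesign (R : PricingRun d Ω) (t : ℕ) (ω : Ω) (i j : Fin d ⊕ Fin d) : ℝ :=
  CFC.sqrt (R.design 1 t ω)⁻¹ i j

/-- The state of the algorithm before the price of a period is sampled. -/
noncomputable def state (R : PricingRun d Ω) (P : PricingModel d) [Nonempty P.paramSet] (T t : ℕ)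
    (ω : Ω) : PricingModel.SamplingState d :=
  (R.θcheck t ω, √(2 / P.gLo * R.gapSup P t ω) + P.alpha 1 T (R.design 1 t ω),
    R.invSqrtDesign t ω, R.x t ω)

theorem measurable_design_apply [MeasurableSpace Ω] {t : ℕ}
    (hx : ∀ τ < t, Measurable (R.x τ)) (hp : ∀ τ < t, Measurable (R.p τ))
    (i j : Fin d ⊕ Fin d) : Measurable fun ω => R.design 1 t ω i j := by
  simp only [design_one]
  exact measurable_gramMatrix_apply (z := fun τ ω i => R.z τ ω i)
    (fun τ hτ i => measurable_z_apply (hx τ hτ) (hp τ hτ) i) i j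

theorem design_posDef (t : ℕ) (ω : Ω) : (R.design 1 t ω).PosDef := by
  rw [design_one]
  exact gramMatrix_posDef _ t

theorem measurable_state [MeasurableSpace Ω] [Nonempty P.paramSet] (hg : Continuous P.g)
    {t : ℕ} (hx : ∀ τ ≤ t, Measurable (R.x τ)) (hp : ∀ τ < t, Measurable (R.p τ))
    (hε : ∀ τ < t, Measurable (R.ε τ)) (hθ : Measurable (R.θcheck t)) :
    Measurable (R.state P T t) := by
  have hM : ∀ i j, Measurable fun ω => R.design 1 t ω i j :=
    measurable_design_apply (fun τ hτ => hx τ hτ.le) hp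
  have hgap := measurable_gapSup hg (fun τ hτ => hx τ hτ.le) hp hε hθ
  have hdet := measurable_det hM
  have hN : ∀ i j, Measurable fun ω => CFC.sqrt (R.design 1 t ω)⁻¹ i j :=
    measurable_sqrt_apply (measurable_inv_apply hM) fun ω => (design_posDef t ω).inv.posSemidef
  have hα : Measurable fun ω => P.alpha 1 T (R.design 1 t ω) := by
    unfold PricingModel.alpha
    exact measurable_const.add (measurable_const.mul
      ((measurable_const.add (hdet.div_const _).log).sqrt))
  refine hθ.prodMk (Measurable.prodMk ((hgap.const_mul _).sqrt.add hα) (Measurable.prodMk ?_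
    (hx t le_rfl)))
  exact measurable_pi_iff.2 fun i => measurable_pi_iff.2 fun j => hN i j

theorem matNorm_inv_eq (t : ℕ) (ω : Ω) (v : ParVec d) :
    matNorm (R.design 1 t ω)⁻¹ v
      = ‖PricingModel.matAct (R.invSqrtDesign t ω) v‖ := by
  rw [matNorm, ← (design_posDef t ω).sqrt_inv_dotProduct, ← Real.sqrt_sq (norm_nonneg _),
    EuclideanSpace.norm_sq_eq_dotProduct]
  rfl

theorem designSq_eq (t : ℕ) (ω : Ω) (v : ParVec d) :
    designSq (fun τ => R.z τ ω) t v
      = (fun i => v i) ⬝ᵥ (R.design 1 t ω).mulVec (fun i => v i) := by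
  rw [design_one, dotProduct_gramMatrix_mulVec, designSq, EuclideanSpace.norm_sq_eq_dotProduct]
  simp only [EuclideanSpace.inner_eq_dotProduct]

theorem abs_inner_le_matNorm (t : ℕ) (ω : Ω) (u v : ParVec d) :
    |⟪u, v⟫_ℝ| ≤ matNorm (R.design 1 t ω)⁻¹ u * √(designSq (fun τ => R.z τ ω) t v) := by
  rw [designSq_eq, EuclideanSpace.inner_eq_dotProduct]
  exact (design_posDef t ω).dotProduct_le_sqrt_mul_sqrt _ _

theorem matNorm_nonneg (M : Matrix (Fin d ⊕ Fin d) (Fin d ⊕ Fin d) ℝ) (v : ParVec d) :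
    0 ≤ matNorm M v := Real.sqrt_nonneg _

theorem matNorm_inv_le_norm (t : ℕ) (ω : Ω) (v : ParVec d) :
    matNorm (R.design 1 t ω)⁻¹ v ≤ ‖v‖ := by
  rw [matNorm, ← Real.sqrt_sq (norm_nonneg v), EuclideanSpace.norm_sq_eq_dotProduct]
  refine Real.sqrt_le_sqrt (inv_quadForm_le (design_posDef t ω) (fun w => ?_) _)
  rw [design_one]
  exact dotProduct_self_le_gramMatrix _ t w

/-- The dual norm of the score of the true parameter is within the confidence width. -/
def ScoreBounded (R : PricingRun d Ω) (P : PricingModel d) (T t : ℕ) (ω : Ω) : Prop :=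
  shockSum (fun τ i => R.z τ ω i) (fun τ => R.ε τ ω) t ⬝ᵥ (R.design 1 t ω)⁻¹.mulVec
      (shockSum (fun τ i => R.z τ ω i) (fun τ => R.ε τ ω) t)
    ≤ (2 * P.σ * √(2 * Real.log T + Real.log (R.design 1 t ω).det)) ^ 2

section Filtered

variable {m : MeasurableSpace Ω} {μ : Measure Ω} {𝓕 : Filtration ℕ m}

theorem IsThompsonRun.measurable_x_of_le (hRun : R.IsThompsonRun P μ 𝓕 1 T) {τ t : ℕ}
    (hτ : τ < T) (h : τ ≤ t) : Measurable[𝓕 t] (R.x τ) :=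
  (hRun.measurable_x τ hτ).mono (𝓕.mono h) le_rfl

theorem IsThompsonRun.measurable_p_of_lt (hRun : R.IsThompsonRun P μ 𝓕 1 T) {τ t : ℕ}
    (hτ : τ < T) (h : τ < t) : Measurable[𝓕 t] (R.p τ) :=
  (hRun.measurable_p τ hτ).mono (𝓕.mono h) le_rfl

theorem SubGaussianShocks.measurable_of_lt (hShock : R.SubGaussianShocks P μ 𝓕 T) {τ t : ℕ}
    (hτ : τ < T) (h : τ < t) : Measurable[𝓕 t] (R.ε τ) :=
  (hShock.measurable_shock τ hτ).mono (𝓕.mono h) le_rfl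

theorem IsThompsonRun.priceInfo_le (hRun : R.IsThompsonRun P μ 𝓕 1 T) {t : ℕ} (ht : t < T) :
    R.priceInfo 𝓕 t ≤ 𝓕 (t + 1) :=
  sup_le (sup_le (𝓕.mono (Nat.le_succ t)) (hRun.measurable_η t ht).comap_le)
    (hRun.measurable_p t ht).comap_le

theorem le_priceInfo (t : ℕ) : 𝓕 t ≤ R.priceInfo 𝓕 t := le_sup_left.trans le_sup_left

theorem measurable_p_priceInfo (t : ℕ) : Measurable[R.priceInfo 𝓕 t] (R.p t) :=
  (comap_measurable (R.p t)).mono le_sup_right le_rfl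

theorem SubGaussianShocks.condSubGaussian (hShock : R.SubGaussianShocks P μ 𝓕 T)
    (hRun : R.IsThompsonRun P μ 𝓕 1 T) {t : ℕ} (ht : t < T) :
    CondSubGaussian (R.priceInfo 𝓕 t) μ P.σ (R.ε t) where
  le := (hRun.priceInfo_le ht).trans (𝓕.le _)
  measurable := (hShock.measurable_shock t ht).mono (𝓕.le _) le_rfl
  integrable_exp := hShock.integrable_exp t ht
  condExp_exp_le := hShock.condExp_exp_le t ht

/-- The case `τ = t` matters: the current regressor contains the current price, which is known in
`priceInfo` but not in `𝓕 t`. -/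
theorem IsThompsonRun.measurable_z_priceInfo (hRun : R.IsThompsonRun P μ 𝓕 1 T) {τ t : ℕ}
    (ht : t < T) (h : τ ≤ t) (i : Fin d ⊕ Fin d) :
    Measurable[R.priceInfo 𝓕 t] fun ω => R.z τ ω i := by
  have hx : Measurable[R.priceInfo 𝓕 t] (R.x τ) :=
    (hRun.measurable_x_of_le (h.trans_lt ht) h).mono (le_priceInfo t) le_rfl
  have hp : Measurable[R.priceInfo 𝓕 t] (R.p τ) := by
    rcases h.eq_or_lt with rfl | h
    · exact measurable_p_priceInfo τ
    · exact (hRun.measurable_p_of_lt (h.trans ht) h).mono (le_priceInfo t) le_rfl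
  exact @measurable_z_apply d Ω R (R.priceInfo 𝓕 t) τ hx hp i

/-- The score leaves its confidence region with probability at most `T⁻²`. -/
theorem measure_not_scoreBounded_le [IsProbabilityMeasure μ]
    (hShock : R.SubGaussianShocks P μ 𝓕 T) (hRun : R.IsThompsonRun P μ 𝓕 1 T) {t : ℕ}
    (ht : t < T) : μ {ω | ¬ R.ScoreBounded P T t ω} ≤ ENNReal.ofReal (1 / (T : ℝ) ^ 2) := by
  have hT1 : (1 : ℝ) ≤ T := by exact_mod_cast (Nat.one_le_of_lt ht)
  have hlog := Real.log_nonneg hT1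
  -- The level `2 log T` yields probability `T⁻²`. Its threshold `σ² (log det + 4 log T)` lies below
  -- `4σ² (2 log T + log det)`, the one allowed by the width.
  have h := measure_selfNormalized_gt_le hShock.σ_pos (μ := μ) (z := fun τ ω i => R.z τ ω i)
    (ε := R.ε) (G := fun τ => R.priceInfo 𝓕 τ) t
    (fun τ hτ => hShock.condSubGaussian hRun (hτ.trans ht))
    (fun τ hτ τ' hτ' i => hRun.measurable_z_priceInfo (hτ.trans ht) hτ' i)
    (fun τ hτ τ' hτ' => (hShock.measurable_of_lt (hτ'.trans (hτ.trans ht)) hτ').mono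
      (le_priceInfo τ) le_rfl) (2 * Real.log T)
  have he : Real.exp (-(2 * Real.log T)) = 1 / (T : ℝ) ^ 2 := by
    rw [Real.exp_neg, show 2 * Real.log (T : ℝ) = Real.log ((T : ℝ) ^ 2) by simp,
      Real.exp_log (by positivity), one_div]
  rw [he] at h
  refine (measure_mono fun ω hω => ?_).trans h
  simp only [Set.mem_ofPred_eq, ScoreBounded, not_le] at hω ⊢
  rw [design_one] at hω
  have hdet := Real.log_nonneg (one_le_det_gramMatrix (fun τ i => R.z τ ω i) t)
  rw [mul_pow, Real.sq_sqrt (by positivity)] at hω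
  refine lt_of_le_of_lt ?_ hω
  nlinarith [sq_nonneg P.σ, mul_nonneg (sq_nonneg P.σ) hdet, mul_nonneg (sq_nonneg P.σ) hlog]

end Filtered

end PricingRun

end RunMeasurability

/-! ### Pathwise consequences: gaps, widths and coverage -/

section RegularPaths

namespace PricingRun

variable {d : ℕ} {Ω : Type*} {P : PricingModel d} {R : PricingRun d Ω} {T : ℕ} {Δbar : ENNReal}

/-- The realized demand may lie outside the range where `g` is controlled, so a single integral
cannot be substituted. In the difference the endpoint `D` cancels and both remaining endpoints are
values of `g` on the predictor range. -/
theorem quasiLik_sub (hB : P.Bounded) (hL : P.LinkRegular 1 T Δbar) (hσ : 0 < P.σ) {t : ℕ}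
    {ω : Ω} (hx : R.x t ω ∈ P.X) (hp : R.p t ω ∈ Set.Icc P.pLo P.pHi)
    (hint : ∀ θ ∈ P.paramSet,
      IntervalIntegrable (fun u => 1 / P.h u * (u - R.demand P t ω)) volume
        (R.demand P t ω) (P.g ⟪R.z t ω, θ⟫_ℝ))
    {θ θ' : ParVec d} (hθ : θ ∈ P.paramSet) (hθ' : θ' ∈ P.paramSet) :
    R.quasiLik P t ω θ - R.quasiLik P t ω θ'
      = -(linkPotential P.g ⟪R.z t ω, θ⟫_ℝ - R.demand P t ω * ⟪R.z t ω, θ⟫_ℝ)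
        + (linkPotential P.g ⟪R.z t ω, θ'⟫_ℝ - R.demand P t ω * ⟪R.z t ω, θ'⟫_ℝ) := by
  have hsub := PricingModel.paramSet_subset_enlargedSet (T := T) (Δbar := Δbar) hB hL.gLo_pos hσ
  have h1 := integral_link_substitution hL.strictMono hL.differentiable hL.convex.1
    (fun s hs => hL.gLo_pos.trans_le (hL.deriv_bounds s hs).1)
    (PricingModel.inner_mem_predictorRange hx hp (hsub hθ'))
    (PricingModel.inner_mem_predictorRange hx hp (hsub hθ)) (R.demand P t ω)
  rw [integral_sub_const_eq_linkPotential hL.differentiable.continuous] at h1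
  have h2 := intervalIntegral.integral_interval_sub_left (hint θ hθ) (hint θ' hθ')
  have h3 : ∫ u in (P.g ⟪R.z t ω, θ'⟫_ℝ)..(P.g ⟪R.z t ω, θ⟫_ℝ),
      1 / P.h u * (u - R.demand P t ω)
        = (linkPotential P.g ⟪R.z t ω, θ⟫_ℝ - R.demand P t ω * ⟪R.z t ω, θ⟫_ℝ)
          - (linkPotential P.g ⟪R.z t ω, θ'⟫_ℝ - R.demand P t ω * ⟪R.z t ω, θ'⟫_ℝ) := h1
  unfold quasiLik
  linarith

theorem objective_sub (hB : P.Bounded) (hL : P.LinkRegular 1 T Δbar) (hσ : 0 < P.σ) {t : ℕ}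
    {ω : Ω} (hx : ∀ τ < t, R.x τ ω ∈ P.X) (hp : ∀ τ < t, R.p τ ω ∈ Set.Icc P.pLo P.pHi)
    (hint : ∀ τ < t, ∀ θ ∈ P.paramSet,
      IntervalIntegrable (fun u => 1 / P.h u * (u - R.demand P τ ω)) volume
        (R.demand P τ ω) (P.g ⟪R.z τ ω, θ⟫_ℝ))
    {θ θ' : ParVec d} (hθ : θ ∈ P.paramSet) (hθ' : θ' ∈ P.paramSet) :
    R.objective P 1 t ω θ - R.objective P 1 t ω θ' = R.logLik P t ω θ - R.logLik P t ω θ' := by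
  have h : ∑ τ ∈ Finset.range t, R.quasiLik P τ ω θ - ∑ τ ∈ Finset.range t, R.quasiLik P τ ω θ'
      = -(∑ τ ∈ Finset.range t,
          (linkPotential P.g ⟪R.z τ ω, θ⟫_ℝ - R.demand P τ ω * ⟪R.z τ ω, θ⟫_ℝ))
        + ∑ τ ∈ Finset.range t,
          (linkPotential P.g ⟪R.z τ ω, θ'⟫_ℝ - R.demand P τ ω * ⟪R.z τ ω, θ'⟫_ℝ) := by
    rw [← Finset.sum_sub_distrib, ← Finset.sum_neg_distrib, ← Finset.sum_add_distrib]
    refine Finset.sum_congr rfl fun τ hτ => ?_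
    have hτ' := Finset.mem_range.1 hτ
    exact quasiLik_sub hB hL hσ (hx τ hτ') (hp τ hτ') (hint τ hτ') hθ hθ'
  unfold objective logLik quasiObjective
  rw [one_mul]
  linarith

/-- The properties of a path of the algorithm that hold almost surely. -/
structure RegularPath (R : PricingRun d Ω) (P : PricingModel d) (T : ℕ) (Δbar : ENNReal)
    (ω : Ω) : Prop where
  x_mem : ∀ t < T, R.x t ω ∈ P.X
  p_mem : ∀ t < T, R.p t ω ∈ Set.Icc P.pLo P.pHi
  p_max : ∀ t < T, IsMaxOn (fun q => P.revenue q (R.sampled P 1 T t ω) (R.x t ω))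
    (Set.Icc P.pLo P.pHi) (R.p t ω)
  θcheck_mem : ∀ t < T, R.θcheck t ω ∈ P.paramSet
  θhat_mem : ∀ t < T, R.θhat t ω ∈ P.paramSet
  θhat_max : ∀ t < T, IsMaxOn (R.logLik P t ω) P.paramSet (R.θhat t ω)
  gap_eq : ∀ t < T, R.gap P 1 t ω
    = R.logLik P t ω (R.θhat t ω) - R.logLik P t ω (R.θcheck t ω)
  gap_le : ∀ t < T, ENNReal.ofReal (R.gap P 1 t ω) ≤ Δbar

theorem IsThompsonRun.ae_regularPath {m : MeasurableSpace Ω} {μ : Measure Ω}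
    {𝓕 : Filtration ℕ m} (hB : P.Bounded) (hL : P.LinkRegular 1 T Δbar) (hσ : 0 < P.σ)
    (hRun : R.IsThompsonRun P μ 𝓕 1 T)
    (hGap : ∀ᵐ ω ∂μ, ∀ t < T, ENNReal.ofReal (R.gap P 1 t ω) ≤ Δbar) :
    ∀ᵐ ω ∂μ, R.RegularPath P T Δbar ω := by
  filter_upwards [hRun.x_mem, hRun.quasiLik_exists, hRun.θhat_argmax, hRun.θcheck_mem,
    hRun.price_argmax, hGap] with ω hx hq hhat hcheck hp hgap
  have hsub : ∀ t < T, ∀ θ ∈ P.paramSet, ∀ θ' ∈ P.paramSet,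
      R.objective P 1 t ω θ - R.objective P 1 t ω θ' = R.logLik P t ω θ - R.logLik P t ω θ' :=
    fun t ht θ hθ θ' hθ' => objective_sub hB hL hσ (fun τ hτ => hx τ (hτ.trans ht))
      (fun τ hτ => (hp τ (hτ.trans ht)).1) (fun τ hτ => hq τ (hτ.trans ht)) hθ hθ'
  refine ⟨hx, fun t ht => (hp t ht).1, fun t ht => (hp t ht).2, hcheck,
    fun t ht => (hhat t ht).1, fun t ht θ hθ => ?_, fun t ht => ?_, hgap⟩
  · have h1 := hsub t ht θ hθ _ (hhat t ht).1
    have h2 : R.objective P 1 t ω θ ≤ R.objective P 1 t ω (R.θhat t ω) := (hhat t ht).2 hθ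
    simp only [Set.mem_ofPred_eq]
    linarith
  · exact hsub t ht _ (hhat t ht).1 _ (hcheck t ht)

variable {ω : Ω} {t : ℕ}

theorem RegularPath.gap_nonneg (hω : R.RegularPath P T Δbar ω) (ht : t < T) :
    0 ≤ R.gap P 1 t ω := by
  rw [hω.gap_eq t ht]
  exact sub_nonneg.2 (hω.θhat_max t ht (hω.θcheck_mem t ht))

theorem RegularPath.gapSup_eq [Nonempty P.paramSet] (hg : Continuous P.g)
    (hω : R.RegularPath P T Δbar ω) (ht : t < T) : R.gapSup P t ω = R.gap P 1 t ω := by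
  rw [hω.gap_eq t ht, gapSup]
  congr 1
  have hc : Continuous fun θ : P.paramSet => R.logLik P t ω θ :=
    (continuous_quasiObjective hg).comp continuous_subtype_val
  exact (eq_iSup_denseSeq_of_forall_le hc (x := ⟨_, hω.θhat_mem t ht⟩)
    fun θ => hω.θhat_max t ht θ.2).symm

theorem RegularPath.sampled_eq [Nonempty P.paramSet] (hg : Continuous P.g)
    (hω : R.RegularPath P T Δbar ω) (ht : t < T) :
    R.sampled P 1 T t ω = PricingModel.perturbed (R.state P T t ω) (R.η t ω) := by
  unfold sampled PricingModel.perturbed state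
  rw [hω.gapSup_eq hg ht]
  rfl

theorem RegularPath.norm_z_le (hB : P.Bounded) (hω : R.RegularPath P T Δbar ω) (ht : t < T) :
    ‖R.z t ω‖ ≤ 1 :=
  hB.feature_norm_le _ (hω.x_mem t ht) _ (hω.p_mem t ht)

theorem RegularPath.z_dotProduct_le (hB : P.Bounded) (hω : R.RegularPath P T Δbar ω)
    (ht : t < T) : (fun i => R.z t ω i) ⬝ᵥ (fun i => R.z t ω i) ≤ 1 := by
  rw [← EuclideanSpace.norm_sq_eq_dotProduct]
  exact pow_le_one₀ (norm_nonneg _) (hω.norm_z_le hB ht)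

theorem RegularPath.alpha_le (hB : P.Bounded) (hg : 0 < P.gLo) (hσ : 0 < P.σ) (hd : 0 < d)
    (hω : R.RegularPath P T Δbar ω) (ht : t < T) :
    P.alpha 1 T (R.design 1 t ω) ≤ P.alphaBar 1 T := by
  have : Nonempty (Fin d ⊕ Fin d) := ⟨Sum.inl ⟨0, hd⟩⟩
  have h := log_det_gramMatrix_le (fun τ i => R.z τ ω i) t T ht.le
    fun τ hτ => hω.z_dotProduct_le hB (hτ.trans ht)
  unfold PricingModel.alpha PricingModel.alphaBar
  rw [design_one, one_pow, div_one, mul_one]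
  have hcard : (Fintype.card (Fin d ⊕ Fin d) : ℝ) = 2 * d := by simp; ring
  rw [hcard] at h
  gcongr

theorem alpha_nonneg (hB : P.Bounded) (hg : 0 < P.gLo) (hσ : 0 < P.σ)
    (M : Matrix (Fin d ⊕ Fin d) (Fin d ⊕ Fin d) ℝ) : 0 ≤ P.alpha 1 T M := by
  have := hB.θbar_pos
  unfold PricingModel.alpha
  positivity

theorem RegularPath.admissible [Nonempty P.paramSet] (hB : P.Bounded)
    (hL : P.LinkRegular 1 T Δbar) (hσ : 0 < P.σ) (hd : 0 < d)
    (hω : R.RegularPath P T Δbar ω) (ht : t < T) : P.Admissible T Δbar (R.state P T t ω) where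
  mem_paramSet := hω.θcheck_mem t ht
  width_nonneg := add_nonneg (Real.sqrt_nonneg _) (alpha_nonneg hB hL.gLo_pos hσ _)
  width_le := by
    -- The realized gap is itself the finite witness, which also covers an infinite `Δbar`.
    refine ⟨R.gap P 1 t ω, hω.gap_nonneg ht, hω.gap_le t ht, ?_⟩
    have h := hω.alpha_le hB hL.gLo_pos hσ hd ht
    simp only [state]
    rw [hω.gapSup_eq hL.differentiable.continuous ht, div_mul_eq_mul_div, add_comm]
    gcongr
  symm i j := by
    have h := (design_posDef (R := R) t ω).sqrt_inv_isHermitian.apply i j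
    simpa [state, invSqrtDesign] using h.symm
  contraction e := by
    simp only [state]
    rw [← matNorm_inv_eq]
    exact matNorm_inv_le_norm t ω e
  covariate_mem := hω.x_mem t ht

/-- When the score is bounded, the true parameter lies in the confidence ellipsoid around the
approximate estimator. -/
theorem RegularPath.state_mem_coveringStates [Nonempty P.paramSet] (hB : P.Bounded)
    (hL : P.LinkRegular 1 T Δbar) (hσ : 0 < P.σ) (hd : 0 < d)
    (hω : R.RegularPath P T Δbar ω) (ht : t < T) (hscore : R.ScoreBounded P T t ω) :
    R.state P T t ω ∈ P.coveringStates := by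
  have hadm := hω.admissible hB hL hσ hd ht
  refine ⟨hadm.width_nonneg, hadm.symm, fun v => ?_⟩
  have hsub := PricingModel.paramSet_subset_enlargedSet (T := T) (Δbar := Δbar) hB hL.gLo_pos hσ
  have hmem : ∀ θ ∈ P.paramSet, ∀ τ < t, ⟪R.z τ ω, θ⟫_ℝ ∈ P.predictorRange 1 T Δbar :=
    fun θ hθ τ hτ => PricingModel.inner_mem_predictorRange (hω.x_mem τ (hτ.trans ht))
      (hω.p_mem τ (hτ.trans ht)) (hsub hθ)
  have hlow : ∀ s ∈ P.predictorRange 1 T Δbar, P.gLo ≤ deriv P.g s :=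
    fun s hs => (hL.deriv_bounds s hs).1
  -- Concavity around the exact maximizer is used twice: `h1` measures the optimization error of
  -- `θcheck`, and `h2`, together with the score bound, the statistical error.
  have h1 := designSq_le_of_isMaxOn hL.differentiable hL.convex.1 hL.gLo_pos hlow
    PricingModel.convex_paramSet hmem (hω.θhat_mem t ht) (hω.θcheck_mem t ht) (hω.θhat_max t ht)
  have h2 := designSq_le_of_isMaxOn hL.differentiable hL.convex.1 hL.gLo_pos hlow
    PricingModel.convex_paramSet hmem (hω.θhat_mem t ht) hB.θstar_mem (hω.θhat_max t ht)
  obtain ⟨s, hs⟩ : ∃ s, s = 2 * P.σ * √(2 * Real.log T + Real.log (R.design 1 t ω).det) :=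
    ⟨_, rfl⟩
  have hs0 : 0 ≤ s := by rw [hs]; positivity
  have hsum : ∑ τ ∈ Finset.range t, (R.demand P τ ω - P.g ⟪R.z τ ω, P.θstar⟫_ℝ)
      * ⟪R.z τ ω, R.θhat t ω - P.θstar⟫_ℝ
      ≤ s * √(designSq (fun τ => R.z τ ω) t (R.θhat t ω - P.θstar)) := by
    have e1 : ∑ τ ∈ Finset.range t, (R.demand P τ ω - P.g ⟪R.z τ ω, P.θstar⟫_ℝ)
        * ⟪R.z τ ω, R.θhat t ω - P.θstar⟫_ℝ
        = shockSum (fun τ i => R.z τ ω i) (fun τ => R.ε τ ω) t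
          ⬝ᵥ (fun i => (R.θhat t ω - P.θstar) i) := by
      rw [shockSum, sum_dotProduct]
      refine Finset.sum_congr rfl fun τ _ => ?_
      rw [smul_dotProduct, smul_eq_mul, ← EuclideanSpace.inner_eq_dotProduct, demand,
        add_sub_cancel_left]
    rw [e1, designSq_eq]
    refine (le_abs_self _).trans
      (((design_posDef (R := R) t ω).dotProduct_le_sqrt_mul_sqrt _ _).trans ?_)
    refine mul_le_mul_of_nonneg_right ?_ (Real.sqrt_nonneg _)
    rw [hs]
    exact Real.sqrt_le_iff.2 ⟨hs ▸ hs0, hscore⟩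
  have h3 := sqrt_designSq_le_of_score hL.differentiable hL.convex.1 hL.gLo_pos hlow hs0
    (hmem _ hB.θstar_mem) (hmem _ (hω.θhat_mem t ht)) hB.θstar_mem h2 hsum
  have h4 : √(designSq (fun τ => R.z τ ω) t (R.θcheck t ω - R.θhat t ω))
      ≤ √(2 / P.gLo * R.gapSup P t ω) := by
    refine Real.sqrt_le_sqrt ?_
    rw [hω.gapSup_eq hL.differentiable.continuous ht, hω.gap_eq t ht]
    exact h1
  have hα : 2 * P.θbar + s / P.gLo = P.alpha 1 T (R.design 1 t ω) := by
    rw [PricingModel.alpha, hs, Real.sqrt_one, one_pow, div_one]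
    ring
  rw [hα] at h3
  have a1 := (abs_le.1 (abs_inner_le_matNorm (R := R) t ω v (R.θhat t ω - P.θstar))).1
  have a2 := (abs_le.1 (abs_inner_le_matNorm (R := R) t ω v (R.θcheck t ω - R.θhat t ω))).1
  have hv := matNorm_nonneg (R.design 1 t ω)⁻¹ v
  have b1 := mul_le_mul_of_nonneg_left h3 hv
  have b2 := mul_le_mul_of_nonneg_left h4 hv
  simp only [state]
  rw [← matNorm_inv_eq]
  -- The triangle inequality through `θhat`; the two errors add up to the two summands of the width.
  have hsplit : ⟪v, P.θstar - R.θcheck t ω⟫_ℝ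
      = -⟪v, R.θhat t ω - P.θstar⟫_ℝ - ⟪v, R.θcheck t ω - R.θhat t ω⟫_ℝ := by
    rw [← inner_neg_right, ← inner_sub_right]
    congr 1
    abel
  rw [hsplit, add_mul]
  linarith

end PricingRun

end RegularPaths

/-! ### Integrability, and removal of the shocks from the regret -/

section Integrability

namespace PricingRun

variable {d : ℕ} {Ω : Type*} {P : PricingModel d} {R : PricingRun d Ω} {T : ℕ} {Δbar : ENNReal}

theorem measurable_matNorm_z [MeasurableSpace Ω] {t : ℕ} (hx : ∀ τ ≤ t, Measurable (R.x τ))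
    (hp : ∀ τ ≤ t, Measurable (R.p τ)) :
    Measurable fun ω => matNorm (R.design 1 t ω)⁻¹ (R.z t ω) := by
  have hM : ∀ i j, Measurable fun ω => R.design 1 t ω i j :=
    measurable_design_apply (fun τ hτ => hx τ hτ.le) fun τ hτ => hp τ hτ.le
  have hz := measurable_z_apply (hx t le_rfl) (hp t le_rfl)
  exact (measurable_dotProduct_mulVec (measurable_inv_apply hM) hz hz).sqrt

/-- The regret of one period, given the covariates and the price. -/
noncomputable def periodRegret (R : PricingRun d Ω) (P : PricingModel d) (t : ℕ) (ω : Ω) : ℝ :=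
  P.feasibleRevenue P.θstar (R.x t ω) - P.revenue (R.p t ω) P.θstar (R.x t ω)

theorem measurable_feasibleRevenue [MeasurableSpace Ω] (hg : Continuous P.g) {t : ℕ}
    (hx : Measurable (R.x t)) : Measurable fun ω => P.feasibleRevenue P.θstar (R.x t ω) := by
  have h : Continuous fun x : CovVec d => P.feasibleRevenue P.θstar x :=
    PricingModel.continuous_feasibleRevenue_comp hg continuous_const continuous_id
  exact h.measurable.comp hx

theorem measurable_revenue [MeasurableSpace Ω] (hg : Continuous P.g) {t : ℕ}
    (hx : Measurable (R.x t)) (hp : Measurable (R.p t)) :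
    Measurable fun ω => P.revenue (R.p t ω) P.θstar (R.x t ω) := by
  have h : Continuous fun v : ParVec d => P.g ⟪v, P.θstar⟫_ℝ := hg.comp (by fun_prop)
  exact hp.mul (h.measurable.comp (measurable_z hx hp))

variable {ω : Ω} {t : ℕ}

theorem RegularPath.periodRegret_nonneg (hg : Continuous P.g) (hω : R.RegularPath P T Δbar ω)
    (ht : t < T) : 0 ≤ R.periodRegret P t ω :=
  sub_nonneg.2 (PricingModel.revenue_le_feasibleRevenue hg _ _ (hω.p_mem t ht))

theorem RegularPath.periodRegret_le (hB : P.Bounded) (hL : P.LinkRegular 1 T Δbar)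
    (hσ : 0 < P.σ) (hω : R.RegularPath P T Δbar ω) (ht : t < T) :
    R.periodRegret P t ω ≤ 3 * (P.pHi * P.gHi * P.θbar) :=
  PricingModel.regret_le_of_feasible hB hL hσ (hω.x_mem t ht) (hω.p_mem t ht)

theorem RegularPath.matNorm_z_le_one (hB : P.Bounded) (hω : R.RegularPath P T Δbar ω)
    (ht : t < T) : matNorm (R.design 1 t ω)⁻¹ (R.z t ω) ≤ 1 :=
  (matNorm_inv_le_norm t ω _).trans (hω.norm_z_le hB ht)

theorem RegularPath.sum_matNorm_z_le (hB : P.Bounded) (hd : 0 < d)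
    (hω : R.RegularPath P T Δbar ω) :
    ∑ t ∈ Finset.range T, matNorm (R.design 1 t ω)⁻¹ (R.z t ω)
      ≤ 2 * √(T * d * Real.log ((2 * d + T) / (2 * d))) := by
  have : Nonempty (Fin d ⊕ Fin d) := ⟨Sum.inl ⟨0, hd⟩⟩
  have h := sum_sqrt_inv_quadForm_le (fun τ i => R.z τ ω i) T
    fun τ hτ => hω.z_dotProduct_le hB hτ
  have hcard : (Fintype.card (Fin d ⊕ Fin d) : ℝ) = 2 * d := by simp; ring
  rw [hcard] at h
  simp only [matNorm, design_one]
  refine h.trans (le_of_eq ?_)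
  rw [show 2 * (T : ℝ) * (2 * d * Real.log ((2 * d + T) / (2 * d)))
    = 2 ^ 2 * (T * d * Real.log ((2 * d + T) / (2 * d))) by ring,
    Real.sqrt_mul (by norm_num), Real.sqrt_sq (by norm_num)]

/-- The true demands and the link potentials are bounded on the parameter set. -/
theorem exists_demand_bound (hg : Continuous P.g) :
    ∃ C : ℝ, 0 ≤ C ∧ ∀ s ∈ Set.Icc (-P.θbar) P.θbar, |P.g s| ≤ C ∧ |linkPotential P.g s| ≤ C := by
  obtain ⟨C₁, h₁⟩ := isCompact_Icc.exists_bound_of_continuousOn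
    (hg.continuousOn (s := Set.Icc (-P.θbar) P.θbar))
  obtain ⟨C₂, h₂⟩ := isCompact_Icc.exists_bound_of_continuousOn
    ((continuous_linkPotential hg).continuousOn (s := Set.Icc (-P.θbar) P.θbar))
  exact ⟨max 0 (max C₁ C₂), le_max_left _ _, fun s hs =>
    ⟨(h₁ s hs).trans ((le_max_left _ _).trans (le_max_right _ _)),
      (h₂ s hs).trans ((le_max_right _ _).trans (le_max_right _ _))⟩⟩

/-- For an infinite `Δbar` nothing bounds the gap a priori. On the compact parameter set it grows at
most linearly in the shocks, which are integrable. -/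
theorem exists_gap_bound (hB : P.Bounded) (hg : Continuous P.g) (hgLo : 0 < P.gLo) (t : ℕ) :
    ∃ C : ℝ, 0 ≤ C ∧ ∀ ω, R.RegularPath P T Δbar ω → t < T →
      R.gap P 1 t ω ≤ C + ∑ τ ∈ Finset.range t, 2 * P.θbar * |R.ε τ ω| := by
  obtain ⟨C, hC, hbd⟩ := exists_demand_bound (P := P) hg
  have hθ0 := hB.θbar_pos.le
  refine ⟨P.gLo * P.θbar ^ 2 + t * (2 * C + 2 * P.θbar * C), by positivity, fun ω hω ht => ?_⟩
  rw [hω.gap_eq t ht]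
  have hin : ∀ τ < t, ∀ θ ∈ P.paramSet, |⟪R.z τ ω, θ⟫_ℝ| ≤ P.θbar := fun τ hτ θ hθ =>
    hB.abs_inner_le (hω.x_mem τ (hτ.trans ht)) (hω.p_mem τ (hτ.trans ht)) hθ
  have hnorm : ‖R.θcheck t ω‖ ^ 2 ≤ P.θbar ^ 2 :=
    pow_le_pow_left₀ (norm_nonneg _) (hω.θcheck_mem t ht) 2
  have hterm : ∀ τ ∈ Finset.range t,
      (linkPotential P.g ⟪R.z τ ω, R.θcheck t ω⟫_ℝ
          - R.demand P τ ω * ⟪R.z τ ω, R.θcheck t ω⟫_ℝ)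
        - (linkPotential P.g ⟪R.z τ ω, R.θhat t ω⟫_ℝ
          - R.demand P τ ω * ⟪R.z τ ω, R.θhat t ω⟫_ℝ)
      ≤ (2 * C + 2 * P.θbar * C) + 2 * P.θbar * |R.ε τ ω| := fun τ hτ => by
    have hτ' := Finset.mem_range.1 hτ
    have a1 := hin τ hτ' _ (hω.θcheck_mem t ht)
    have a2 := hin τ hτ' _ (hω.θhat_mem t ht)
    have a3 := hin τ hτ' _ hB.θstar_mem
    have b1 := (hbd _ (abs_le.1 a1)).2
    have b2 := (hbd _ (abs_le.1 a2)).2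
    have b3 := (hbd _ (abs_le.1 a3)).1
    have c1 : |R.demand P τ ω| ≤ C + |R.ε τ ω| := (abs_add_le _ _).trans (by gcongr)
    have c2 : |R.demand P τ ω * (⟪R.z τ ω, R.θhat t ω⟫_ℝ - ⟪R.z τ ω, R.θcheck t ω⟫_ℝ)|
        ≤ (C + |R.ε τ ω|) * (2 * P.θbar) := by
      rw [abs_mul]
      refine mul_le_mul c1 ((abs_sub _ _).trans (by linarith)) (abs_nonneg _) (by positivity)
    have c3 := (abs_le.1 c2).2
    have d1 := (abs_le.1 b1).2
    have d2 := (abs_le.1 b2).1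
    linarith
  have hsum := Finset.sum_le_sum hterm
  rw [Finset.sum_sub_distrib, Finset.sum_add_distrib (s := Finset.range t), Finset.sum_const,
    Finset.card_range, nsmul_eq_mul] at hsum
  unfold logLik quasiObjective
  have e1 := mul_le_mul_of_nonneg_left hnorm hgLo.le
  have e2 : 0 ≤ P.gLo * ‖R.θhat t ω‖ ^ 2 := by positivity
  linarith

section Filtered

variable {m : MeasurableSpace Ω} {μ : Measure Ω} {𝓕 : Filtration ℕ m}

theorem SubGaussianShocks.integrable_shock (hShock : R.SubGaussianShocks P μ 𝓕 T) (ht : t < T) :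
    Integrable (R.ε t) μ := by
  refine ((hShock.integrable_exp t ht 1).add (hShock.integrable_exp t ht (-1))).mono'
    ((hShock.measurable_shock t ht).mono (𝓕.le _) le_rfl).aestronglyMeasurable
    (Filter.Eventually.of_forall fun ω => ?_)
  have h1 := Real.add_one_le_exp (R.ε t ω)
  have h2 := Real.add_one_le_exp (-R.ε t ω)
  have h3 := Real.exp_pos (R.ε t ω)
  have h4 := Real.exp_pos (-R.ε t ω)
  rw [Real.norm_eq_abs, Pi.add_apply, one_mul, neg_one_mul]
  exact abs_le.2 ⟨by linarith, by linarith⟩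

theorem IsThompsonRun.measurable_covariate (hRun : R.IsThompsonRun P μ 𝓕 1 T) (ht : t < T) :
    Measurable (R.x t) := (hRun.measurable_x t ht).mono (𝓕.le _) le_rfl

theorem IsThompsonRun.measurable_price (hRun : R.IsThompsonRun P μ 𝓕 1 T) (ht : t < T) :
    Measurable (R.p t) := (hRun.measurable_p t ht).mono (𝓕.le _) le_rfl

theorem IsThompsonRun.measurable_gapSup [Nonempty P.paramSet] (hg : Continuous P.g)
    (hShock : R.SubGaussianShocks P μ 𝓕 T) (hRun : R.IsThompsonRun P μ 𝓕 1 T) (ht : t < T) :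
    Measurable (R.gapSup P t) :=
  PricingRun.measurable_gapSup hg (fun _ hτ => hRun.measurable_covariate (hτ.trans ht))
    (fun _ hτ => hRun.measurable_price (hτ.trans ht))
    (fun τ hτ => (hShock.measurable_shock τ (hτ.trans ht)).mono (𝓕.le _) le_rfl)
    ((hRun.measurable_θcheck t ht).mono (𝓕.le _) le_rfl)

theorem IsThompsonRun.measurable_matNorm_z (hRun : R.IsThompsonRun P μ 𝓕 1 T) (ht : t < T) :
    Measurable fun ω => matNorm (R.design 1 t ω)⁻¹ (R.z t ω) :=
  PricingRun.measurable_matNorm_z (fun _ hτ => hRun.measurable_covariate (hτ.trans_lt ht))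
    fun _ hτ => hRun.measurable_price (hτ.trans_lt ht)

variable [IsProbabilityMeasure μ]

theorem integrable_matNorm_z (hB : P.Bounded) (hRun : R.IsThompsonRun P μ 𝓕 1 T)
    (hae : ∀ᵐ ω ∂μ, R.RegularPath P T Δbar ω) (ht : t < T) :
    Integrable (fun ω => matNorm (R.design 1 t ω)⁻¹ (R.z t ω)) μ := by
  refine (integrable_const (1 : ℝ)).mono' (hRun.measurable_matNorm_z ht).aestronglyMeasurable ?_
  filter_upwards [hae] with ω hω
  rw [Real.norm_eq_abs, abs_of_nonneg (matNorm_nonneg _ _)]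
  exact hω.matNorm_z_le_one hB ht

theorem integrable_sqrt_gap_mul (hB : P.Bounded) (hL : P.LinkRegular 1 T Δbar)
    (hShock : R.SubGaussianShocks P μ 𝓕 T) (hRun : R.IsThompsonRun P μ 𝓕 1 T)
    (hae : ∀ᵐ ω ∂μ, R.RegularPath P T Δbar ω) (ht : t < T) :
    Integrable (fun ω => √(R.gap P 1 t ω) * matNorm (R.design 1 t ω)⁻¹ (R.z t ω)) μ := by
  have : Nonempty P.paramSet := ⟨⟨_, hB.θstar_mem⟩⟩
  have hg := hL.differentiable.continuous
  obtain ⟨C, hC, hbd⟩ := exists_gap_bound (R := R) (T := T) (Δbar := Δbar) hB hg hL.gLo_pos t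
  have hdom : Integrable
      (fun ω => 1 + (C + ∑ τ ∈ Finset.range t, 2 * P.θbar * |R.ε τ ω|)) μ :=
    (integrable_const _).add ((integrable_const _).add (integrable_finsetSum _ fun τ hτ =>
      ((hShock.integrable_shock ((Finset.mem_range.1 hτ).trans ht)).abs.const_mul _)))
  refine hdom.mono' ?_ ?_
  -- The gap involves `θhat`, an arbitrary selection of maximizers; it is almost surely equal to the
  -- measurable `gapSup`.
  · refine ((hRun.measurable_gapSup hg hShock ht).sqrt.mul
      (hRun.measurable_matNorm_z ht)).aestronglyMeasurable.congr ?_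
    filter_upwards [hae] with ω hω
    rw [Pi.mul_apply, hω.gapSup_eq hg ht]
  · filter_upwards [hae] with ω hω
    have h1 := hω.gap_nonneg ht
    have h2 := matNorm_nonneg (R.design 1 t ω)⁻¹ (R.z t ω)
    have h3 := hω.matNorm_z_le_one hB ht
    have h4 := hbd ω hω ht
    have h5 : √(R.gap P 1 t ω) ≤ 1 + R.gap P 1 t ω :=
      Real.sqrt_le_iff.2 ⟨by linarith, by nlinarith⟩
    rw [Real.norm_eq_abs, abs_of_nonneg (by positivity)]
    calc √(R.gap P 1 t ω) * matNorm (R.design 1 t ω)⁻¹ (R.z t ω)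
        ≤ √(R.gap P 1 t ω) * 1 := mul_le_mul_of_nonneg_left h3 (Real.sqrt_nonneg _)
      _ ≤ _ := by linarith

theorem integrable_revenue (hB : P.Bounded) (hL : P.LinkRegular 1 T Δbar)
    (hRun : R.IsThompsonRun P μ 𝓕 1 T) (hae : ∀ᵐ ω ∂μ, R.RegularPath P T Δbar ω) (ht : t < T) :
    Integrable (fun ω => P.revenue (R.p t ω) P.θstar (R.x t ω)) μ := by
  have hg := hL.differentiable.continuous
  obtain ⟨C, hC, hbd⟩ := exists_demand_bound (P := P) hg
  refine (integrable_const (P.pHi * C)).mono' (measurable_revenue hg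
    (hRun.measurable_covariate ht) (hRun.measurable_price ht)).aestronglyMeasurable ?_
  filter_upwards [hae] with ω hω
  have hp := hω.p_mem t ht
  have h0 := hB.pLo_nonneg.trans hp.1
  rw [PricingModel.revenue, Real.norm_eq_abs, abs_mul, abs_of_nonneg h0]
  exact mul_le_mul hp.2 (hbd _ (abs_le.1 (hB.abs_inner_le (hω.x_mem t ht) hp hB.θstar_mem))).1
    (abs_nonneg _) (h0.trans hp.2)

theorem integrable_periodRegret (hB : P.Bounded) (hL : P.LinkRegular 1 T Δbar) (hσ : 0 < P.σ)
    (hRun : R.IsThompsonRun P μ 𝓕 1 T) (hae : ∀ᵐ ω ∂μ, R.RegularPath P T Δbar ω) (ht : t < T) :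
    Integrable (R.periodRegret P t) μ := by
  have hg := hL.differentiable.continuous
  refine (integrable_const (3 * (P.pHi * P.gHi * P.θbar))).mono'
    ((measurable_feasibleRevenue hg (hRun.measurable_covariate ht)).sub (measurable_revenue hg
    (hRun.measurable_covariate ht) (hRun.measurable_price ht))).aestronglyMeasurable ?_
  filter_upwards [hae] with ω hω
  rw [Real.norm_eq_abs, abs_of_nonneg (hω.periodRegret_nonneg hg ht)]
  exact hω.periodRegret_le hB hL hσ ht

theorem integrable_price_mul_shock (hB : P.Bounded) (hShock : R.SubGaussianShocks P μ 𝓕 T)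
    (hRun : R.IsThompsonRun P μ 𝓕 1 T) (hae : ∀ᵐ ω ∂μ, R.RegularPath P T Δbar ω) (ht : t < T) :
    Integrable (R.p t * R.ε t) μ := by
  refine (hShock.integrable_shock ht).bdd_mul (c := P.pHi)
    (hRun.measurable_price ht).aestronglyMeasurable ?_
  filter_upwards [hae] with ω hω
  have hp := hω.p_mem t ht
  rw [Real.norm_eq_abs, abs_of_nonneg (hB.pLo_nonneg.trans hp.1)]
  exact hp.2

/-- The price is known before the shock is realized, so it can be pulled out of the conditional
expectation, which is zero. -/
theorem integral_price_mul_shock (hB : P.Bounded) (hShock : R.SubGaussianShocks P μ 𝓕 T)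
    (hRun : R.IsThompsonRun P μ 𝓕 1 T) (hae : ∀ᵐ ω ∂μ, R.RegularPath P T Δbar ω) (ht : t < T) :
    ∫ ω, (R.p t * R.ε t) ω ∂μ = 0 := by
  have hle : R.priceInfo 𝓕 t ≤ m := (hRun.priceInfo_le ht).trans (𝓕.le _)
  have hp : StronglyMeasurable[R.priceInfo 𝓕 t] (R.p t) :=
    Measurable.stronglyMeasurable (measurable_p_priceInfo t)
  have h := condExp_mul_of_stronglyMeasurable_left hp
    (integrable_price_mul_shock hB hShock hRun hae ht) (hShock.integrable_shock ht)
  rw [← integral_condExp hle, integral_congr_ae h]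
  refine (integral_congr_ae ?_).trans (integral_zero Ω ℝ)
  filter_upwards [hShock.condExp_zero t ht] with ω hω
  rw [Pi.mul_apply, hω, Pi.zero_apply, mul_zero]

theorem integrable_benchmark (hB : P.Bounded) (hL : P.LinkRegular 1 T Δbar) (hσ : 0 < P.σ)
    (hRun : R.IsThompsonRun P μ 𝓕 1 T) (hae : ∀ᵐ ω ∂μ, R.RegularPath P T Δbar ω) :
    Integrable (R.benchmark P T) μ := by
  have h : Integrable (fun ω => ∑ t ∈ Finset.range T,
      (R.periodRegret P t ω + P.revenue (R.p t ω) P.θstar (R.x t ω))) μ :=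
    integrable_finsetSum _ fun t ht =>
      (integrable_periodRegret hB hL hσ hRun hae (Finset.mem_range.1 ht)).add
        (integrable_revenue hB hL hRun hae (Finset.mem_range.1 ht))
  refine h.congr ?_
  filter_upwards [hae] with ω hω
  refine Finset.sum_congr rfl fun t ht => ?_
  rw [hB.optRevenue_eq (hω.x_mem t (Finset.mem_range.1 ht)), periodRegret, sub_add_cancel]

theorem collected_eq (T : ℕ) (ω : Ω) : R.collected P T ω
    = ∑ t ∈ Finset.range T,
      (P.revenue (R.p t ω) P.θstar (R.x t ω) + (R.p t * R.ε t) ω) :=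
  Finset.sum_congr rfl fun _ _ => mul_add _ _ _

theorem integrable_collected (hB : P.Bounded) (hL : P.LinkRegular 1 T Δbar)
    (hShock : R.SubGaussianShocks P μ 𝓕 T) (hRun : R.IsThompsonRun P μ 𝓕 1 T)
    (hae : ∀ᵐ ω ∂μ, R.RegularPath P T Δbar ω) : Integrable (R.collected P T) μ := by
  rw [funext (collected_eq (P := P) (R := R) T)]
  exact integrable_finsetSum _ fun t ht =>
    (integrable_revenue hB hL hRun hae (Finset.mem_range.1 ht)).add
      (integrable_price_mul_shock hB hShock hRun hae (Finset.mem_range.1 ht))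

theorem integrable_gapSum (hB : P.Bounded) (hL : P.LinkRegular 1 T Δbar)
    (hShock : R.SubGaussianShocks P μ 𝓕 T) (hRun : R.IsThompsonRun P μ 𝓕 1 T)
    (hae : ∀ᵐ ω ∂μ, R.RegularPath P T Δbar ω) : Integrable (R.gapSum P 1 T) μ :=
  integrable_finsetSum _ fun _ ht =>
    integrable_sqrt_gap_mul hB hL hShock hRun hae (Finset.mem_range.1 ht)

/-- The shocks do not contribute to the expected regret. -/
theorem regret_eq_sum (hB : P.Bounded) (hL : P.LinkRegular 1 T Δbar)
    (hShock : R.SubGaussianShocks P μ 𝓕 T) (hRun : R.IsThompsonRun P μ 𝓕 1 T)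
    (hae : ∀ᵐ ω ∂μ, R.RegularPath P T Δbar ω) :
    R.regret P μ T = ∑ t ∈ Finset.range T, ∫ ω, R.periodRegret P t ω ∂μ := by
  have hper : ∀ t ∈ Finset.range T, Integrable (R.periodRegret P t) μ := fun _ ht =>
    integrable_periodRegret hB hL hShock.σ_pos hRun hae (Finset.mem_range.1 ht)
  have hnoise := fun t (ht : t ∈ Finset.range T) =>
    integrable_price_mul_shock hB hShock hRun hae (Finset.mem_range.1 ht)
  rw [regret, ← integral_sub (integrable_benchmark hB hL hShock.σ_pos hRun hae)
    (integrable_collected hB hL hShock hRun hae)]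
  have h : (fun ω => R.benchmark P T ω - R.collected P T ω) =ᵐ[μ] fun ω =>
      ∑ t ∈ Finset.range T, (R.periodRegret P t ω - (R.p t * R.ε t) ω) := by
    filter_upwards [hae] with ω hω
    rw [collected_eq, benchmark, ← Finset.sum_sub_distrib]
    refine Finset.sum_congr rfl fun t ht => ?_
    rw [hB.optRevenue_eq (hω.x_mem t (Finset.mem_range.1 ht)), periodRegret]
    ring
  have hsub : ∀ t ∈ Finset.range T,
      Integrable (fun ω => R.periodRegret P t ω - (R.p t * R.ε t) ω) μ :=
    fun t ht => (hper t ht).sub (hnoise t ht)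
  rw [integral_congr_ae h, integral_finsetSum _ hsub]
  refine Finset.sum_congr rfl fun t ht => ?_
  rw [integral_sub (hper t ht) (hnoise t ht),
    integral_price_mul_shock hB hShock hRun hae (Finset.mem_range.1 ht), sub_zero]

end Filtered

end PricingRun

end Integrability

/-! ### Expected regret of one period -/

section PeriodRegret

namespace PricingRun

variable {d : ℕ} {Ω : Type*} {P : PricingModel d} {R : PricingRun d Ω} {T : ℕ} {Δbar : ENNReal}

/-- The confidence width in the direction of the regressor, with the uniform bound for the
statistical part of the width. -/
noncomputable def widthBound (R : PricingRun d Ω) (P : PricingModel d) (T t : ℕ) (ω : Ω) : ℝ :=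
  √(2 / P.gLo) * (√(R.gap P 1 t ω) * matNorm (R.design 1 t ω)⁻¹ (R.z t ω))
    + P.alphaBar 1 T * matNorm (R.design 1 t ω)⁻¹ (R.z t ω)

variable {ω : Ω} {t : ℕ}

theorem alphaBar_nonneg (hB : P.Bounded) (hL : P.LinkRegular 1 T Δbar) (hσ : 0 < P.σ) :
    0 ≤ P.alphaBar 1 T := by
  have := hB.θbar_pos
  linarith [PricingModel.two_mul_radius_le_alphaBar (T := T) hB hL.gLo_pos hσ]

theorem widthBound_nonneg (hB : P.Bounded) (hL : P.LinkRegular 1 T Δbar) (hσ : 0 < P.σ) :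
    0 ≤ R.widthBound P T t ω := by
  have h1 := alphaBar_nonneg hB hL hσ
  have h2 := matNorm_nonneg (R.design 1 t ω)⁻¹ (R.z t ω)
  unfold widthBound
  positivity

theorem RegularPath.width_mul_le [Nonempty P.paramSet] (hB : P.Bounded)
    (hL : P.LinkRegular 1 T Δbar) (hσ : 0 < P.σ) (hd : 0 < d)
    (hω : R.RegularPath P T Δbar ω) (ht : t < T) :
    (R.state P T t ω).2.1 * ‖PricingModel.matAct (R.state P T t ω).2.2.1 (R.z t ω)‖
      ≤ R.widthBound P T t ω := by
  have hgap := hω.gapSup_eq hL.differentiable.continuous ht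
  have hα := hω.alpha_le hB hL.gLo_pos hσ hd ht
  have hw := matNorm_nonneg (R.design 1 t ω)⁻¹ (R.z t ω)
  have hc : 0 ≤ 2 / P.gLo := div_nonneg zero_le_two hL.gLo_pos.le
  simp only [state]
  rw [← matNorm_inv_eq, hgap, Real.sqrt_mul hc, add_mul, mul_assoc, widthBound]
  exact add_le_add le_rfl (mul_le_mul_of_nonneg_right hα hw)

theorem RegularPath.gHi_pos (hB : P.Bounded) (hL : P.LinkRegular 1 T Δbar) (hσ : 0 < P.σ)
    (hω : R.RegularPath P T Δbar ω) (ht : t < T) : 0 < P.gHi :=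
  hL.gHi_pos (PricingModel.inner_mem_predictorRange (hω.x_mem t ht) (hω.p_mem t ht)
    (PricingModel.paramSet_subset_enlargedSet hB hL.gLo_pos hσ hB.θstar_mem))

theorem RegularPath.price_isMaxOn [Nonempty P.paramSet] (hL : P.LinkRegular 1 T Δbar)
    (hω : R.RegularPath P T Δbar ω) (ht : t < T) :
    IsMaxOn (fun q => P.revenue q (PricingModel.perturbed (R.state P T t ω) (R.η t ω))
      (R.state P T t ω).2.2.2) (Set.Icc P.pLo P.pHi) (R.p t ω) := by
  rw [← hω.sampled_eq hL.differentiable.continuous ht]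
  exact hω.p_max t ht

/-- On the good event, the regret is bounded by the worst shortfall and the confidence width. -/
theorem RegularPath.periodRegret_le_of_scoreBounded [Nonempty P.paramSet] (hB : P.Bounded)
    (hL : P.LinkRegular 1 T Δbar) (hσ : 0 < P.σ) (hd : 0 < d)
    (hω : R.RegularPath P T Δbar ω) (ht : t < T) (hscore : R.ScoreBounded P T t ω)
    (hη : ‖R.η t ω‖ ≤ PricingModel.samplingRadius d T) :
    R.periodRegret P t ω
      ≤ P.worstShortfall (PricingModel.samplingRadius d T) (R.state P T t ω)
        + P.pHi * P.gHi * (PricingModel.samplingRadius d T + 1) * R.widthBound P T t ω := by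
  have h := (hω.admissible hB hL hσ hd ht).regret_le hB hL hσ
    (hω.state_mem_coveringStates hB hL hσ hd ht hscore) (hω.p_mem t ht) hη
    (hω.price_isMaxOn hL ht)
  refine h.trans (add_le_add le_rfl ?_)
  have hpg := mul_nonneg (hB.pHi_pos (hω.x_mem t ht)).le (hω.gHi_pos hB hL hσ ht).le
  have hρ := PricingModel.samplingRadius_nonneg d T
  rw [mul_assoc (P.pHi * P.gHi), mul_assoc (_ + _)]
  exact mul_le_mul_of_nonneg_left (mul_le_mul_of_nonneg_left
    (hω.width_mul_le hB hL hσ hd ht) (by linarith)) hpg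

/-- For an optimistic sample the worst shortfall is bounded by the confidence width. -/
theorem RegularPath.worstShortfall_le [Nonempty P.paramSet] (hB : P.Bounded)
    (hL : P.LinkRegular 1 T Δbar) (hσ : 0 < P.σ) (hd : 0 < d)
    (hω : R.RegularPath P T Δbar ω) (ht : t < T)
    (hη : (R.state P T t ω, R.η t ω) ∈ P.optimisticSet (PricingModel.samplingRadius d T)) :
    P.worstShortfall (PricingModel.samplingRadius d T) (R.state P T t ω)
      ≤ P.pHi * P.gHi * (2 * PricingModel.samplingRadius d T) * R.widthBound P T t ω := by
  have h := (hω.admissible hB hL hσ hd ht).worstShortfall_le hB hL (hω.p_mem t ht) hη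
    (hω.price_isMaxOn hL ht)
  refine h.trans ?_
  have hpg := mul_nonneg (hB.pHi_pos (hω.x_mem t ht)).le (hω.gHi_pos hB hL hσ ht).le
  have hρ := PricingModel.samplingRadius_nonneg d T
  rw [mul_assoc (P.pHi * P.gHi), mul_assoc (2 * _)]
  exact mul_le_mul_of_nonneg_left (mul_le_mul_of_nonneg_left
    (hω.width_mul_le hB hL hσ hd ht) (by linarith)) hpg

/-- The worst shortfall of the states whose confidence ellipsoid contains the true parameter. -/
noncomputable def coveredShortfall (P : PricingModel d) (T : ℕ) :
    PricingModel.SamplingState d → ENNReal :=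
  P.coveringStates.indicator
    fun b => ENNReal.ofReal (P.worstShortfall (PricingModel.samplingRadius d T) b)

theorem measurable_coveredShortfall (hg : Continuous P.g) :
    Measurable (coveredShortfall P T) :=
  ((PricingModel.continuous_worstShortfall hg _).measurable.ennreal_ofReal).indicator
    PricingModel.isClosed_coveringStates.measurableSet

section Filtered

variable {m : MeasurableSpace Ω} {μ : Measure Ω} {𝓕 : Filtration ℕ m}

theorem IsThompsonRun.measurable_state [Nonempty P.paramSet] (hg : Continuous P.g)
    (hShock : R.SubGaussianShocks P μ 𝓕 T) (hRun : R.IsThompsonRun P μ 𝓕 1 T) (ht : t < T) :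
    Measurable[𝓕 t] (R.state P T t) :=
  @PricingRun.measurable_state d Ω P R T (𝓕 t) _ hg t
    (fun _ hτ => hRun.measurable_x_of_le (hτ.trans_lt ht) hτ)
    (fun _ hτ => hRun.measurable_p_of_lt (hτ.trans ht) hτ)
    (fun _ hτ => hShock.measurable_of_lt (hτ.trans ht) hτ) (hRun.measurable_θcheck t ht)

theorem IsThompsonRun.measure_radius_lt_le (hRun : R.IsThompsonRun P μ 𝓕 1 T) (hd : 0 < d)
    (ht : t < T) : μ {ω | PricingModel.samplingRadius d T < ‖R.η t ω‖}
      ≤ ENNReal.ofReal (1 / (T : ℝ) ^ 2) := by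
  have hη : Measurable (R.η t) := (hRun.measurable_η t ht).mono (𝓕.le _) le_rfl
  have hs : MeasurableSet {e : ParVec d | PricingModel.samplingRadius d T < ‖e‖} :=
    (isOpen_lt continuous_const continuous_norm).measurableSet
  have h := PricingModel.stdGaussian_samplingRadius_lt_le hd (Nat.zero_lt_of_lt ht)
  have h1 : μ {ω | PricingModel.samplingRadius d T < ‖R.η t ω‖}
      = stdGaussian (ParVec d) {e : ParVec d | PricingModel.samplingRadius d T < ‖e‖} := by
    rw [← hRun.law_η t ht, Measure.map_apply hη hs]
    rfl
  rw [h1, ← ofReal_measureReal]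
  exact ENNReal.ofReal_le_ofReal h

variable [IsProbabilityMeasure μ]

/-- Samples are optimistic with constant probability, independently of the state. -/
theorem lintegral_coveredShortfall_le [Nonempty P.paramSet] (hB : P.Bounded)
    (hL : P.LinkRegular 1 T Δbar) (hd : 0 < d) (hT : 10 ≤ T)
    (hShock : R.SubGaussianShocks P μ 𝓕 T) (hRun : R.IsThompsonRun P μ 𝓕 1 T)
    (hae : ∀ᵐ ω ∂μ, R.RegularPath P T Δbar ω) (hne : P.pLo ≤ P.pHi) (ht : t < T) :
    ENNReal.ofReal (5 / 100) * ∫⁻ ω, coveredShortfall P T (R.state P T t ω) ∂μ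
      ≤ ∫⁻ ω, ENNReal.ofReal (P.pHi * P.gHi * (2 * PricingModel.samplingRadius d T)
          * R.widthBound P T t ω) ∂μ := by
  have hg := hL.differentiable.continuous
  have hX := hRun.measurable_state hg hShock ht
  -- The state is `𝓕 t`-measurable and the sampling vector is independent of `𝓕 t`.
  have hind : IndepFun (R.state P T t) (R.η t) μ :=
    (IndepFun_iff_Indep _ _ _).2
      (indep_of_indep_of_le_left (hRun.indep_η t ht).symm hX.comap_le)
  refine (mul_lintegral_le_of_indepFun (hX.mono (𝓕.le _) le_rfl)
    ((hRun.measurable_η t ht).mono (𝓕.le _) le_rfl) hind (measurable_coveredShortfall hg)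
    (PricingModel.isClosed_optimisticSet hg (PricingModel.samplingRadius d T)).measurableSet
    fun b hb => ?_).trans (lintegral_mono_ae ?_)
  · rw [hRun.law_η t ht]
    exact PricingModel.stdGaussian_optimistic_ge hL hB.pLo_nonneg hne hd hT
      (Set.mem_of_indicator_ne_zero hb)
  · filter_upwards [hae] with ω hω
    by_cases hO : (R.state P T t ω, R.η t ω)
        ∈ P.optimisticSet (PricingModel.samplingRadius d T)
    · rw [Set.indicator_of_mem hO]
      have h : coveredShortfall P T (R.state P T t ω) ≤ ENNReal.ofReal
          (P.worstShortfall (PricingModel.samplingRadius d T) (R.state P T t ω)) :=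
        Set.indicator_le_self _ _ _
      exact h.trans (ENNReal.ofReal_le_ofReal
        (hω.worstShortfall_le hB hL hShock.σ_pos hd ht hO))
    · rw [Set.indicator_of_notMem hO]
      exact zero_le

theorem integrable_widthBound (hB : P.Bounded) (hL : P.LinkRegular 1 T Δbar)
    (hShock : R.SubGaussianShocks P μ 𝓕 T) (hRun : R.IsThompsonRun P μ 𝓕 1 T)
    (hae : ∀ᵐ ω ∂μ, R.RegularPath P T Δbar ω) (ht : t < T) :
    Integrable (R.widthBound P T t) μ :=
  ((integrable_sqrt_gap_mul hB hL hShock hRun hae ht).const_mul _).add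
    ((integrable_matNorm_z hB hRun hae ht).const_mul _)

/-- Outside two events of probability at most `T⁻²` each, a large score and a long sampling vector,
the pathwise bound applies; inside, the crude bound does. -/
theorem lintegral_periodRegret_le [Nonempty P.paramSet] (hB : P.Bounded)
    (hL : P.LinkRegular 1 T Δbar) (hd : 0 < d)
    (hShock : R.SubGaussianShocks P μ 𝓕 T) (hRun : R.IsThompsonRun P μ 𝓕 1 T)
    (hae : ∀ᵐ ω ∂μ, R.RegularPath P T Δbar ω) (ht : t < T) :
    ∫⁻ ω, ENNReal.ofReal (R.periodRegret P t ω) ∂μ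
      ≤ ∫⁻ ω, coveredShortfall P T (R.state P T t ω) ∂μ
        + (∫⁻ ω, ENNReal.ofReal (P.pHi * P.gHi * (PricingModel.samplingRadius d T + 1)
          * R.widthBound P T t ω) ∂μ
        + ENNReal.ofReal (3 * (P.pHi * P.gHi * P.θbar))
          * (ENNReal.ofReal (1 / (T : ℝ) ^ 2) + ENNReal.ofReal (1 / (T : ℝ) ^ 2))) := by
  have hg := hL.differentiable.continuous
  have hX := (hRun.measurable_state hg hShock ht).mono (𝓕.le _) le_rfl
  obtain ⟨bad, hbad⟩ : ∃ bad, bad = {ω | ¬ R.ScoreBounded P T t ω}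
      ∪ {ω | PricingModel.samplingRadius d T < ‖R.η t ω‖} := ⟨_, rfl⟩
  have hμ : μ bad ≤ ENNReal.ofReal (1 / (T : ℝ) ^ 2) + ENNReal.ofReal (1 / (T : ℝ) ^ 2) := by
    rw [hbad]
    exact (measure_union_le _ _).trans (add_le_add (measure_not_scoreBounded_le hShock hRun ht)
      (hRun.measure_radius_lt_le hd ht))
  have hW : AEMeasurable (fun ω => ENNReal.ofReal (P.pHi * P.gHi
      * (PricingModel.samplingRadius d T + 1) * R.widthBound P T t ω)) μ :=
    ((integrable_widthBound hB hL hShock hRun hae ht).const_mul _).aemeasurable.ennreal_ofReal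
  have hV : Measurable fun ω => coveredShortfall P T (R.state P T t ω) :=
    (measurable_coveredShortfall hg).comp hX
  calc ∫⁻ ω, ENNReal.ofReal (R.periodRegret P t ω) ∂μ
      ≤ ∫⁻ ω, (coveredShortfall P T (R.state P T t ω)
          + (ENNReal.ofReal (P.pHi * P.gHi * (PricingModel.samplingRadius d T + 1)
            * R.widthBound P T t ω)
          + bad.indicator (fun _ => ENNReal.ofReal (3 * (P.pHi * P.gHi * P.θbar))) ω)) ∂μ := by
        refine lintegral_mono_ae ?_
        filter_upwards [hae] with ω hω
        by_cases hb : ω ∈ bad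
        · rw [Set.indicator_of_mem hb]
          exact (ENNReal.ofReal_le_ofReal (hω.periodRegret_le hB hL hShock.σ_pos ht)).trans
            (le_add_self.trans le_add_self)
        · have h1 : R.ScoreBounded P T t ω := by
            by_contra h
            exact hb (hbad ▸ Or.inl h)
          have h2 : ‖R.η t ω‖ ≤ PricingModel.samplingRadius d T := by
            by_contra h
            exact hb (hbad ▸ Or.inr (not_le.1 h))
          rw [Set.indicator_of_notMem hb, add_zero, coveredShortfall, Set.indicator_of_mem
            (hω.state_mem_coveringStates hB hL hShock.σ_pos hd ht h1)]
          exact (ENNReal.ofReal_le_ofReal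
            (hω.periodRegret_le_of_scoreBounded hB hL hShock.σ_pos hd ht h1 h2)).trans
            ENNReal.ofReal_add_le
    _ = ∫⁻ ω, coveredShortfall P T (R.state P T t ω) ∂μ
        + (∫⁻ ω, ENNReal.ofReal (P.pHi * P.gHi * (PricingModel.samplingRadius d T + 1)
          * R.widthBound P T t ω) ∂μ
        + ∫⁻ ω, bad.indicator (fun _ => ENNReal.ofReal (3 * (P.pHi * P.gHi * P.θbar))) ω ∂μ) := by
        rw [lintegral_add_left hV, lintegral_add_left' hW]
    _ ≤ _ := by
        gcongr
        exact (lintegral_indicator_const_le _ _).trans (mul_le_mul_right hμ _)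

/-- The expected regret of one period in terms of the expected confidence width. -/
theorem integral_periodRegret_le (hB : P.Bounded) (hL : P.LinkRegular 1 T Δbar) (hd : 0 < d)
    (hT : 10 ≤ T) (hShock : R.SubGaussianShocks P μ 𝓕 T) (hRun : R.IsThompsonRun P μ 𝓕 1 T)
    (hae : ∀ᵐ ω ∂μ, R.RegularPath P T Δbar ω) (hp : 0 ≤ P.pHi) (hgHi : 0 ≤ P.gHi)
    (hne : P.pLo ≤ P.pHi) (ht : t < T) :
    ∫ ω, R.periodRegret P t ω ∂μ
      ≤ P.pHi * P.gHi * (41 * PricingModel.samplingRadius d T + 1)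
          * ∫ ω, R.widthBound P T t ω ∂μ
        + 6 / (T : ℝ) ^ 2 * (P.pHi * P.gHi * P.θbar) := by
  have : Nonempty P.paramSet := ⟨⟨_, hB.θstar_mem⟩⟩
  have hg := hL.differentiable.continuous
  have hσ := hShock.σ_pos
  have hρ := PricingModel.samplingRadius_nonneg d T
  have hθ := hB.θbar_pos.le
  have hint := integrable_widthBound hB hL hShock hRun hae ht
  have hI : 0 ≤ ∫ ω, R.widthBound P T t ω ∂μ :=
    integral_nonneg fun ω => widthBound_nonneg hB hL hσ
  have hscale : ∀ c : ℝ, 0 ≤ c → ∫⁻ ω, ENNReal.ofReal (c * R.widthBound P T t ω) ∂μ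
      = ENNReal.ofReal (c * ∫ ω, R.widthBound P T t ω ∂μ) := fun c hc => by
    rw [← integral_const_mul, ofReal_integral_eq_lintegral_ofReal (hint.const_mul c)]
    exact Filter.Eventually.of_forall fun ω => mul_nonneg hc (widthBound_nonneg hB hL hσ)
  have h1 := lintegral_coveredShortfall_le hB hL hd hT hShock hRun hae hne ht
  have h2 := lintegral_periodRegret_le hB hL hd hShock hRun hae ht
  rw [hscale _ (by positivity)] at h1 h2
  obtain ⟨I, hIdef⟩ : ∃ I, I = ∫ ω, R.widthBound P T t ω ∂μ := ⟨_, rfl⟩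
  rw [← hIdef] at h1 h2 hI ⊢
  -- Dividing by the optimism probability 0.05 multiplies by 20, so the shortfall costs `40ρ`. With
  -- the direct term `ρ + 1` this makes `41ρ + 1`.
  have h3 : ∫⁻ ω, coveredShortfall P T (R.state P T t ω) ∂μ
      ≤ ENNReal.ofReal (20 * (P.pHi * P.gHi * (2 * PricingModel.samplingRadius d T) * I)) := by
    rw [ENNReal.ofReal_mul (by norm_num)]
    refine le_trans (le_of_eq ?_) (mul_le_mul_right h1 _)
    rw [← mul_assoc, ← ENNReal.ofReal_mul (by norm_num)]
    norm_num
  have h4 : ENNReal.ofReal (∫ ω, R.periodRegret P t ω ∂μ)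
      = ∫⁻ ω, ENNReal.ofReal (R.periodRegret P t ω) ∂μ := by
    refine ofReal_integral_eq_lintegral_ofReal (integrable_periodRegret hB hL hσ hRun hae ht) ?_
    filter_upwards [hae] with ω hω using hω.periodRegret_nonneg hg ht
  have h5 := h2.trans (add_le_add h3 le_rfl)
  rw [← h4, ← ENNReal.ofReal_add (by positivity) (by positivity),
    ← ENNReal.ofReal_mul (by positivity), ← ENNReal.ofReal_add (by positivity) (by positivity),
    ← ENNReal.ofReal_add (by positivity) (by positivity),
    ENNReal.ofReal_le_ofReal_iff (by positivity)] at h5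
  refine h5.trans (le_of_eq ?_)
  ring

end Filtered

end PricingRun

end PeriodRegret

/-! ### Summation over periods and numerical constants -/

section TotalRegret

namespace PricingRun

variable {d : ℕ} {Ω : Type*} {P : PricingModel d} {R : PricingRun d Ω} {T : ℕ} {Δbar : ENNReal}

theorem one_le_samplingRadius (hd : 0 < d) (hT : 0 < T) :
    1 ≤ PricingModel.samplingRadius d T := by
  have hd1 : (1 : ℝ) ≤ d := by exact_mod_cast hd
  have hT1 : (1 : ℝ) ≤ T := by exact_mod_cast hT
  have h1 : (4 : ℝ) ≤ 4 * d * T ^ 2 := by nlinarith [one_le_pow₀ hT1 (n := 2)]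
  have h2 : 1 ≤ Real.log (4 * d * T ^ 2) := by
    rw [Real.le_log_iff_exp_le (by linarith)]
    linarith [Real.exp_one_lt_d9]
  have h3 : 1 ≤ √(d * Real.log (4 * d * T ^ 2)) := Real.one_le_sqrt.2 (by nlinarith)
  unfold PricingModel.samplingRadius
  linarith

/-- From `log x ≥ 1 - 1/x` the radicand is at least `T²d / (2d + T) ≥ 1/4`. With `2θbar ≤ alphaBar`
this makes the leading term at least `2θbar`. -/
theorem half_le_sqrt_mul_log (hd : 0 < d) (hT : 0 < T) :
    1 / 2 ≤ √(T * d * Real.log ((2 * d + T) / (2 * d))) := by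
  have hd1 : (1 : ℝ) ≤ d := by exact_mod_cast hd
  have hT1 : (1 : ℝ) ≤ T := by exact_mod_cast hT
  have h1 := Real.one_sub_inv_le_log_of_pos (show 0 < ((2 * d + T) / (2 * d) : ℝ) by positivity)
  have h2 : (T : ℝ) / (2 * d + T) = 1 - ((2 * d + T) / (2 * d) : ℝ)⁻¹ := by
    field_simp
    ring
  rw [← h2] at h1
  refine Real.le_sqrt_of_sq_le ?_
  calc ((1 : ℝ) / 2) ^ 2 ≤ T * d * (T / (2 * d + T)) := by
        rw [mul_div_assoc', le_div_iff₀ (by positivity)]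
        nlinarith [mul_nonneg (sub_nonneg.2 hd1) (sub_nonneg.2 hT1)]
    _ ≤ _ := mul_le_mul_of_nonneg_left h1 (by positivity)

/-- The stated constant is about 24.4, just above the 24 needed to dominate the constant 48 of
`regret_le`. -/
theorem twenty_four_le_constant : 24 ≤ 8 * √(Real.exp 1 * Real.pi) + 1 := by
  have h : (23 / 8 : ℝ) ≤ √(Real.exp 1 * Real.pi) := by
    refine Real.le_sqrt_of_sq_le ?_
    nlinarith [Real.exp_one_gt_d9, Real.pi_gt_d2]
  linarith

theorem sqrt_two_div_sqrt {c : ℝ} : √2 / (2 * √c) = √(2 / c) / 2 := by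
  rw [Real.sqrt_div zero_le_two, mul_comm 2, div_div]

variable {m : MeasurableSpace Ω} {μ : Measure Ω} {𝓕 : Filtration ℕ m} [IsProbabilityMeasure μ]

theorem sum_integral_widthBound_le (hB : P.Bounded) (hL : P.LinkRegular 1 T Δbar) (hd : 0 < d)
    (hShock : R.SubGaussianShocks P μ 𝓕 T) (hRun : R.IsThompsonRun P μ 𝓕 1 T)
    (hae : ∀ᵐ ω ∂μ, R.RegularPath P T Δbar ω) :
    ∑ t ∈ Finset.range T, ∫ ω, R.widthBound P T t ω ∂μ
      ≤ √(2 / P.gLo) * ∫ ω, R.gapSum P 1 T ω ∂μ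
        + P.alphaBar 1 T * (2 * √(T * d * Real.log ((2 * d + T) / (2 * d)))) := by
  have hα := alphaBar_nonneg hB hL hShock.σ_pos
  have hint : ∀ t ∈ Finset.range T, Integrable (R.widthBound P T t) μ := fun _ ht =>
    integrable_widthBound hB hL hShock hRun hae (Finset.mem_range.1 ht)
  have hG := integrable_gapSum hB hL hShock hRun hae
  rw [← integral_finsetSum _ hint]
  calc ∫ ω, ∑ t ∈ Finset.range T, R.widthBound P T t ω ∂μ
      ≤ ∫ ω, (√(2 / P.gLo) * R.gapSum P 1 T ω
        + P.alphaBar 1 T * (2 * √(T * d * Real.log ((2 * d + T) / (2 * d))))) ∂μ := by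
        refine integral_mono_ae (integrable_finsetSum _ hint)
          ((hG.const_mul _).add (integrable_const _)) ?_
        filter_upwards [hae] with ω hω
        simp only [widthBound, Finset.sum_add_distrib, ← Finset.mul_sum]
        exact add_le_add le_rfl (mul_le_mul_of_nonneg_left (hω.sum_matNorm_z_le hB hd) hα)
    _ = _ := by
        rw [integral_add (hG.const_mul _) (integrable_const _), integral_const_mul, integral_const,
          probReal_univ, one_smul]

theorem integral_gapSum_nonneg : 0 ≤ ∫ ω, R.gapSum P 1 T ω ∂μ :=
  integral_nonneg fun _ => Finset.sum_nonneg fun _ _ =>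
    mul_nonneg (Real.sqrt_nonneg _) (matNorm_nonneg _ _)

theorem integral_gapSum_le (hB : P.Bounded) (hL : P.LinkRegular 1 T Δbar) (hd : 0 < d)
    (hShock : R.SubGaussianShocks P μ 𝓕 T) (hRun : R.IsThompsonRun P μ 𝓕 1 T)
    (hae : ∀ᵐ ω ∂μ, R.RegularPath P T Δbar ω) (hΔ : Δbar ≠ ⊤) :
    ∫ ω, R.gapSum P 1 T ω ∂μ
      ≤ √Δbar.toReal * (2 * √(T * d * Real.log ((2 * d + T) / (2 * d)))) := by
  refine (integral_mono_ae (integrable_gapSum hB hL hShock hRun hae)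
    (integrable_const (√Δbar.toReal * (2 * √(T * d * Real.log ((2 * d + T) / (2 * d)))))) ?_).trans
    (le_of_eq (by rw [integral_const, probReal_univ, one_smul]))
  filter_upwards [hae] with ω hω
  refine le_trans ?_ (mul_le_mul_of_nonneg_left (hω.sum_matNorm_z_le hB hd) (Real.sqrt_nonneg _))
  rw [Finset.mul_sum]
  refine Finset.sum_le_sum fun t ht => mul_le_mul_of_nonneg_right (Real.sqrt_le_sqrt ?_)
    (matNorm_nonneg _ _)
  exact (ENNReal.ofReal_le_iff_le_toReal hΔ).1 (hω.gap_le t (Finset.mem_range.1 ht))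

/-- The regret bound with an explicit numerical constant. -/
theorem regret_le (hB : P.Bounded) (hL : P.LinkRegular 1 T Δbar) (hd : 0 < d) (hT : 0 < T)
    (hShock : R.SubGaussianShocks P μ 𝓕 T) (hRun : R.IsThompsonRun P μ 𝓕 1 T)
    (hae : ∀ᵐ ω ∂μ, R.RegularPath P T Δbar ω) (hp : 0 ≤ P.pHi) (hgHi : 0 ≤ P.gHi)
    (hne : P.pLo ≤ P.pHi) :
    R.regret P μ T ≤ P.pHi * P.gHi * (48 * PricingModel.samplingRadius d T
      * (√(2 / P.gLo) * ∫ ω, R.gapSum P 1 T ω ∂μ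
        + P.alphaBar 1 T * (2 * √(T * d * Real.log ((2 * d + T) / (2 * d)))))) := by
  have hρ := one_le_samplingRadius hd hT
  have hA := half_le_sqrt_mul_log hd hT
  have hθ := hB.θbar_pos
  have hα := PricingModel.two_mul_radius_le_alphaBar (T := T) hB hL.gLo_pos hShock.σ_pos
  have hG : 0 ≤ √(2 / P.gLo) * ∫ ω, R.gapSum P 1 T ω ∂μ :=
    mul_nonneg (Real.sqrt_nonneg _) integral_gapSum_nonneg
  have hsum := sum_integral_widthBound_le hB hL hd hShock hRun hae
  have hpg := mul_nonneg hp hgHi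
  have hT1 : (1 : ℝ) ≤ T := by exact_mod_cast hT
  rw [regret_eq_sum hB hL hShock hRun hae]
  obtain ⟨ρ, hρe⟩ : ∃ ρ, ρ = PricingModel.samplingRadius d T := ⟨_, rfl⟩
  obtain ⟨A, hAe⟩ : ∃ A, A = √(T * d * Real.log ((2 * d + T) / (2 * d))) := ⟨_, rfl⟩
  obtain ⟨G, hGe⟩ : ∃ G, G = √(2 / P.gLo) * ∫ ω, R.gapSum P 1 T ω ∂μ := ⟨_, rfl⟩
  rw [← hρe] at hρ ⊢
  rw [← hAe] at hA hsum ⊢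
  rw [← hGe] at hG hsum ⊢
  have hαA : 2 * P.θbar ≤ P.alphaBar 1 T * (2 * A) := by nlinarith
  obtain ⟨W, hW⟩ : ∃ W, W = G + P.alphaBar 1 T * (2 * A) := ⟨_, rfl⟩
  rw [← hW] at hsum ⊢
  have hWθ : 2 * P.θbar ≤ W := by linarith
  have hρW : W ≤ ρ * W := by nlinarith
  -- For `T ≥ 10` the coefficients of `ρ W` are 41, plus 1 from the direct term, plus 3 from `6θbar
  -- ≤ 3W`: 45 in total. For `T < 10` the crude bound `30θbar ≤ 15W` suffices, since truncation
  -- could destroy the probability of optimism.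
  rcases le_or_gt 10 T with h10 | h10
  · have hper : ∀ t ∈ Finset.range T, ∫ ω, R.periodRegret P t ω ∂μ
        ≤ P.pHi * P.gHi * (41 * ρ + 1) * ∫ ω, R.widthBound P T t ω ∂μ
          + 6 / (T : ℝ) ^ 2 * (P.pHi * P.gHi * P.θbar) := fun t ht => by
      rw [hρe]
      exact integral_periodRegret_le hB hL hd h10 hShock hRun hae hp hgHi hne
        (Finset.mem_range.1 ht)
    refine (Finset.sum_le_sum hper).trans ?_
    rw [Finset.sum_add_distrib, ← Finset.mul_sum, Finset.sum_const, Finset.card_range,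
      nsmul_eq_mul]
    have h1 : (T : ℝ) * (6 / (T : ℝ) ^ 2 * (P.pHi * P.gHi * P.θbar))
        ≤ P.pHi * P.gHi * (6 * P.θbar) := by
      have e : (T : ℝ) * (6 / (T : ℝ) ^ 2 * (P.pHi * P.gHi * P.θbar))
          = P.pHi * P.gHi * (6 * P.θbar) / T := by
        field_simp
      rw [e]
      exact div_le_self (by positivity) hT1
    have h2 := mul_le_mul_of_nonneg_left hsum
      (show 0 ≤ P.pHi * P.gHi * (41 * ρ + 1) by positivity)
    have h3 : P.pHi * P.gHi * ((41 * ρ + 1) * W + 6 * P.θbar)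
        ≤ P.pHi * P.gHi * (48 * ρ * W) :=
      mul_le_mul_of_nonneg_left (by linarith) hpg
    linarith
  · have hper : ∀ t ∈ Finset.range T,
        ∫ ω, R.periodRegret P t ω ∂μ ≤ 3 * (P.pHi * P.gHi * P.θbar) := fun t ht => by
      have ht' := Finset.mem_range.1 ht
      refine (integral_mono_ae (integrable_periodRegret hB hL hShock.σ_pos hRun hae ht')
        (integrable_const (3 * (P.pHi * P.gHi * P.θbar))) ?_).trans
        (le_of_eq (by rw [integral_const, probReal_univ, one_smul]))
      filter_upwards [hae] with ω hω using hω.periodRegret_le hB hL hShock.σ_pos ht'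
    refine (Finset.sum_le_sum hper).trans ?_
    rw [Finset.sum_const, Finset.card_range, nsmul_eq_mul]
    have hT9 : (T : ℝ) ≤ 10 := by exact_mod_cast h10.le
    have h1 : (T : ℝ) * (3 * (P.pHi * P.gHi * P.θbar)) ≤ 10 * (3 * (P.pHi * P.gHi * P.θbar)) :=
      mul_le_mul_of_nonneg_right hT9 (by positivity)
    have h3 : P.pHi * P.gHi * (30 * P.θbar) ≤ P.pHi * P.gHi * (48 * ρ * W) :=
      mul_le_mul_of_nonneg_left (by linarith) hpg
    linarith

end PricingRun

end TotalRegret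


/-! ### The regret theorem -/

theorem mainTheorem5 {d : ℕ} (hd : 0 < d) {T : ℕ} (hT : 0 < T)
    {Ω : Type*} {m : MeasurableSpace Ω} (μ : Measure Ω) [IsProbabilityMeasure μ]
    (𝓕 : Filtration ℕ m) (P : PricingModel d) (R : PricingRun d Ω) (Δbar : ENNReal)
    (hBounded : P.Bounded)
    (hLink : P.LinkRegular 1 T Δbar)
    (hShock : R.SubGaussianShocks P μ 𝓕 T)
    (hRun : R.IsThompsonRun P μ 𝓕 1 T)
    (hGap : ∀ᵐ ω ∂μ, ∀ t < T, ENNReal.ofReal (R.gap P 1 t ω) ≤ Δbar) :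
    (Integrable (R.benchmark P T) μ ∧ Integrable (R.collected P T) μ ∧
      Integrable (R.gapSum P 1 T) μ) ∧
    R.regret P μ T
      ≤ 8 * P.gHi * P.pHi * √(d * Real.log (4 * d * T ^ 2))
          * (8 * √(Real.exp 1 * Real.pi) + 1)
          * (P.alphaBar 1 T * √(T * d * Real.log ((2 * d + T) / (2 * d)))
              + √2 / (2 * √P.gLo) * ∫ ω, R.gapSum P 1 T ω ∂μ)
        + 2 * P.pHi ∧
    (Δbar ≠ ⊤ →
      R.regret P μ T
        ≤ 8 * P.pHi * P.gHi * d * (8 * √(Real.exp 1 * Real.pi) + 1)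
            * (P.alphaBar 1 T + √(2 * Δbar.toReal / P.gLo))
            * √(T * Real.log (4 * d * T ^ 2) * Real.log ((2 * d + T) / (2 * d)))
          + 2 * P.pHi) := by
  have hae := hRun.ae_regularPath hBounded hLink hShock.σ_pos hGap
  -- One regular path provides a covariate in `𝒳` and a feasible price, from which the signs of
  -- `pHi` and `gHi` follow.
  obtain ⟨ω₀, hω₀⟩ := hae.exists
  have hp := hBounded.pHi_pos (hω₀.x_mem 0 hT)
  have hgHi := hω₀.gHi_pos hBounded hLink hShock.σ_pos hT
  have hne : P.pLo ≤ P.pHi := (hω₀.p_mem 0 hT).1.trans (hω₀.p_mem 0 hT).2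
  have hα := PricingRun.alphaBar_nonneg hBounded hLink hShock.σ_pos
  have hG : 0 ≤ ∫ ω, R.gapSum P 1 T ω ∂μ := PricingRun.integral_gapSum_nonneg
  have hmain := PricingRun.regret_le hBounded hLink hd hT hShock hRun hae hp.le hgHi.le hne
  have hK := PricingRun.twenty_four_le_constant
  obtain ⟨K, hKe⟩ : ∃ K, K = 8 * √(Real.exp 1 * Real.pi) + 1 := ⟨_, rfl⟩
  rw [← hKe] at hK ⊢
  have hfirst : R.regret P μ T
      ≤ 8 * P.gHi * P.pHi * √(d * Real.log (4 * d * T ^ 2)) * K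
          * (P.alphaBar 1 T * √(T * d * Real.log ((2 * d + T) / (2 * d)))
              + √2 / (2 * √P.gLo) * ∫ ω, R.gapSum P 1 T ω ∂μ)
        + 2 * P.pHi := by
    rw [PricingRun.sqrt_two_div_sqrt]
    have h1 : 0 ≤ 8 * P.gHi * P.pHi * √(d * Real.log (4 * d * T ^ 2))
        * (P.alphaBar 1 T * √(T * d * Real.log ((2 * d + T) / (2 * d)))
          + √(2 / P.gLo) / 2 * ∫ ω, R.gapSum P 1 T ω ∂μ) := by positivity
    -- With `ρ = 2√(d log(4dT²))`, the bound `48ρ (G + 2αA)` equals `8 · 24 · √(d log(4dT²)) (αA +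
    -- G/2)`; the summand `2 pHi` need only be nonnegative.
    have h2 := mul_le_mul_of_nonneg_right hK h1
    rw [PricingModel.samplingRadius] at hmain
    linarith
  refine ⟨⟨PricingRun.integrable_benchmark hBounded hLink hShock.σ_pos hRun hae,
    PricingRun.integrable_collected hBounded hLink hShock hRun hae,
    PricingRun.integrable_gapSum hBounded hLink hShock hRun hae⟩, hfirst, fun hΔ => ?_⟩
  have hgap := PricingRun.integral_gapSum_le hBounded hLink hd hShock hRun hae hΔ
  have hd0 : (0 : ℝ) ≤ d := Nat.cast_nonneg d
  have hK0 : 0 ≤ K := by linarith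
  have hdlog : 0 ≤ (d : ℝ) * Real.log (4 * d * T ^ 2) := by
    have h : (1 : ℝ) ≤ 4 * d * T ^ 2 := by
      have hd1 : (1 : ℝ) ≤ d := by exact_mod_cast hd
      have hT1 : (1 : ℝ) ≤ (T : ℝ) ^ 2 := one_le_pow₀ (by exact_mod_cast hT)
      nlinarith
    exact mul_nonneg hd0 (Real.log_nonneg h)
  have hsqrt : √(d * Real.log (4 * d * T ^ 2)) * √(T * d * Real.log ((2 * d + T) / (2 * d)))
      = d * √(T * Real.log (4 * d * T ^ 2) * Real.log ((2 * d + T) / (2 * d))) := by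
    rw [← Real.sqrt_mul hdlog, show (d : ℝ) * Real.log (4 * d * T ^ 2)
      * (T * d * Real.log ((2 * d + T) / (2 * d)))
      = d ^ 2 * (T * Real.log (4 * d * T ^ 2) * Real.log ((2 * d + T) / (2 * d))) by ring,
      Real.sqrt_mul (by positivity), Real.sqrt_sq hd0]
  have hΔe : √(2 * Δbar.toReal / P.gLo) = √(2 / P.gLo) * √Δbar.toReal := by
    rw [← Real.sqrt_mul (div_nonneg zero_le_two hLink.gLo_pos.le), div_mul_eq_mul_div]
  refine hfirst.trans (add_le_add ?_ le_rfl)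
  rw [PricingRun.sqrt_two_div_sqrt, hΔe]
  have hcoef : 0 ≤ 8 * P.gHi * P.pHi * √(d * Real.log (4 * d * T ^ 2)) * K := by positivity
  have hinner : √(2 / P.gLo) / 2 * ∫ ω, R.gapSum P 1 T ω ∂μ
      ≤ √(2 / P.gLo) * √Δbar.toReal * √(T * d * Real.log ((2 * d + T) / (2 * d))) := by
    refine (mul_le_mul_of_nonneg_left hgap (by positivity)).trans (le_of_eq ?_)
    ring
  refine (mul_le_mul_of_nonneg_left (add_le_add le_rfl hinner) hcoef).trans (le_of_eq ?_)
  rw [← add_mul]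
  calc 8 * P.gHi * P.pHi * √(d * Real.log (4 * d * T ^ 2)) * K
        * ((P.alphaBar 1 T + √(2 / P.gLo) * √Δbar.toReal)
          * √(T * d * Real.log ((2 * d + T) / (2 * d))))
      = 8 * P.pHi * P.gHi * K * (P.alphaBar 1 T + √(2 / P.gLo) * √Δbar.toReal)
        * (√(d * Real.log (4 * d * T ^ 2))
          * √(T * d * Real.log ((2 * d + T) / (2 * d)))) := by ring
    _ = _ := by rw [hsqrt]; ring
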